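/- **Setting.** An online convex optimization (OCO) instance consists of a compact convex set $\mathcal K\subseteq\mathbb R^d$, a starting point $x^{(1)}\in\mathcal K$, a horizon $T$ and (random, oblivious) convex losses $f^{(1)},\dots,f^{(T)}$. A linear loss is called $S$-sparse if it has the form $f(x)=-\langle c,x\rangle$ with $c\in\{0,1\}^d$ having at most $S$ nonzero coordinates. Online mirror descent (OMD) with mirror map $h$ and step size $\eta$ plays $$x^{(t+1)}=\arg\min_{x\in\mathcal K}\ \langle\nabla f^{(t)}(x^{(t)}),x\rangle+\tfrac1\eta B_h(x\|x^{(t)}),\qquad B_h(x\|y)=h(x)-h(y)-\langle\nabla h(y),x-y\rangle,$$ and its regret is $\sum_{t\le T}f^{(t)}(x^{(t)})-\min_{x\in\mathcal K}\sum_{t\le T}f^{(t)}(x)$. For $n\mid d$ let $(B_1,\dots,B_n)$ be a uniformly random partition of $[d]$ into $n$ blocks of equal size, fixed in advance and independent of the losses. The $n$-th block norm is $\|x\|_{[n]}=\sum_j\|x_{B_j}\|_2$, with dual norm $\max_j\|x_{B_j}\|_2$ and mirror map $h_n(x)=\frac1{\gamma_np_n}\sum_j\|x_{B_j}\|_2^{p_n}$,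 where $\gamma_1=1$, $\gamma_2=\frac12$, $p_1=p_2=2$, and $\gamma_n=\frac1{e\ln n}$, $p_n=1+\frac1{\ln n}$ for $n>2$. If $R=\max_{x\in\mathcal K}\|x\|_{[n]}>1$, OMD is run on the rescaled body $\mathcal K/R$ with start $x^{(1)}/R$ and losses $z\mapsto f^{(t)}(Rz)$. OPGD is the case $n=1$. The entropic mirror map is $\sum_ix_i\ln x_i$, with norm $\|\cdot\|_1$ and dual norm $\|\cdot\|_\infty$. Every algorithm uses a constant step size $\eta=\kappa\, D/(G\sqrt T)$, where $D=\sqrt{\max_{z\in\mathcal K}B_h(z\|x^{(1)})}$, $G=\max_{t\le T,\,x\in\mathcal K}\sqrt{\mathbb E\|\nabla f^{(t)}(x)\|_*^2}$ (both computed for the rescaled instance when rescaling is used), and $\kappa>0$ is a constant that may be chosen separately for each algorithm. Expectations are over the random partition and the losses; $\mathrm{regret}_n$ is the regret of OMD with $h_n$ and $\mathrm{regret}_{\rm euc}=\mathrm{regret}_1$. The constants implicit in $\Omega$ and $\widetilde\Omega$, and the thresholds for "sufficiently large", depend only on the constants $\kappa$, and $\widetilde\Omega$ hides powers of $\ln d$.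 **Theorem.** Let $\mathbf\Delta_d$ be the probability simplex in $\mathbb R^d$. 1. There is a family of OCO instances, one for every perfect cube $d\ge1$ and every $T$, with $\mathcal K_d=\mathrm{conv}(\mathbf\Delta_d\cup\{d^{-2/3}\mathbf 1_d\})$ and $d^{1/3}$-sparse linear losses, such that for any choice of the constants $\kappa$, for all sufficiently large perfect cubes $d$ and all $T\ge d^{1/3}$, $\mathbb E[\mathrm{regret}_{d^{1/3}}(T)]>0$ and $$\min\{\mathbb E[\mathrm{regret}_{\rm euc}(T)],\mathbb E[\mathrm{regret}_{d}(T)]\}\ \ge\ \widetilde\Omega(d^{1/6})\cdot\mathbb E[\mathrm{regret}_{d^{1/3}}(T)].$$ Here OMD with $h_d$ plays the role of online exponentiated gradient (OEG), since $\mathcal K_d\not\subseteq\mathbf\Delta_d$. 2. There is a family of OCO instances, one for every $d\ge1$ and $T$, with $\mathcal K_d=\mathbf\Delta_d$ and $\lfloor\ln d\rfloor$-sparse linear losses, such that for any choice of the constants $\kappa$, for all sufficiently large $d$, all $T\ge\ln d$ and every divisor $n$ of $d$ with $\frac12\ln d\le n\le2\ln d$, $\mathbb E[\mathrm{regret}_{n}(T)]>0$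 and $$\min\{\mathbb E[\mathrm{regret}_{\rm euc}(T)],\mathbb E[\mathrm{regret}_{\rm ent}(T)]\}\ \ge\ \Omega\!\left(\frac{\sqrt{\ln d}}{\ln\ln d}\right)\mathbb E[\mathrm{regret}_{n}(T)],$$ both when $\mathrm{regret}_{\rm ent}$ is the regret of OMD with the entropic mirror map (OEG) and when it is that of OMD with $h_d$ (with the same constant $\kappa$ for both). -/

import Mathlib

noncomputable section

namespace OCO

/-! ### Gradients, Bregman divergences and online mirror descent -/

/-- The gradient of `f : ℝ^d → ℝ` at `x`, as the vector of partial derivatives. -/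
def grad {d : ℕ} (f : (Fin d → ℝ) → ℝ) (x : Fin d → ℝ) : Fin d → ℝ :=
  fun i => fderiv ℝ f x (Pi.single i 1)

/-- The Bregman divergence `B_h(x ‖ y) = h(x) - h(y) - ⟨∇h(y), x - y⟩`. -/
def bregman {d : ℕ} (h : (Fin d → ℝ) → ℝ) (x y : Fin d → ℝ) : ℝ :=
  h x - h y - ∑ i, grad h y i * (x i - y i)

/-- The objective of one mirror descent update from the point `x` with loss gradient `g` and step
size `η`. It is `η` times `⟨g, z⟩ + B_h(z ‖ x) / η`, so that for `η > 0` the minimizers agree. -/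
def omdObjective {d : ℕ} (h : (Fin d → ℝ) → ℝ) (η : ℝ) (g x z : Fin d → ℝ) : ℝ :=
  η * ∑ i, g i * z i + bregman h z x

/-- One mirror descent update: the minimizer over `K` of `⟨g, z⟩ + B_h(z ‖ x) / η`. -/
def omdStep {d : ℕ} (K : Set (Fin d → ℝ)) (h : (Fin d → ℝ) → ℝ) (η : ℝ) (g x : Fin d → ℝ) :
    Fin d → ℝ :=
  Classical.epsilon fun z => z ∈ K ∧ IsMinOn (omdObjective h η g x) K z

/-- The update is a genuine minimizer whenever `K` is compact and `h` is continuous. -/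
theorem omdStep_spec {d : ℕ} {K : Set (Fin d → ℝ)} {h : (Fin d → ℝ) → ℝ} (hK : IsCompact K)
    (hne : K.Nonempty) (hh : ContinuousOn h K) (η : ℝ) (g x : Fin d → ℝ) :
    omdStep K h η g x ∈ K ∧ IsMinOn (omdObjective h η g x) K (omdStep K h η g x) := by
  have hc : ContinuousOn (omdObjective h η g x) K := by
    unfold omdObjective bregman
    fun_prop
  obtain ⟨z, hz, hmin⟩ := hK.exists_isMinOn hne hc
  exact Classical.epsilon_spec
    (p := fun z => z ∈ K ∧ IsMinOn (omdObjective h η g x) K z) ⟨z, hz, hmin⟩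

/-- The iterates of online mirror descent with constant step size `η`, started at `x₁`; the index
`t = 0, 1, …` stands for the rounds `1, 2, …`. -/
def omdIter {d : ℕ} (K : Set (Fin d → ℝ)) (h : (Fin d → ℝ) → ℝ) (η : ℝ)
    (f : ℕ → (Fin d → ℝ) → ℝ) (x₁ : Fin d → ℝ) : ℕ → (Fin d → ℝ)
  | 0 => x₁
  | t + 1 => omdStep K h η (grad (f t) (omdIter K h η f x₁ t)) (omdIter K h η f x₁ t)

/-- The regret over `T` rounds of the played points `x` against the best fixed point of `K`. -/
def regret {d : ℕ} (K : Set (Fin d → ℝ)) (T : ℕ) (f : ℕ → (Fin d → ℝ) → ℝ)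
    (x : ℕ → (Fin d → ℝ)) : ℝ :=
  ∑ t ∈ Finset.range T, f t (x t) - sInf ((fun z => ∑ t ∈ Finset.range T, f t z) '' K)

/-- The diameter `√(max_{z ∈ K} B_h(z ‖ x₁))`. -/
def diameter {d : ℕ} (K : Set (Fin d → ℝ)) (h : (Fin d → ℝ) → ℝ) (x₁ : Fin d → ℝ) : ℝ :=
  Real.sqrt (sSup ((fun z => bregman h z x₁) '' K))

/-! ### Instances of online convex optimization -/

/-- An instance of online convex optimization in `ℝ^d` with oblivious random losses: a convex body
`K`, a starting point, a horizon `T`, a finite probability space `Ω` and random convex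
differentiable losses; `loss t ω` is the loss of round `t + 1` in the outcome `ω`. -/
structure OCOInstance (d : ℕ) where
  K : Set (Fin d → ℝ)
  K_convex : Convex ℝ K
  K_compact : IsCompact K
  start : Fin d → ℝ
  start_mem : start ∈ K
  T : ℕ
  Ω : Type
  fintypeΩ : Fintype Ω
  prob : Ω → ℝ
  prob_nonneg : ∀ ω, 0 ≤ prob ω
  prob_sum : ∑ ω, prob ω = 1
  loss : ℕ → Ω → (Fin d → ℝ) → ℝ
  loss_convex : ∀ t ω, ConvexOn ℝ Set.univ (loss t ω)
  loss_differentiable : ∀ t ω, Differentiable ℝ (loss t ω)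

attribute [instance] OCOInstance.fintypeΩ

/-- All losses are linear and `S`-sparse: `x ↦ -⟨c, x⟩` for a `0`-`1` vector `c` with at most `S`
nonzero coordinates. -/
def OCOInstance.SparseLinear {d : ℕ} (I : OCOInstance d) (S : ℕ) : Prop :=
  ∀ t ω, ∃ c : Fin d → ℝ, (∀ i, c i = 0 ∨ c i = 1) ∧ ∑ i, c i ≤ S ∧
    ∀ x, I.loss t ω x = -∑ i, c i * x i

/-! ### Geometries: a mirror map, a norm and the dual norm -/

/-- The data that a run of mirror descent uses: a mirror map, a norm and its dual norm. -/
structure Geometry (d : ℕ) where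
  mirror : (Fin d → ℝ) → ℝ
  norm : (Fin d → ℝ) → ℝ
  dualNorm : (Fin d → ℝ) → ℝ

/-- The partitions of the `d` coordinates into `n` (labelled) blocks of equal size `d / n`. Every
unlabelled partition has `n!` labellings, so the uniform distributions correspond. -/
abbrev EqualPartition (d n : ℕ) : Type :=
  {β : Fin d → Fin n // ∀ j, n * (Finset.univ.filter fun i => β i = j).card = d}

/-- The Euclidean norm of the `j`-th block of `x`. -/
def blockL2 {d n : ℕ} (β : EqualPartition d n) (x : Fin d → ℝ) (j : Fin n) : ℝ :=
  Real.sqrt (∑ i ∈ Finset.univ.filter (fun i => β.1 i = j), x i ^ 2)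

/-- `γ_n`. -/
def gam (n : ℕ) : ℝ :=
  if n = 1 then 1 else if n = 2 then 1 / 2 else 1 / (Real.exp 1 * Real.log n)

/-- The exponent `p_n`. -/
def pexp (n : ℕ) : ℝ :=
  if n ≤ 2 then 2 else 1 + 1 / Real.log n

/-- The block norm geometry: the mirror map `h_n(x) = (γ_n p_n)⁻¹ ∑_j ‖x_{B_j}‖₂ ^ p_n`, the block
norm `∑_j ‖x_{B_j}‖₂` and the dual norm `max_j ‖x_{B_j}‖₂`. -/
def blockGeometry {d n : ℕ} (β : EqualPartition d n) : Geometry d where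
  mirror x := 1 / (gam n * pexp n) * ∑ j, blockL2 β x j ^ pexp n
  norm x := ∑ j, blockL2 β x j
  dualNorm x := ⨆ j, blockL2 β x j

/-- The entropic geometry: the mirror map `∑ x_i ln x_i` with the `L₁` norm and its dual. -/
def entGeometry (d : ℕ) : Geometry d where
  mirror x := ∑ i, x i * Real.log (x i)
  norm x := ∑ i, |x i|
  dualNorm x := ⨆ i, |x i|

/-! ### Expected regret of mirror descent in a random geometry -/

namespace OCOInstance

variable {d : ℕ} (I : OCOInstance d)

/-- The factor by which `K` is shrunk in order to fit into the unit ball; it is `1` if `K` already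
lies there. -/
def scale (G : Geometry d) : ℝ := max 1 (sSup (G.norm '' I.K))

/-- The rescaled body `K / R`. -/
def scaledK (G : Geometry d) : Set (Fin d → ℝ) := (fun x => (I.scale G)⁻¹ • x) '' I.K

/-- The rescaled starting point `x₁ / R`. -/
def scaledStart (G : Geometry d) : Fin d → ℝ := (I.scale G)⁻¹ • I.start

/-- The rescaled losses `z ↦ f(R z)` on `K / R`, which is `R f` if `f` is linear. -/
def scaledLoss (G : Geometry d) (ω : I.Ω) (t : ℕ) (z : Fin d → ℝ) : ℝ :=
  I.loss t ω (I.scale G • z)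

/-- The gradient bound `max_{t, x} √(E ‖∇f_t(x)‖_*²)` of the (rescaled) losses, where `x` ranges
over `K` and the expectation is over the losses and over the geometry `𝒢 b`, `b : ι` uniform. -/
def gradBound {ι : Type} [Fintype ι] (𝒢 : ι → Geometry d) : ℝ :=
  Real.sqrt (sSup {v : ℝ | ∃ t < I.T, ∃ x ∈ I.K,
    v = (Fintype.card ι : ℝ)⁻¹ * ∑ b, ∑ ω, I.prob ω *
      (𝒢 b).dualNorm (grad (I.scaledLoss (𝒢 b) ω t) ((I.scale (𝒢 b))⁻¹ • x)) ^ 2})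

/-- The step size `κ D / (G √T)` in the geometry `𝒢 b`. -/
def stepSize (κ : ℝ) {ι : Type} [Fintype ι] (𝒢 : ι → Geometry d) (b : ι) : ℝ :=
  κ * diameter (I.scaledK (𝒢 b)) (𝒢 b).mirror (I.scaledStart (𝒢 b)) /
    (I.gradBound 𝒢 * Real.sqrt I.T)

/-- The expected regret of online mirror descent on the (rescaled) instance with step size
`κ D / (G √T)`, where the geometry `𝒢 b` is drawn uniformly in advance, independently of the
losses, and the expectation is over this choice and over the losses. -/
def expRegret (κ : ℝ) {ι : Type} [Fintype ι] (𝒢 : ι → Geometry d) : ℝ :=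
  (Fintype.card ι : ℝ)⁻¹ * ∑ b, ∑ ω, I.prob ω *
    regret (I.scaledK (𝒢 b)) I.T (I.scaledLoss (𝒢 b) ω)
      (omdIter (I.scaledK (𝒢 b)) (𝒢 b).mirror (I.stepSize κ 𝒢 b) (I.scaledLoss (𝒢 b) ω)
        (I.scaledStart (𝒢 b)))

/-- The expected regret of mirror descent with the `n`-th block norm (random equal partition). -/
def blockRegret (κ : ℝ) (n : ℕ) : ℝ :=
  I.expRegret κ fun β : EqualPartition d n => blockGeometry β

/-- The expected regret of online projected gradient descent: `n = 1` block, for which the mirror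
map is `‖x‖₂² / 2`. -/
def eucRegret (κ : ℝ) : ℝ := I.blockRegret κ 1

/-- The expected regret of online exponentiated gradient, with the entropic mirror map. -/
def entRegret (κ : ℝ) : ℝ :=
  I.expRegret κ fun _ : Unit => entGeometry d

end OCOInstance

/-- The polytope `conv(Δ_d ∪ {d^{-2/3} 1_d})`. -/
def polytope (d : ℕ) : Set (Fin d → ℝ) :=
  convexHull ℝ (stdSimplex ℝ (Fin d) ∪ {fun _ => (d : ℝ) ^ (-(2 / 3) : ℝ)})

end OCO

end

namespace OCO

/-! ### Gradients and first-order optimality -/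

/-! Both families use deterministic losses. The sparse vector of a round is coordinate `0` together
with one of `d / S` disjoint groups of `S - 1` coordinates, and the groups are used cyclically. The
vertex `e` at coordinate `0` earns the maximal gain `1` in every round, so regret is the total gain
missed (`regret_eq`). The other coordinates are distractions: they inflate gradients, but each is
useful only once per cycle.

Upper bound (`blockRegret_le`). For `2 < n` and a body in the nonnegative unit ball, `h_n` is
strongly convex in the block norm with `D² ≤ e ln n`. A random equal partition spreads at most `2n`
ones so evenly over the `n` blocks that the expected maximal load is `O(ln n)`, hence `G² = O(ln
n)`. The standard regret bound then gives `O(ln n √T)`. It is applied with `n = m = d^{1/3}` on the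
polytope and with `n` of order `ln d` on the simplex.

Lower bounds (`le_expRegret_of_stepSize_le`). A small step size keeps the gain at most `1/2` for
many rounds, each costing regret at least `1/2`, while no round has negative regret. Euclidean: `G ≥
√S` and `D ≤ 1` give `η ≤ κ / √(S T)`. A coordinate grows by at most `η` per use, so the gain stays
low for about `√(S T)` rounds. Entropy or `h_d` on the simplex: `G ≥ 1` and `D² = O(ln d)` give `η =
O(√(ln d / T))`. To climb from `1/d` past `d^{-3/4}`, a coordinate needs `η t` of order `ln d`,
which takes about `√(T ln d)` rounds. `h_d` on the polytope: the constant vertex has norm `m`, so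
the body is shrunk by `m` and the gradients grow to at least `m`, which makes `η` tiny. A potential
argument (`polytope_potential_step`) keeps the iterate near the constant vertex, whose gain is only
`1/m`, for at least order `√(m T)` rounds.

The ratios are `√m / ln d`, with `√m = d^{1/6}`, on the polytope, and `√(ln d) / ln ln d` on the
simplex, where `S = ⌊ln d⌋`. -/

theorem fderiv_eq_sum_grad {d : ℕ} (f : (Fin d → ℝ) → ℝ) (x v : Fin d → ℝ) :
    fderiv ℝ f x v = ∑ i, grad f x i * v i := by
  have h := LinearMap.pi_apply_eq_sum_univ (fderiv ℝ f x).toLinearMap v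
  simp only [ContinuousLinearMap.coe_coe, smul_eq_mul] at h
  rw [h]
  refine Finset.sum_congr rfl fun i _ => ?_
  rw [mul_comm]
  congr 2
  ext j
  simp [Pi.single_apply, eq_comm]

theorem hasFDerivAt_linear {d : ℕ} (c x : Fin d → ℝ) :
    HasFDerivAt (fun x : Fin d → ℝ => ∑ i, c i * x i)
      (∑ i, c i • ContinuousLinearMap.proj (R := ℝ) (φ := fun _ : Fin d => ℝ) i) x := by
  refine HasFDerivAt.fun_sum fun i _ => ?_
  exact ((ContinuousLinearMap.proj (R := ℝ) (φ := fun _ : Fin d => ℝ) i).hasFDerivAt).const_mul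
    (c i)

theorem grad_linear {d : ℕ} (c x : Fin d → ℝ) :
    grad (fun x : Fin d → ℝ => ∑ i, c i * x i) x = c := by
  ext j
  simp [grad, (hasFDerivAt_linear c x).fderiv, Pi.single_apply]

/-- The first-order optimality condition for a mirror descent update. -/
theorem first_order_of_isMinOn {d : ℕ} {K : Set (Fin d → ℝ)} (hK : Convex ℝ K)
    {h : (Fin d → ℝ) → ℝ} {η : ℝ} {g x y : Fin d → ℝ} (hy : y ∈ K)
    (hmin : IsMinOn (omdObjective h η g x) K y) (hd : DifferentiableAt ℝ h y)
    {z : Fin d → ℝ} (hz : z ∈ K) :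
    0 ≤ ∑ i, (η * g i + grad h y i - grad h x i) * (z i - y i) := by
  have hobj : HasFDerivAt (omdObjective h η g x)
      (η • (∑ i, g i • ContinuousLinearMap.proj (R := ℝ) (φ := fun _ : Fin d => ℝ) i) +
        (fderiv ℝ h y -
          ∑ i, grad h x i • ContinuousLinearMap.proj (R := ℝ) (φ := fun _ : Fin d => ℝ) i)) y := by
    have e : omdObjective h η g x = fun z => η * (∑ i, g i * z i) +
        ((h z - h x + ∑ i, grad h x i * x i) - ∑ i, grad h x i * z i) := by
      funext z
      simp only [omdObjective, bregman, mul_sub, Finset.sum_sub_distrib]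
      ring
    rw [e]
    exact ((hasFDerivAt_linear g y).const_mul η).add
      (((hd.hasFDerivAt.sub_const _).add_const _).sub (hasFDerivAt_linear _ y))
  have h0 := (IsMinOn.localize hmin).hasFDerivWithinAt_nonneg hobj.hasFDerivWithinAt
    (sub_mem_posTangentConeAt_of_segment_subset (hK.segment_subset hy hz))
  refine h0.trans_eq ?_
  simp only [add_apply, smul_apply, sub_apply, sum_apply, ContinuousLinearMap.proj_apply,
    fderiv_eq_sum_grad, Pi.sub_apply, smul_eq_mul, Finset.mul_sum]
  rw [← Finset.sum_sub_distrib, ← Finset.sum_add_distrib]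
  exact Finset.sum_congr rfl fun i _ => by ring

theorem omdIter_mem {d : ℕ} {K : Set (Fin d → ℝ)} (hK : IsCompact K)
    {h : (Fin d → ℝ) → ℝ} (hh : ContinuousOn h K) (η : ℝ) (f : ℕ → (Fin d → ℝ) → ℝ)
    {x₁ : Fin d → ℝ} (hx : x₁ ∈ K) (t : ℕ) : omdIter K h η f x₁ t ∈ K := by
  cases t with
  | zero => exact hx
  | succ t => exact (omdStep_spec hK ⟨x₁, hx⟩ hh _ _ _).1

/-- The variational inequality satisfied by consecutive iterates. -/
theorem omdIter_first_order {d : ℕ} {K : Set (Fin d → ℝ)} (hK : IsCompact K) (hc : Convex ℝ K)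
    {h : (Fin d → ℝ) → ℝ} (hh : Differentiable ℝ h) (η : ℝ) (f : ℕ → (Fin d → ℝ) → ℝ)
    {x₁ : Fin d → ℝ} (hx : x₁ ∈ K) (t : ℕ) {z : Fin d → ℝ} (hz : z ∈ K) :
    0 ≤ ∑ i, (η * grad (f t) (omdIter K h η f x₁ t) i + grad h (omdIter K h η f x₁ (t + 1)) i
      - grad h (omdIter K h η f x₁ t) i) * (z i - omdIter K h η f x₁ (t + 1) i) :=
  have hs := omdStep_spec hK ⟨x₁, hx⟩ hh.continuous.continuousOn η
    (grad (f t) (omdIter K h η f x₁ t)) (omdIter K h η f x₁ t)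
  first_order_of_isMinOn hc hs.1 hs.2 (hh _) hz

/-- The standard regret bound of mirror descent for a mirror map whose Bregman divergence
dominates a quarter of the squared norm. -/
theorem omd_linearized_regret_le {d : ℕ} {K : Set (Fin d → ℝ)} (hK : IsCompact K)
    (hc : Convex ℝ K) {h : (Fin d → ℝ) → ℝ} (hh : Differentiable ℝ h) {η : ℝ} (hη : 0 < η)
    (f : ℕ → (Fin d → ℝ) → ℝ) {x₁ : Fin d → ℝ} (hx : x₁ ∈ K) (g : ℕ → Fin d → ℝ)
    (hg : ∀ t x, grad (f t) x = g t) (N Nd : (Fin d → ℝ) → ℝ)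
    (hsc : ∀ x ∈ K, ∀ y ∈ K, N (y - x) ^ 2 / 4 ≤ bregman h x y)
    (hdual : ∀ u v : Fin d → ℝ, ∑ i, u i * v i ≤ Nd u * N v)
    {z : Fin d → ℝ} (hz : z ∈ K) (T : ℕ) :
    ∑ t ∈ Finset.range T, ∑ i, g t i * (omdIter K h η f x₁ t i - z i) ≤
      bregman h z x₁ / η + η * ∑ t ∈ Finset.range T, Nd (g t) ^ 2 := by
  set X := omdIter K h η f x₁ with hX
  have hmem : ∀ t, X t ∈ K := omdIter_mem hK hh.continuous.continuousOn η f hx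
  have key : ∀ t, η * ∑ i, g t i * (X t i - z i) ≤
      bregman h z (X t) - bregman h z (X (t + 1)) + η ^ 2 * Nd (g t) ^ 2 := by
    intro t
    have h1 := omdIter_first_order hK hc hh η f hx t hz
    rw [← hX, hg] at h1
    have h2 := hsc _ (hmem (t + 1)) _ (hmem t)
    have h3 := hdual (g t) (X t - X (t + 1))
    -- Three-point identity for Bregman divergences. The subtracted sum is nonnegative by
    -- first-order optimality, and the two divergences to `z` telescope over the rounds.
    have h4 : η * ∑ i, g t i * (X t i - z i) = η * ∑ i, g t i * (X t - X (t + 1)) i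
        - ∑ i, (η * g t i + grad h (X (t + 1)) i - grad h (X t) i) * (z i - X (t + 1) i)
        + bregman h z (X t) - bregman h z (X (t + 1)) - bregman h (X (t + 1)) (X t) := by
      simp only [bregman, Pi.sub_apply, Finset.mul_sum]
      have e1 : ∀ i, η * (g t i * (X t i - z i)) = η * (g t i * (X t i - X (t + 1) i))
          - (η * g t i + grad h (X (t + 1)) i - grad h (X t) i) * (z i - X (t + 1) i)
          - grad h (X t) i * (z i - X t i) + grad h (X (t + 1)) i * (z i - X (t + 1) i)
          + grad h (X t) i * (X (t + 1) i - X t i) := fun i => by ring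
      rw [Finset.sum_congr rfl fun i _ => e1 i]
      simp only [Finset.sum_add_distrib, Finset.sum_sub_distrib]
      ring
    have h5 : η * ∑ i, g t i * (X t - X (t + 1)) i ≤ η * (Nd (g t) * N (X t - X (t + 1))) :=
      mul_le_mul_of_nonneg_left h3 hη.le
    -- Young's inequality `η Nd N ≤ η² Nd² + N² / 4`; the last term is absorbed by the divergence of
    -- the step, which is where the quarter in `hsc` is used.
    nlinarith [sq_nonneg (η * Nd (g t) - N (X t - X (t + 1)) / 2)]
  have tel : ∀ T, η * ∑ t ∈ Finset.range T, ∑ i, g t i * (X t i - z i) ≤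
      bregman h z (X 0) - bregman h z (X T) + η ^ 2 * ∑ t ∈ Finset.range T, Nd (g t) ^ 2 := by
    intro T
    induction T with
    | zero => simp
    | succ T ih =>
      rw [Finset.sum_range_succ, Finset.sum_range_succ, mul_add, mul_add]
      linarith [key T]
  have hpos : 0 ≤ bregman h z (X T) := le_trans (by positivity) (hsc z hz _ (hmem T))
  have h6 := tel T
  have h7 : X 0 = x₁ := rfl
  rw [h7] at h6
  have h8 : bregman h z x₁ / η + η * ∑ t ∈ Finset.range T, Nd (g t) ^ 2 =
      (bregman h z x₁ + η ^ 2 * ∑ t ∈ Finset.range T, Nd (g t) ^ 2) / η := by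
    field_simp
  rw [h8, le_div_iff₀ hη]
  linarith

/-! ### A quantitative convexity inequality for powers of the norm -/

/-- The difference of the two sides vanishes at `a = 1` and is decreasing, because its derivative is
nonpositive by Bernoulli's inequality for the exponent `p - 1 ≤ 1`. -/
theorem rpow_bregman_le_one {p a : ℝ} (hp : 1 < p) (hp2 : p ≤ 2) (ha : 0 ≤ a) (ha1 : a ≤ 1) :
    p * (p - 1) / 2 * (a - 1) ^ 2 ≤ a ^ p + (p - 1) - p * a := by
  have hanti : AntitoneOn (fun a : ℝ => a ^ p + (p - 1) - p * a - p * (p - 1) / 2 * (a - 1) ^ 2)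
      (Set.Ici 0) := by
    have hder : ∀ x : ℝ, HasDerivAt
        (fun a : ℝ => a ^ p + (p - 1) - p * a - p * (p - 1) / 2 * (a - 1) ^ 2)
        (p * x ^ (p - 1) - p - p * (p - 1) * (x - 1)) x := by
      intro x
      have h1 := Real.hasDerivAt_rpow_const (x := x) (p := p) (Or.inr hp.le)
      have h2 := (((hasDerivAt_id x).sub_const 1).pow 2).const_mul (p * (p - 1) / 2)
      have h3 := (hasDerivAt_id x).const_mul p
      refine (((h1.add_const (p - 1)).sub h3).sub h2).congr_deriv ?_
      simp
      ring
    refine antitoneOn_of_deriv_nonpos (convex_Ici 0)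
      (fun x _ => (hder x).continuousAt.continuousWithinAt)
      (fun x _ => (hder x).differentiableAt.differentiableWithinAt) fun x hx => ?_
    rw [interior_Ici] at hx
    rw [(hder x).deriv]
    have hx0 : (0 : ℝ) < x := hx
    have := rpow_one_add_le_one_add_mul_self (s := x - 1) (by linarith) (p := p - 1)
      (by linarith) (by linarith)
    rw [add_sub_cancel] at this
    nlinarith
  have h := hanti (a := a) ha (b := 1) (by simp) ha1
  simp only [Real.one_rpow] at h
  linarith

/-- The complementary case, with the larger argument normalized to `1`. The difference vanishes at
`b = 1` and has derivative `-p (p - 1) (1 - b) (b ^ (p - 2) - 1) ≤ 0`. -/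
theorem rpow_bregman_ge_one {p b : ℝ} (hp : 1 < p) (hp2 : p ≤ 2) (hb : 0 < b) (hb1 : b ≤ 1) :
    p * (p - 1) / 2 * (1 - b) ^ 2 ≤ 1 + (p - 1) * b ^ p - p * b ^ (p - 1) := by
  have hanti : AntitoneOn
      (fun b : ℝ => 1 + (p - 1) * b ^ p - p * b ^ (p - 1) - p * (p - 1) / 2 * (1 - b) ^ 2)
      (Set.Ioc 0 1) := by
    have hder : ∀ x : ℝ, 0 < x → HasDerivAt
        (fun b : ℝ => 1 + (p - 1) * b ^ p - p * b ^ (p - 1) - p * (p - 1) / 2 * (1 - b) ^ 2)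
        (p * (p - 1) * (x ^ (p - 1) - x ^ (p - 2) + (1 - x))) x := by
      intro x hx
      have h1 := (Real.hasDerivAt_rpow_const (x := x) (p := p) (Or.inr hp.le)).const_mul (p - 1)
      have h4 := (Real.hasDerivAt_rpow_const (x := x) (p := p - 1) (Or.inl hx.ne')).const_mul p
      have h2 := (((hasDerivAt_id x).const_sub 1).pow 2).const_mul (p * (p - 1) / 2)
      refine (((h1.const_add 1).sub h4).sub h2).congr_deriv ?_
      have : p - 1 - 1 = p - 2 := by ring
      simp [this]
      ring
    refine antitoneOn_of_deriv_nonpos (convex_Ioc 0 1)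
      (fun x hx => (hder x hx.1).continuousAt.continuousWithinAt)
      (fun x hx => (hder x (interior_subset hx).1).differentiableAt.differentiableWithinAt)
      fun x hx => ?_
    have hx' := interior_subset hx
    rw [(hder x hx'.1).deriv]
    have e : x ^ (p - 1) = x ^ (p - 2) * x := by
      rw [← Real.rpow_add_one hx'.1.ne']
      congr 1
      ring
    have h1 : 1 ≤ x ^ (p - 2) := Real.one_le_rpow_of_pos_of_le_one_of_nonpos hx'.1 hx'.2
      (by linarith)
    rw [e]
    have h2 : 0 ≤ (1 - x) * (x ^ (p - 2) - 1) :=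
      mul_nonneg (by linarith [hx'.2]) (by linarith)
    have h3 : 0 ≤ p * (p - 1) := mul_nonneg (by linarith) (by linarith)
    nlinarith
  have h := hanti (a := b) ⟨hb, hb1⟩ (b := 1) (by simp) hb1
  simp only [Real.one_rpow] at h
  linarith

/-- Both sides are homogeneous of degree `p`, so dividing by the larger of `a` and `b` leads to one
of the two normalized cases. For `b = 0 < a` the claim is `p (p - 1) ≤ 2`, that is `(2 - p) (p + 1)
≥ 0`. -/
theorem rpow_bregman_scalar {p a b : ℝ} (hp : 1 < p) (hp2 : p ≤ 2) (ha : 0 ≤ a) (hb : 0 ≤ b) :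
    p * (p - 1) / 2 * max a b ^ (p - 2) * (a - b) ^ 2 ≤
      a ^ p + (p - 1) * b ^ p - p * b ^ (p - 1) * a := by
  rcases le_total a b with hab | hab
  · rw [max_eq_right hab]
    rcases hb.eq_or_lt with rfl | hb
    · have : a = 0 := le_antisymm hab ha
      subst this
      simp [Real.zero_rpow (by linarith : p ≠ 0)]
    have h := rpow_bregman_le_one hp hp2 (div_nonneg ha hb.le) ((div_le_one hb).2 hab)
    rw [Real.div_rpow ha hb.le] at h
    have hbp := Real.rpow_pos_of_pos hb p
    have h1 := mul_le_mul_of_nonneg_left h hbp.le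
    have e1 : b ^ (p - 2) = b ^ p / b ^ 2 := by
      rw [Real.rpow_sub hb]; norm_cast
    have e2 : b ^ (p - 1) = b ^ p / b := Real.rpow_sub_one hb.ne' p
    rw [e1, e2]
    have e3 : b ^ p * (p * (p - 1) / 2 * (a / b - 1) ^ 2) =
        p * (p - 1) / 2 * (b ^ p / b ^ 2) * (a - b) ^ 2 := by field_simp
    have e4 : b ^ p * (a ^ p / b ^ p + (p - 1) - p * (a / b)) =
        a ^ p + (p - 1) * b ^ p - p * (b ^ p / b) * a := by field_simp
    rw [e3, e4] at h1
    exact h1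
  · rw [max_eq_left hab]
    rcases hb.eq_or_lt with rfl | hb
    · rcases ha.eq_or_lt with rfl | ha
      · simp [Real.zero_rpow (by linarith : p ≠ 0)]
      have e1 : a ^ (p - 2) = a ^ p / a ^ 2 := by
        rw [Real.rpow_sub ha]; norm_cast
      rw [Real.zero_rpow (by linarith : p ≠ 0), Real.zero_rpow (by linarith : p - 1 ≠ 0), e1]
      have hap := Real.rpow_pos_of_pos ha p
      have : p * (p - 1) / 2 * (a ^ p / a ^ 2) * (a - 0) ^ 2 = p * (p - 1) / 2 * a ^ p := by
        field_simp; ring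
      rw [this]
      have h1 : 0 ≤ (2 - p) * (p + 1) * a ^ p :=
        mul_nonneg (mul_nonneg (by linarith) (by linarith)) hap.le
      nlinarith
    have ha : 0 < a := hb.trans_le hab
    have h := rpow_bregman_ge_one hp hp2 (div_pos hb ha) ((div_le_one ha).2 hab)
    rw [Real.div_rpow hb.le ha.le, Real.div_rpow hb.le ha.le] at h
    have hap := Real.rpow_pos_of_pos ha p
    have h1 := mul_le_mul_of_nonneg_left h hap.le
    have e1 : a ^ (p - 2) = a ^ p / a ^ 2 := by
      rw [Real.rpow_sub ha]; norm_cast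
    have e2 : a ^ (p - 1) = a ^ p / a := Real.rpow_sub_one ha.ne' p
    rw [e1]
    rw [e2] at h1
    have e3 : a ^ p * (p * (p - 1) / 2 * (1 - b / a) ^ 2) =
        p * (p - 1) / 2 * (a ^ p / a ^ 2) * (a - b) ^ 2 := by field_simp
    have e4 : a ^ p * (1 + (p - 1) * (b ^ p / a ^ p) - p * (b ^ (p - 1) / (a ^ p / a))) =
        a ^ p + (p - 1) * b ^ p - p * b ^ (p - 1) * a := by field_simp
    rw [e3, e4] at h1
    exact h1

/-- Uniform convexity of `‖·‖ ^ p` for `1 < p ≤ 2`, in terms of its Bregman divergence. -/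
theorem norm_rpow_bregman {E : Type*} [NormedAddCommGroup E] [InnerProductSpace ℝ E] {p : ℝ}
    (hp : 1 < p) (hp2 : p ≤ 2) (u v : E) :
    p * (p - 1) / 2 * max ‖u‖ ‖v‖ ^ (p - 2) * ‖u - v‖ ^ 2 ≤
      ‖u‖ ^ p - ‖v‖ ^ p - p * ‖v‖ ^ (p - 2) * inner ℝ v (u - v) := by
  have hs : inner ℝ v u ≤ ‖u‖ * ‖v‖ := by
    rw [mul_comm]; exact real_inner_le_norm v u
  have h := rpow_bregman_scalar hp hp2 (norm_nonneg u) (norm_nonneg v)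
  have e0 : ‖u - v‖ ^ 2 = ‖u‖ ^ 2 - 2 * inner ℝ v u + ‖v‖ ^ 2 := by
    rw [norm_sub_sq_real, real_inner_comm]
  rw [inner_sub_right, real_inner_self_eq_norm_sq, e0]
  rcases (norm_nonneg v).eq_or_lt with hv | hv
  · have hv' : v = 0 := norm_eq_zero.1 hv.symm
    subst hv'
    simp only [norm_zero, inner_zero_left, Real.zero_rpow (by linarith : p ≠ 0),
      Real.zero_rpow (by linarith : p - 1 ≠ 0)] at h ⊢
    linarith
  have e1 : ‖v‖ ^ (p - 1) = ‖v‖ ^ (p - 2) * ‖v‖ := by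
    rw [← Real.rpow_add_one hv.ne']
    congr 1
    ring
  have e2 : ‖v‖ ^ p = ‖v‖ ^ (p - 2) * ‖v‖ ^ 2 := by
    rw [← Real.rpow_natCast, ← Real.rpow_add hv]
    congr 1
    norm_num
  have hM : max ‖u‖ ‖v‖ ^ (p - 2) ≤ ‖v‖ ^ (p - 2) :=
    Real.rpow_le_rpow_of_nonpos hv (le_max_right _ _) (by linarith)
  have hM0 : 0 ≤ max ‖u‖ ‖v‖ ^ (p - 2) := by positivity
  -- For fixed norms both sides are affine in the inner product of `v` and `u`. At its maximum `‖u‖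
  -- ‖v‖` the claim is the scalar inequality. As it decreases, the right side grows at rate `p ‖v‖ ^
  -- (p - 2)`, which dominates the rate of the left side.
  have hc : 0 ≤ p * ‖v‖ ^ (p - 2) - p * (p - 1) * max ‖u‖ ‖v‖ ^ (p - 2) := by
    have : (p - 1) * max ‖u‖ ‖v‖ ^ (p - 2) ≤ 1 * ‖v‖ ^ (p - 2) :=
      mul_le_mul (by linarith) hM hM0 zero_le_one
    nlinarith
  have h2 := mul_nonneg hc (sub_nonneg.2 hs)
  rw [e1] at h
  nlinarith

/-! ### The block norm geometries -/

theorem one_lt_log {n : ℕ} (hn : 2 < n) : 1 < Real.log n := by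
  rw [Real.lt_log_iff_exp_lt (by positivity)]
  have : (3 : ℝ) ≤ n := by exact_mod_cast hn
  linarith [Real.exp_one_lt_d9]

theorem one_lt_pexp (n : ℕ) : 1 < pexp n := by
  unfold pexp
  split_ifs with h
  · norm_num
  · have := one_lt_log (not_le.1 h)
    have : 0 < 1 / Real.log n := by positivity
    linarith

theorem pexp_le_two (n : ℕ) : pexp n ≤ 2 := by
  unfold pexp
  split_ifs with h
  · norm_num
  · have := one_lt_log (not_le.1 h)
    have : 1 / Real.log n ≤ 1 := by
      rw [div_le_one (by linarith)]; exact this.le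
    linarith

theorem gam_pos (n : ℕ) (hn : 0 < n) : 0 < gam n := by
  unfold gam
  split_ifs with h1 h2
  · norm_num
  · norm_num
  · have := one_lt_log (n := n) (by omega)
    positivity

/-- The restriction of a vector to the `j`-th block, as an element of Euclidean space. -/
noncomputable def blockMask {d n : ℕ} (β : EqualPartition d n) (j : Fin n) :
    (Fin d → ℝ) →L[ℝ] EuclideanSpace ℝ (Fin d) :=
  LinearMap.toContinuousLinearMap
    { toFun := fun x => WithLp.toLp 2 fun i => if β.1 i = j then x i else 0
      map_add' := fun x y => by ext i; simp; split_ifs <;> simp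
      map_smul' := fun a x => by ext i; simp }

theorem blockMask_apply {d n : ℕ} (β : EqualPartition d n) (j : Fin n) (x : Fin d → ℝ)
    (i : Fin d) : blockMask β j x i = if β.1 i = j then x i else 0 := rfl

theorem norm_blockMask {d n : ℕ} (β : EqualPartition d n) (x : Fin d → ℝ) (j : Fin n) :
    ‖blockMask β j x‖ = blockL2 β x j := by
  rw [EuclideanSpace.norm_eq, blockL2, Finset.sum_filter]
  congr 1
  refine Finset.sum_congr rfl fun i _ => ?_
  rw [blockMask_apply]
  split_ifs <;> simp

theorem inner_blockMask {d n : ℕ} (β : EqualPartition d n) (x y : Fin d → ℝ) (j : Fin n) :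
    inner ℝ (blockMask β j x) (blockMask β j y) =
      ∑ i ∈ Finset.univ.filter (fun i => β.1 i = j), x i * y i := by
  rw [PiLp.inner_apply, Finset.sum_filter]
  refine Finset.sum_congr rfl fun i _ => ?_
  rw [blockMask_apply, blockMask_apply]
  split_ifs <;> simp [mul_comm]

theorem blockL2_nonneg {d n : ℕ} (β : EqualPartition d n) (x : Fin d → ℝ) (j : Fin n) :
    0 ≤ blockL2 β x j := Real.sqrt_nonneg _

theorem hasFDerivAt_blockMirror {d n : ℕ} (β : EqualPartition d n) (x : Fin d → ℝ) :
    HasFDerivAt (blockGeometry β).mirror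
      ((1 / (gam n * pexp n)) • ∑ j, ((pexp n * blockL2 β x j ^ (pexp n - 2)) •
        (innerSL ℝ (blockMask β j x)).comp (blockMask β j))) x := by
  have h : ∀ j, HasFDerivAt (fun x => blockL2 β x j ^ pexp n)
      ((pexp n * blockL2 β x j ^ (pexp n - 2)) •
        (innerSL ℝ (blockMask β j x)).comp (blockMask β j)) x := by
    intro j
    have := (hasFDerivAt_norm_rpow (blockMask β j x) (one_lt_pexp n)).comp x
      (blockMask β j).hasFDerivAt
    simp only [Function.comp_def, norm_blockMask, ContinuousLinearMap.smul_comp] at this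
    exact this
  exact (HasFDerivAt.fun_sum fun j _ => h j).const_mul _

theorem differentiable_blockMirror {d n : ℕ} (β : EqualPartition d n) :
    Differentiable ℝ (blockGeometry β).mirror := fun x =>
  (hasFDerivAt_blockMirror β x).differentiableAt

theorem sum_grad_blockMirror {d n : ℕ} (β : EqualPartition d n) (x v : Fin d → ℝ) :
    ∑ i, grad (blockGeometry β).mirror x i * v i = 1 / (gam n * pexp n) *
      ∑ j, pexp n * blockL2 β x j ^ (pexp n - 2) *
        inner ℝ (blockMask β j x) (blockMask β j v) := by
  rw [← fderiv_eq_sum_grad, (hasFDerivAt_blockMirror β x).fderiv]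
  simp

theorem grad_blockMirror {d n : ℕ} (β : EqualPartition d n) (x : Fin d → ℝ) (i : Fin d) :
    grad (blockGeometry β).mirror x i =
      1 / gam n * blockL2 β x (β.1 i) ^ (pexp n - 2) * x i := by
  have h := sum_grad_blockMirror β x (Pi.single i 1)
  have h1 : ∀ j, inner ℝ (blockMask β j x) (blockMask β j (Pi.single i 1)) =
      if β.1 i = j then x i else 0 := by
    intro j
    rw [inner_blockMask, Finset.sum_filter, Finset.sum_eq_single i]
    · simp
    · intro k _ hk; simp [hk]
    · simp
  simp only [h1, mul_ite, mul_zero, Finset.sum_ite_eq, Finset.mem_univ, if_true] at h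
  simp only [Pi.single_apply, mul_ite, mul_one, mul_zero, Finset.sum_ite_eq', Finset.mem_univ,
    if_true] at h
  rw [h]
  have := one_lt_pexp n
  rw [one_div, mul_inv]
  field_simp

theorem bregman_blockMirror {d n : ℕ} (β : EqualPartition d n) (u v : Fin d → ℝ) :
    bregman (blockGeometry β).mirror u v = 1 / (gam n * pexp n) *
      ∑ j, (‖blockMask β j u‖ ^ pexp n - ‖blockMask β j v‖ ^ pexp n -
        pexp n * ‖blockMask β j v‖ ^ (pexp n - 2) *
          inner ℝ (blockMask β j v) (blockMask β j u - blockMask β j v)) := by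
  have h := sum_grad_blockMirror β v (u - v)
  simp only [Pi.sub_apply, map_sub] at h
  rw [bregman, h]
  simp only [blockGeometry, norm_blockMask, Finset.sum_sub_distrib]
  ring

/-- `∑ M_j ^ (2 - p) ≤ 2 n ^ (p - 1)` for nonnegative `M_j` with sum at most two. -/
theorem sum_rpow_le {n : ℕ} (hn : 0 < n) {p : ℝ} (hp : 1 < p) (hp2 : p ≤ 2) (M : Fin n → ℝ)
    (hM : ∀ j, 0 ≤ M j) (hs : ∑ j, M j ≤ 2) :
    ∑ j, M j ^ (2 - p) ≤ 2 * (n : ℝ) ^ (p - 1) := by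
  have hn' : (0 : ℝ) < n := by exact_mod_cast hn
  -- Tangent line of the concave function `t ↦ t ^ (2 - p)` at `2 / n`, the largest possible mean of
  -- the `M j`; summing these bounds is Jensen's inequality.
  have h1 : ∀ j, M j ^ (2 - p) ≤ (2 / n : ℝ) ^ (2 - p) * (1 + (2 - p) * (n / 2 * M j - 1)) := by
    intro j
    have hb := rpow_one_add_le_one_add_mul_self (s := n / 2 * M j - 1)
      (by have := mul_nonneg (by positivity : (0 : ℝ) ≤ n / 2) (hM j); linarith) (p := 2 - p)
      (by linarith) (by linarith)
    rw [add_sub_cancel] at hb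
    calc M j ^ (2 - p) = (2 / n * (n / 2 * M j)) ^ (2 - p) := by
          congr 1; field_simp
      _ = (2 / n : ℝ) ^ (2 - p) * (n / 2 * M j) ^ (2 - p) :=
          Real.mul_rpow (by positivity) (mul_nonneg (by positivity) (hM j))
      _ ≤ _ := by gcongr
  calc ∑ j, M j ^ (2 - p)
      ≤ ∑ j, (2 / n : ℝ) ^ (2 - p) * (1 + (2 - p) * (n / 2 * M j - 1)) :=
        Finset.sum_le_sum fun j _ => h1 j
    _ = (2 / n : ℝ) ^ (2 - p) * (n + (2 - p) * (n / 2 * ∑ j, M j - n)) := by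
        rw [← Finset.mul_sum, Finset.sum_add_distrib, ← Finset.mul_sum, Finset.sum_sub_distrib,
          ← Finset.mul_sum]
        simp
    _ ≤ (2 / n : ℝ) ^ (2 - p) * n := by
        gcongr
        have : (n : ℝ) / 2 * ∑ j, M j ≤ n / 2 * 2 := by gcongr
        nlinarith
    _ = 2 ^ (2 - p) * (n : ℝ) ^ (p - 1) := by
        rw [Real.div_rpow (by norm_num) hn'.le, div_mul_eq_mul_div, mul_div_assoc]
        congr 1
        rw [div_eq_iff (by positivity), ← Real.rpow_add hn']
        norm_num
    _ ≤ 2 * (n : ℝ) ^ (p - 1) := by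
        gcongr
        calc (2 : ℝ) ^ (2 - p) ≤ 2 ^ (1 : ℝ) :=
              Real.rpow_le_rpow_of_exponent_le (by norm_num) (by linarith)
          _ = 2 := by norm_num

/-- Strong convexity of the block mirror map with respect to the block norm on its unit ball. -/
theorem blockMirror_strongly_convex {d n : ℕ} (hn : 2 < n) (β : EqualPartition d n)
    {u v : Fin d → ℝ} (hu : (blockGeometry β).norm u ≤ 1) (hv : (blockGeometry β).norm v ≤ 1) :
    (blockGeometry β).norm (v - u) ^ 2 / 4 ≤ bregman (blockGeometry β).mirror u v := by
  have hp := one_lt_pexp n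
  have hp2 := pexp_le_two n
  have hl := one_lt_log hn
  have hpv : pexp n = 1 + 1 / Real.log n := by rw [pexp, if_neg (by omega)]
  have hgv : gam n = 1 / (Real.exp 1 * Real.log n) := by
    rw [gam, if_neg (by omega), if_neg (by omega)]
  set p := pexp n
  set a : Fin n → ℝ := fun j => ‖blockMask β j u‖
  set b : Fin n → ℝ := fun j => ‖blockMask β j v‖
  set r : Fin n → ℝ := fun j => ‖blockMask β j u - blockMask β j v‖
  have hr : (blockGeometry β).norm (v - u) = ∑ j, r j := by
    change ∑ j, blockL2 β (v - u) j = ∑ j, r j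
    refine Finset.sum_congr rfl fun j _ => ?_
    rw [← norm_blockMask, map_sub, norm_sub_rev]
  have hua : ∑ j, a j ≤ 1 := by
    refine le_of_eq_of_le (Finset.sum_congr rfl fun j _ => norm_blockMask β u j) hu
  have hvb : ∑ j, b j ≤ 1 := by
    refine le_of_eq_of_le (Finset.sum_congr rfl fun j _ => norm_blockMask β v j) hv
  set M : Fin n → ℝ := fun j => max (a j) (b j)
  have ha0 : ∀ j, 0 ≤ a j := fun j => norm_nonneg _
  have hb0 : ∀ j, 0 ≤ b j := fun j => norm_nonneg _
  have hM0 : ∀ j, 0 ≤ M j := fun j => (ha0 j).trans (le_max_left _ _)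
  have hMs : ∑ j, M j ≤ 2 := by
    calc ∑ j, M j ≤ ∑ j, (a j + b j) :=
          Finset.sum_le_sum fun j _ => max_le (by linarith [hb0 j]) (by linarith [ha0 j])
      _ ≤ 2 := by rw [Finset.sum_add_distrib]; linarith
  -- The choice `p - 1 = 1 / ln n` makes the dimension factor a constant.
  have hpow : (n : ℝ) ^ (p - 1) = Real.exp 1 := by
    rw [Real.rpow_def_of_pos (by positivity), hpv]
    congr 1
    field_simp
    ring
  have h2 := sum_rpow_le (by omega) hp hp2 M hM0 hMs
  rw [hpow] at h2
  -- Cauchy–Schwarz with the weights `M j ^ (p - 2)` and `M j ^ (2 - p)`. In a block with `M j = 0`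
  -- both vectors vanish, hence so does `r j`.
  have hcs : (∑ j, r j) ^ 2 ≤ (∑ j, M j ^ (p - 2) * r j ^ 2) * ∑ j, M j ^ (2 - p) := by
    refine Finset.sum_sq_le_sum_mul_sum_of_sq_le_mul _
      (fun j _ => mul_nonneg (Real.rpow_nonneg (hM0 j) _) (sq_nonneg _))
      (fun j _ => Real.rpow_nonneg (hM0 j) _) fun j _ => le_of_eq ?_
    rcases (hM0 j).eq_or_lt with h0 | h0
    · have h3 : r j ≤ a j + b j := norm_sub_le _ _
      have h4 : a j ≤ M j := le_max_left _ _
      have h5 : b j ≤ M j := le_max_right _ _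
      have h6 : 0 ≤ r j := norm_nonneg _
      have : r j = 0 := by linarith
      simp [this]
    · rw [mul_right_comm, ← Real.rpow_add h0]
      simp
  have hS0 : 0 ≤ ∑ j, M j ^ (p - 2) * r j ^ 2 :=
    Finset.sum_nonneg fun j _ => mul_nonneg (Real.rpow_nonneg (hM0 j) _) (sq_nonneg _)
  have hcs2 : (∑ j, r j) ^ 2 ≤ (∑ j, M j ^ (p - 2) * r j ^ 2) * (2 * Real.exp 1) :=
    hcs.trans (mul_le_mul_of_nonneg_left h2 hS0)
  have hB : p * (p - 1) / 2 * ∑ j, M j ^ (p - 2) * r j ^ 2 ≤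
      ∑ j, (‖blockMask β j u‖ ^ p - ‖blockMask β j v‖ ^ p - p * ‖blockMask β j v‖ ^ (p - 2) *
          inner ℝ (blockMask β j v) (blockMask β j u - blockMask β j v)) := by
    rw [Finset.mul_sum]
    refine Finset.sum_le_sum fun j _ => ?_
    rw [← mul_assoc]
    exact norm_rpow_bregman hp hp2 _ _
  rw [hr, bregman_blockMirror]
  have he := Real.exp_pos 1
  have hgp : 0 < gam n * p := mul_pos (gam_pos n (by omega)) (by linarith)
  refine le_trans ?_ (mul_le_mul_of_nonneg_left hB (by positivity))
  -- Here `(p - 1) / γ_n = e`, which matches the constant `2 e / 4` left by Cauchy–Schwarz.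
  have e : 1 / (gam n * p) * (p * (p - 1) / 2 * ∑ j, M j ^ (p - 2) * r j ^ 2) =
      Real.exp 1 / 2 * ∑ j, M j ^ (p - 2) * r j ^ 2 := by
    have hp0 : p ≠ 0 := by linarith
    have h7 : p - 1 = 1 / Real.log n := by rw [hpv]; ring
    rw [h7, hgv]
    field_simp
  rw [e]
  nlinarith

theorem sum_mul_le_dualNorm_mul_norm {d n : ℕ} (β : EqualPartition d n) (u v : Fin d → ℝ) :
    ∑ i, u i * v i ≤ (blockGeometry β).dualNorm u * (blockGeometry β).norm v := by
  rw [← Finset.sum_fiberwise (s := Finset.univ) (g := β.1)]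
  simp only [blockGeometry, Finset.mul_sum]
  refine Finset.sum_le_sum fun j _ => ?_
  rw [← inner_blockMask]
  refine (real_inner_le_norm _ _).trans ?_
  rw [norm_blockMask, norm_blockMask]
  exact mul_le_mul_of_nonneg_right (le_ciSup (f := fun j => blockL2 β u j)
    (Set.finite_range _).bddAbove j) (blockL2_nonneg _ _ _)

/-- On the nonnegative part of the unit ball, Bregman divergences are at most `1 / γ_n`. -/
theorem bregman_blockMirror_le {d n : ℕ} (hn : 0 < n) (β : EqualPartition d n)
    {u v : Fin d → ℝ} (hu0 : ∀ i, 0 ≤ u i) (hv0 : ∀ i, 0 ≤ v i)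
    (hu : (blockGeometry β).norm u ≤ 1) (hv : (blockGeometry β).norm v ≤ 1) :
    bregman (blockGeometry β).mirror u v ≤ 1 / gam n := by
  have hp := one_lt_pexp n
  have hg := gam_pos n hn
  have key : ∀ w : Fin d → ℝ, (blockGeometry β).norm w ≤ 1 →
      ∑ j, ‖blockMask β j w‖ ^ pexp n ≤ 1 := by
    intro w hw
    refine le_trans (Finset.sum_le_sum fun j _ => ?_) hw
    rw [norm_blockMask]
    have h1 : blockL2 β w j ≤ 1 := le_trans (Finset.single_le_sum
      (f := fun j => blockL2 β w j) (fun j _ => blockL2_nonneg β w j) (Finset.mem_univ j)) hw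
    calc blockL2 β w j ^ pexp n ≤ blockL2 β w j ^ (1 : ℝ) :=
          Real.rpow_le_rpow_of_exponent_ge_of_imp (blockL2_nonneg _ _ _) h1 hp.le
            (by intro _ h; linarith)
      _ = blockL2 β w j := Real.rpow_one _
  rw [bregman_blockMirror]
  have h1 : ∀ j, ‖blockMask β j u‖ ^ pexp n - ‖blockMask β j v‖ ^ pexp n -
        pexp n * ‖blockMask β j v‖ ^ (pexp n - 2) *
          inner ℝ (blockMask β j v) (blockMask β j u - blockMask β j v) ≤
      ‖blockMask β j u‖ ^ pexp n + (pexp n - 1) * ‖blockMask β j v‖ ^ pexp n := by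
    intro j
    have h2 : 0 ≤ inner ℝ (blockMask β j v) (blockMask β j u) := by
      rw [inner_blockMask]
      exact Finset.sum_nonneg fun i _ => mul_nonneg (hv0 i) (hu0 i)
    have h3 : ‖blockMask β j v‖ ^ (pexp n - 2) * ‖blockMask β j v‖ ^ 2 =
        ‖blockMask β j v‖ ^ pexp n := by
      rcases (norm_nonneg (blockMask β j v)).eq_or_lt with h | h
      · rw [← h, Real.zero_rpow (by linarith : pexp n ≠ 0)]; simp
      · rw [← Real.rpow_natCast, ← Real.rpow_add h]
        congr 1
        norm_num
    rw [inner_sub_right, real_inner_self_eq_norm_sq]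
    -- Nonnegativity of both vectors lets the cross term be dropped. What remains totals at most `1
    -- + (p - 1) = p`, which cancels the `p` of the mirror map.
    have h4 : 0 ≤ pexp n * ‖blockMask β j v‖ ^ (pexp n - 2) *
        inner ℝ (blockMask β j v) (blockMask β j u) := by positivity
    nlinarith
  calc _ ≤ 1 / (gam n * pexp n) * ∑ j, (‖blockMask β j u‖ ^ pexp n +
        (pexp n - 1) * ‖blockMask β j v‖ ^ pexp n) := by
        gcongr with j
        exact h1 j
    _ ≤ 1 / (gam n * pexp n) * (1 + (pexp n - 1) * 1) := by
        rw [Finset.sum_add_distrib, ← Finset.mul_sum]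
        have := mul_le_mul_of_nonneg_left (key v hv) (by linarith : 0 ≤ pexp n - 1)
        gcongr
        exact key u hu
    _ = 1 / gam n := by field_simp; ring

/-! ### Uniformly random equal partitions -/

/-- The number of equal partitions that put all of `U` into the `j`-th block. -/
def countBlock {d n : ℕ} (j : Fin n) (U : Finset (Fin d)) : ℕ :=
  (Finset.univ.filter fun β : EqualPartition d n => ∀ i ∈ U, β.1 i = j).card

/-- Relabelling the coordinates of an equal partition by a permutation. -/
def EqualPartition.perm {d n : ℕ} (σ : Equiv.Perm (Fin d)) (β : EqualPartition d n) :
    EqualPartition d n :=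
  ⟨fun i => β.1 (σ i), fun j => by
    refine Eq.trans ?_ (β.2 j)
    congr 1
    refine Finset.card_bij (fun i _ => σ i) (fun i hi => by simpa using hi)
      (fun _ _ _ _ h => σ.injective h) fun i hi => ⟨σ.symm i, ?_, ?_⟩
    · simpa using hi
    · simp⟩

theorem countBlock_insert_eq {d n : ℕ} (j : Fin n) {U : Finset (Fin d)} {i i' : Fin d}
    (hi : i ∉ U) (hi' : i' ∉ U) :
    countBlock j (insert i U) = countBlock j (insert i' U) := by
  have hU : ∀ k ∈ U, Equiv.swap i i' k = k := fun k hk =>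
    Equiv.swap_apply_of_ne_of_ne (by rintro rfl; exact hi hk) (by rintro rfl; exact hi' hk)
  refine Finset.card_bij' (fun β _ => β.perm (Equiv.swap i i'))
    (fun β _ => β.perm (Equiv.swap i i')) ?_ ?_ ?_ ?_
  · intro β hβ
    simp only [Finset.mem_filter, Finset.mem_univ, true_and, Finset.forall_mem_insert,
      EqualPartition.perm, Equiv.swap_apply_right] at hβ ⊢
    exact ⟨hβ.1, fun k hk => by rw [hU k hk]; exact hβ.2 k hk⟩
  · intro β hβ
    simp only [Finset.mem_filter, Finset.mem_univ, true_and, Finset.forall_mem_insert,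
      EqualPartition.perm, Equiv.swap_apply_left] at hβ ⊢
    exact ⟨hβ.1, fun k hk => by rw [hU k hk]; exact hβ.2 k hk⟩
  · intro β _
    ext k
    simp [EqualPartition.perm]
  · intro β _
    ext k
    simp [EqualPartition.perm]

/-- Given that `U` lies in block `j`, one further coordinate falls there with probability at most `1
/ n`. By symmetry one may average over all coordinates outside `U`: block `j` has `d / n - |U|`
places left for `d - |U|` coordinates, and `n (d / n - |U|) ≤ d - |U|`. -/
theorem mul_countBlock_insert_le {d n : ℕ} (j : Fin n) {U : Finset (Fin d)} {i : Fin d}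
    (hi : i ∉ U) : n * countBlock j (insert i U) ≤ countBlock j U := by
  have hn : 0 < n := j.pos
  have hcard : Uᶜ.card = d - U.card := by rw [Finset.card_compl, Fintype.card_fin]
  have hpos : 0 < d - U.card := by
    rw [← hcard]
    exact Finset.card_pos.2 ⟨i, Finset.mem_compl.2 hi⟩
  have h1 : (d - U.card) * countBlock j (insert i U) =
      ∑ i' ∈ Uᶜ, countBlock j (insert i' U) := by
    rw [← hcard, Finset.sum_congr rfl fun i' hi' =>
      countBlock_insert_eq j (Finset.mem_compl.1 hi') hi]
    simp
  have h2 : ∑ i' ∈ Uᶜ, countBlock j (insert i' U) =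
      ∑ β : EqualPartition d n with ∀ i ∈ U, β.1 i = j, (Uᶜ.filter fun i' => β.1 i' = j).card := by
    simp only [countBlock, Finset.card_filter]
    rw [Finset.sum_comm, Finset.sum_filter]
    refine Finset.sum_congr rfl fun β _ => ?_
    split_ifs with h
    · refine Finset.sum_congr rfl fun i' _ => ?_
      exact if_congr ((Finset.forall_mem_insert _ _ _).trans (and_iff_left h)) rfl rfl
    · refine Finset.sum_eq_zero fun i' _ => ?_
      rw [if_neg]
      exact fun h' => h fun k hk => h' k (Finset.mem_insert_of_mem hk)
  have h3 : n * ∑ β : EqualPartition d n with ∀ i ∈ U, β.1 i = j,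
      (Uᶜ.filter fun i' => β.1 i' = j).card ≤ (d - U.card) * countBlock j U := by
    rw [Finset.mul_sum, countBlock, mul_comm, ← smul_eq_mul]
    refine Finset.sum_le_card_nsmul _ _ _ fun β hβ => ?_
    have hβ' : ∀ i ∈ U, β.1 i = j := (Finset.mem_filter.1 hβ).2
    have h4 : (Uᶜ.filter fun i' => β.1 i' = j).card + U.card =
        (Finset.univ.filter fun i' => β.1 i' = j).card := by
      rw [← Finset.card_union_of_disjoint]
      · congr 1
        ext k
        simp only [Finset.mem_union, Finset.mem_filter, Finset.mem_compl, Finset.mem_univ,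
          true_and]
        constructor
        · rintro (h | h)
          · exact h.2
          · exact hβ' k h
        · intro h
          by_cases hk : k ∈ U
          · exact Or.inr hk
          · exact Or.inl ⟨hk, h⟩
      · rw [Finset.disjoint_left]
        intro k hk hk'
        exact (Finset.mem_compl.1 (Finset.mem_filter.1 hk).1) hk'
    have h5 := β.2 j
    rw [← h4, mul_add] at h5
    have h6 : U.card ≤ n * U.card := Nat.le_mul_of_pos_left _ hn
    omega
  have h4 : (d - U.card) * (n * countBlock j (insert i U)) ≤ (d - U.card) * countBlock j U := by
    calc _ = n * ((d - U.card) * countBlock j (insert i U)) := by ring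
      _ ≤ _ := by rw [h1, h2]; exact h3
  exact Nat.le_of_mul_le_mul_left h4 hpos

/-- The events of falling into block `j` are negatively correlated: all of `U` lands there with
probability at most `n ^ (-|U|)`, as if the coordinates were independent. -/
theorem pow_mul_countBlock_le {d n : ℕ} (j : Fin n) (U : Finset (Fin d)) :
    n ^ U.card * countBlock j U ≤ Fintype.card (EqualPartition d n) := by
  induction U using Finset.induction_on with
  | empty => simp [countBlock]
  | insert i U hi ih =>
    rw [Finset.card_insert_of_notMem hi, pow_succ, mul_assoc]
    exact (Nat.mul_le_mul_left _ (mul_countBlock_insert_le j hi)).trans ih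

/-- The exponential moment of the load of a block. -/
theorem sum_two_pow_load_le {d n : ℕ} (j : Fin n) (A : Finset (Fin d)) :
    ∑ β : EqualPartition d n, (2 : ℝ) ^ (A.filter fun i => β.1 i = j).card ≤
      Fintype.card (EqualPartition d n) * (1 + 1 / n) ^ A.card := by
  have hn : (0 : ℝ) < n := by exact_mod_cast j.pos
  -- `2` to the load counts the subsets of `A` contained in block `j`. Exchanging the sums and
  -- applying the binomial theorem gives the moment.
  have h1 : ∀ β : EqualPartition d n, (2 : ℝ) ^ (A.filter fun i => β.1 i = j).card =
      ∑ U ∈ A.powerset, if ∀ i ∈ U, β.1 i = j then (1 : ℝ) else 0 := by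
    intro β
    rw [← Finset.sum_filter, Finset.sum_const, nsmul_eq_mul, mul_one]
    have : A.powerset.filter (fun U => ∀ i ∈ U, β.1 i = j) =
        (A.filter fun i => β.1 i = j).powerset := by
      ext U
      simp only [Finset.mem_filter, Finset.mem_powerset, Finset.subset_iff]
      exact ⟨fun h k hk => ⟨h.1 hk, h.2 k hk⟩, fun h => ⟨fun k hk => (h hk).1, fun k hk => (h hk).2⟩⟩
    rw [this, Finset.card_powerset]
    simp
  rw [Finset.sum_congr rfl fun β _ => h1 β, Finset.sum_comm]
  have h2 := Finset.sum_pow_mul_eq_add_pow (1 / n : ℝ) 1 A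
  rw [add_comm 1 (1 / n : ℝ), ← h2, Finset.mul_sum]
  refine Finset.sum_le_sum fun U _ => ?_
  rw [← Finset.sum_filter, Finset.sum_const, nsmul_eq_mul, mul_one, one_pow, mul_one, one_div,
    inv_pow, ← div_eq_mul_inv, le_div_iff₀ (by positivity)]
  have := pow_mul_countBlock_le j U
  rw [mul_comm]
  exact_mod_cast this

/-- The expected squared dual norm of a sparse `0`-`1` vector in a random block geometry. -/
theorem avg_dualNorm_sq_le {d n : ℕ} (hn : 0 < n) (c : Fin d → ℝ) (hc : ∀ i, c i = 0 ∨ c i = 1)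
    (hs : ∑ i, c i ≤ 2 * n) :
    (Fintype.card (EqualPartition d n) : ℝ)⁻¹ *
      ∑ β : EqualPartition d n, (blockGeometry β).dualNorm c ^ 2 ≤ 2 * (Real.log n + 2) := by
  have hn' : (0 : ℝ) < n := by exact_mod_cast hn
  have : Nonempty (Fin n) := ⟨⟨0, hn⟩⟩
  set A : Finset (Fin d) := Finset.univ.filter fun i => c i = 1 with hA
  have hsq : ∀ i, c i ^ 2 = if c i = 1 then 1 else 0 := fun i => by
    rcases hc i with h | h <;> simp [h]
  have hAc : (A.card : ℝ) ≤ 2 * n := by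
    refine le_of_eq_of_le ?_ hs
    rw [hA, Finset.card_filter]
    push_cast
    exact Finset.sum_congr rfl fun i _ => by rcases hc i with h | h <;> simp [h]
  -- The squared dual norm of a `0`-`1` vector is its maximal block load, which is at most `log₂ Y`.
  set Y : EqualPartition d n → ℝ := fun β =>
    ∑ j, (2 : ℝ) ^ (A.filter fun i => β.1 i = j).card
  -- `a` bounds the mean of `Y`, since `n (1 + 1 / n) ^ (2 n) ≤ n e²`. The tangent of the logarithm
  -- at `a` then replaces Jensen's inequality.
  set a : ℝ := n * Real.exp 2 with ha
  have ha0 : 0 < a := by positivity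
  have hln : (1 : ℝ) / 2 ≤ Real.log 2 := by linarith [Real.log_two_gt_d9]
  have key : ∀ β : EqualPartition d n,
      (blockGeometry β).dualNorm c ^ 2 ≤ (Y β / a - 1 + Real.log a) / Real.log 2 := by
    intro β
    obtain ⟨j, hj⟩ := exists_eq_ciSup_of_finite (f := fun j => blockL2 β c j)
    have e : (blockGeometry β).dualNorm c = blockL2 β c j := hj.symm
    have e2 : blockL2 β c j ^ 2 = (A.filter fun i => β.1 i = j).card := by
      rw [blockL2, Real.sq_sqrt (Finset.sum_nonneg fun i _ => sq_nonneg _),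
        Finset.sum_congr rfl fun i _ => hsq i, ← Finset.sum_filter, hA, Finset.filter_comm]
      simp
    rw [e, e2, le_div_iff₀ (by linarith)]
    have h1 : (2 : ℝ) ^ (A.filter fun i => β.1 i = j).card ≤ Y β :=
      Finset.single_le_sum (f := fun j => (2 : ℝ) ^ (A.filter fun i => β.1 i = j).card)
        (fun j _ => by positivity) (Finset.mem_univ j)
    have hY : 0 < Y β := lt_of_lt_of_le (by positivity) h1
    have h2 := Real.log_le_log (by positivity) h1
    rw [Real.log_pow] at h2
    have h3 := Real.log_le_sub_one_of_pos (div_pos hY ha0)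
    rw [Real.log_div hY.ne' ha0.ne'] at h3
    linarith
  have hsumY : ∑ β, Y β ≤ Fintype.card (EqualPartition d n) * a := by
    rw [Finset.sum_comm]
    calc _ ≤ ∑ _j : Fin n, (Fintype.card (EqualPartition d n) : ℝ) * (1 + 1 / n) ^ A.card :=
          Finset.sum_le_sum fun j _ => sum_two_pow_load_le j A
      _ = Fintype.card (EqualPartition d n) * (n * (1 + 1 / n) ^ A.card) := by
          simp; ring
      _ ≤ _ := by
          rw [ha]
          gcongr
          calc (1 + 1 / n : ℝ) ^ A.card ≤ Real.exp (1 / n) ^ A.card := by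
                gcongr
                rw [add_comm]
                exact Real.add_one_le_exp _
            _ = Real.exp (A.card * (1 / n)) := (Real.exp_nat_mul _ _).symm
            _ ≤ Real.exp 2 := by
                gcongr
                rw [mul_one_div, div_le_iff₀ hn']
                exact hAc
  have hlog : Real.log a = Real.log n + 2 := by
    rw [ha, Real.log_mul hn'.ne' (Real.exp_ne_zero _), Real.log_exp]
  have hlogn : 0 ≤ Real.log n := Real.log_natCast_nonneg n
  -- If there are no equal partitions, the average is `0⁻¹ * 0 = 0`.
  rcases (Nat.cast_nonneg (α := ℝ) (Fintype.card (EqualPartition d n))).eq_or_lt with h0 | h0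
  · rw [← h0]
    simp only [inv_zero, zero_mul]
    positivity
  rw [inv_mul_le_iff₀ h0]
  calc _ ≤ ∑ β, (Y β / a - 1 + Real.log a) / Real.log 2 := Finset.sum_le_sum fun β _ => key β
    _ = (((∑ β, Y β) / a - Fintype.card (EqualPartition d n)) +
          Fintype.card (EqualPartition d n) * Real.log a) / Real.log 2 := by
        rw [← Finset.sum_div, Finset.sum_add_distrib, Finset.sum_sub_distrib, Finset.sum_div]
        simp
    _ ≤ (Fintype.card (EqualPartition d n) * Real.log a) / Real.log 2 := by
        gcongr
        have : (∑ β, Y β) / a ≤ Fintype.card (EqualPartition d n) := by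
          rw [div_le_iff₀ ha0]; exact hsumY
        linarith
    _ ≤ _ := by
        rw [div_le_iff₀ (by linarith), hlog]
        have : 0 ≤ (Fintype.card (EqualPartition d n) : ℝ) * (Real.log n + 2) := by positivity
        nlinarith

theorem nonempty_equalPartition {d n : ℕ} (h : n ∣ d) : Nonempty (EqualPartition d n) := by
  obtain ⟨b, rfl⟩ := h
  refine ⟨⟨fun i => (finProdFinEquiv.symm i).1, fun j => ?_⟩⟩
  congr 1
  have : (Finset.univ.filter fun i : Fin (n * b) => (finProdFinEquiv.symm i).1 = j).card =
      (Finset.univ : Finset (Fin b)).card := by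
    symm
    refine Finset.card_bij (fun k _ => finProdFinEquiv (j, k)) (fun k _ => by rw [Finset.mem_filter, Equiv.symm_apply_apply]; simp)
      (fun k _ k' _ h => by simpa using h) fun i hi => ⟨(finProdFinEquiv.symm i).2, by simp, ?_⟩
    have hi' : (finProdFinEquiv.symm i).1 = j := by simpa using hi
    rw [← hi', Prod.mk.eta, Equiv.apply_symm_apply]
  rw [this, Finset.card_fin]

theorem card_equalPartition_pos {d n : ℕ} (h : n ∣ d) :
    (0 : ℝ) < Fintype.card (EqualPartition d n) := by
  have := nonempty_equalPartition h
  exact_mod_cast Fintype.card_pos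

theorem blockL2_mul {d n : ℕ} (β : EqualPartition d n) (a : ℝ) (x : Fin d → ℝ) (j : Fin n) :
    blockL2 β (fun i => a * x i) j = |a| * blockL2 β x j := by
  rw [← norm_blockMask, ← norm_blockMask, ← Real.norm_eq_abs, ← norm_smul, ← map_smul]
  rfl

theorem dualNorm_mul {d n : ℕ} (β : EqualPartition d n) (a : ℝ) (x : Fin d → ℝ) :
    (blockGeometry β).dualNorm (fun i => a * x i) = |a| * (blockGeometry β).dualNorm x := by
  simp only [blockGeometry, blockL2_mul]
  exact (Real.mul_iSup_of_nonneg (abs_nonneg a) _).symm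

/-! ### Instances with deterministic linear losses -/

/-- The instance with the deterministic losses `x ↦ -⟨c t, x⟩`. -/
noncomputable def linearInstance {d : ℕ} (K : Set (Fin d → ℝ)) (hK : Convex ℝ K)
    (hKc : IsCompact K) (x₁ : Fin d → ℝ) (hx : x₁ ∈ K) (T : ℕ) (c : ℕ → Fin d → ℝ) :
    OCOInstance d where
  K := K
  K_convex := hK
  K_compact := hKc
  start := x₁
  start_mem := hx
  T := T
  Ω := Unit
  fintypeΩ := inferInstance
  prob := fun _ => 1
  prob_nonneg := fun _ => zero_le_one
  prob_sum := by simp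
  loss := fun t _ x => -∑ i, c t i * x i
  loss_convex := fun t _ => by
    refine ⟨convex_univ, fun x _ y _ a b _ _ _ => le_of_eq ?_⟩
    simp only [Pi.add_apply, Pi.smul_apply, smul_eq_mul, mul_add, Finset.sum_add_distrib,
      mul_neg, Finset.mul_sum, neg_add]
    congr 2 <;> exact Finset.sum_congr rfl fun i _ => by ring
  loss_differentiable := fun t _ x => (hasFDerivAt_linear (c t) x).differentiableAt.neg

/-- An instance whose losses are `x ↦ -⟨c t, x⟩`, with a point `e` of `K` that is optimal in each
round and has loss `-1`. -/
structure IsLinearWith {d : ℕ} (I : OCOInstance d) (c : ℕ → Fin d → ℝ) (e : Fin d → ℝ) : Prop where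
  loss_eq : ∀ t ω x, I.loss t ω x = -∑ i, c t i * x i
  mem : e ∈ I.K
  opt : ∀ t, ∑ i, c t i * e i = 1
  le_one : ∀ t, ∀ x ∈ I.K, ∑ i, c t i * x i ≤ 1

namespace OCOInstance

variable {d : ℕ} (I : OCOInstance d)

/-- The iterates of mirror descent in the geometry `𝒢 b` on the rescaled instance. -/
noncomputable def run (κ : ℝ) {ι : Type} [Fintype ι] (𝒢 : ι → Geometry d) (b : ι) (ω : I.Ω) :
    ℕ → Fin d → ℝ :=
  omdIter (I.scaledK (𝒢 b)) (𝒢 b).mirror (I.stepSize κ 𝒢 b) (I.scaledLoss (𝒢 b) ω)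
    (I.scaledStart (𝒢 b))

theorem one_le_scale (G : Geometry d) : 1 ≤ I.scale G := le_max_left _ _

theorem scale_pos (G : Geometry d) : 0 < I.scale G := zero_lt_one.trans_le (I.one_le_scale G)

theorem scale_eq_one {G : Geometry d} (h : ∀ x ∈ I.K, G.norm x ≤ 1) : I.scale G = 1 := by
  refine max_eq_left (Real.sSup_le ?_ zero_le_one)
  rintro _ ⟨x, hx, rfl⟩
  exact h x hx

theorem mem_scaledK {G : Geometry d} {x : Fin d → ℝ} (hx : x ∈ I.K) :
    (I.scale G)⁻¹ • x ∈ I.scaledK G := ⟨x, hx, rfl⟩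

theorem smul_mem_of_mem_scaledK {G : Geometry d} {x : Fin d → ℝ} (hx : x ∈ I.scaledK G) :
    I.scale G • x ∈ I.K := by
  obtain ⟨y, hy, rfl⟩ := hx
  simp only
  rwa [smul_inv_smul₀ (I.scale_pos G).ne']

theorem scaledStart_mem (G : Geometry d) : I.scaledStart G ∈ I.scaledK G :=
  I.mem_scaledK I.start_mem

theorem isCompact_scaledK (G : Geometry d) : IsCompact (I.scaledK G) :=
  I.K_compact.image (continuous_const_smul _)

theorem convex_scaledK (G : Geometry d) : Convex ℝ (I.scaledK G) :=
  I.K_convex.smul _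

theorem run_mem (κ : ℝ) {ι : Type} [Fintype ι] (𝒢 : ι → Geometry d) (b : ι) (ω : I.Ω)
    (hc : ContinuousOn (𝒢 b).mirror (I.scaledK (𝒢 b))) (t : ℕ) :
    I.run κ 𝒢 b ω t ∈ I.scaledK (𝒢 b) :=
  omdIter_mem (I.isCompact_scaledK _) hc _ _ (I.scaledStart_mem _) t

variable {I} {c : ℕ → Fin d → ℝ} {e : Fin d → ℝ}

theorem scaledLoss_eq (hI : IsLinearWith I c e) (G : Geometry d) (ω : I.Ω) (t : ℕ) :
    I.scaledLoss G ω t = fun z => ∑ i, (-I.scale G * c t i) * z i := by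
  funext z
  rw [scaledLoss, hI.loss_eq, ← Finset.sum_neg_distrib]
  exact Finset.sum_congr rfl fun i _ => by simp; ring

theorem grad_scaledLoss (hI : IsLinearWith I c e) (G : Geometry d) (ω : I.Ω) (t : ℕ)
    (x : Fin d → ℝ) : grad (I.scaledLoss G ω t) x = fun i => -I.scale G * c t i := by
  rw [scaledLoss_eq hI, grad_linear]

theorem gradBound_eq (hI : IsLinearWith I c e) {ι : Type} [Fintype ι] (𝒢 : ι → Geometry d) :
    I.gradBound 𝒢 = Real.sqrt (sSup {v : ℝ | ∃ t < I.T,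
      v = (Fintype.card ι : ℝ)⁻¹ *
        ∑ b, (𝒢 b).dualNorm (fun i => -I.scale (𝒢 b) * c t i) ^ 2}) := by
  rw [gradBound]
  congr 2
  ext v
  have h : ∀ t, ∑ b, ∑ ω, I.prob ω *
      (𝒢 b).dualNorm (fun i => -I.scale (𝒢 b) * c t i) ^ 2 =
      ∑ b, (𝒢 b).dualNorm (fun i => -I.scale (𝒢 b) * c t i) ^ 2 := fun t =>
    Finset.sum_congr rfl fun b _ => by rw [← Finset.sum_mul, I.prob_sum, one_mul]
  simp only [grad_scaledLoss hI, h, Set.mem_ofPred_eq]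
  exact ⟨fun ⟨t, ht, x, _, hv⟩ => ⟨t, ht, hv⟩, fun ⟨t, ht, hv⟩ => ⟨t, ht, I.start, I.start_mem, hv⟩⟩

theorem le_gradBound (hI : IsLinearWith I c e) {ι : Type} [Fintype ι] (𝒢 : ι → Geometry d)
    {t : ℕ} (ht : t < I.T) :
    Real.sqrt ((Fintype.card ι : ℝ)⁻¹ *
      ∑ b, (𝒢 b).dualNorm (fun i => -I.scale (𝒢 b) * c t i) ^ 2) ≤ I.gradBound 𝒢 := by
  rw [gradBound_eq hI]
  refine Real.sqrt_le_sqrt (le_csSup ?_ ⟨t, ht, rfl⟩)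
  refine (Set.Finite.subset ((Finset.range I.T).finite_toSet.image fun t =>
    (Fintype.card ι : ℝ)⁻¹ *
      ∑ b, (𝒢 b).dualNorm (fun i => -I.scale (𝒢 b) * c t i) ^ 2) ?_).bddAbove
  rintro _ ⟨t, ht, rfl⟩
  exact ⟨t, by simpa using ht, rfl⟩

theorem gradBound_le (hI : IsLinearWith I c e) {ι : Type} [Fintype ι] (𝒢 : ι → Geometry d)
    {B : ℝ} (hB : 0 ≤ B) (h : ∀ t < I.T, (Fintype.card ι : ℝ)⁻¹ *
      ∑ b, (𝒢 b).dualNorm (fun i => -I.scale (𝒢 b) * c t i) ^ 2 ≤ B) :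
    I.gradBound 𝒢 ≤ Real.sqrt B := by
  rw [gradBound_eq hI]
  refine Real.sqrt_le_sqrt (Real.sSup_le ?_ hB)
  rintro _ ⟨t, ht, rfl⟩
  exact h t ht

theorem regret_eq (hI : IsLinearWith I c e) (G : Geometry d) (ω : I.Ω) (X : ℕ → Fin d → ℝ) :
    regret (I.scaledK G) I.T (I.scaledLoss G ω) X =
      ∑ t ∈ Finset.range I.T, (1 - I.scale G * ∑ i, c t i * X t i) := by
  have hval : ∀ t z, I.scaledLoss G ω t z = -∑ i, c t i * (I.scale G • z) i := fun t z => by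
    rw [scaledLoss, hI.loss_eq]
  have hleast : IsLeast ((fun z => ∑ t ∈ Finset.range I.T, I.scaledLoss G ω t z) '' I.scaledK G)
      (-I.T) := by
    refine ⟨⟨(I.scale G)⁻¹ • e, I.mem_scaledK hI.mem, ?_⟩, ?_⟩
    · simp only [hval, smul_inv_smul₀ (I.scale_pos G).ne', hI.opt]
      simp
    · rintro _ ⟨z, hz, rfl⟩
      have h1 : ∑ t ∈ Finset.range I.T, (-1 : ℝ) ≤
          ∑ t ∈ Finset.range I.T, I.scaledLoss G ω t z := by
        refine Finset.sum_le_sum fun t _ => ?_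
        rw [hval]
        exact neg_le_neg (hI.le_one t _ (I.smul_mem_of_mem_scaledK hz))
      simpa using h1
  rw [regret, hleast.csInf_eq, Finset.sum_sub_distrib]
  simp only [scaledLoss_eq hI, Finset.mul_sum, mul_assoc, neg_mul, Finset.sum_neg_distrib]
  simp
  ring

theorem expRegret_eq (hI : IsLinearWith I c e) (κ : ℝ) {ι : Type} [Fintype ι]
    (𝒢 : ι → Geometry d) :
    I.expRegret κ 𝒢 = (Fintype.card ι : ℝ)⁻¹ * ∑ b, ∑ ω, I.prob ω *
      ∑ t ∈ Finset.range I.T, (1 - I.scale (𝒢 b) * ∑ i, c t i * I.run κ 𝒢 b ω t i) := by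
  simp only [expRegret, regret_eq hI]
  rfl

theorem scale_mul_sum_le_one (hI : IsLinearWith I c e) {G : Geometry d} {x : Fin d → ℝ}
    (hx : x ∈ I.scaledK G) (t : ℕ) : I.scale G * ∑ i, c t i * x i ≤ 1 := by
  refine le_of_eq_of_le ?_ (hI.le_one t _ (I.smul_mem_of_mem_scaledK hx))
  rw [Finset.mul_sum]
  exact Finset.sum_congr rfl fun i _ => by simp; ring

/-- If in every geometry the player gains at most `1 / 2` per round up to time `ℓ`, then the
expected regret is at least `min T ℓ / 2`. -/
theorem le_expRegret (hI : IsLinearWith I c e) (κ : ℝ) {ι : Type} [Fintype ι] [Nonempty ι]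
    (𝒢 : ι → Geometry d) (hc : ∀ b, ContinuousOn (𝒢 b).mirror (I.scaledK (𝒢 b))) {l : ℝ}
    (hl : 0 ≤ l) (h : ∀ b ω, ∀ t : ℕ, (t : ℝ) ≤ l →
      I.scale (𝒢 b) * ∑ i, c t i * I.run κ 𝒢 b ω t i ≤ 1 / 2) :
    min (I.T : ℝ) l / 2 ≤ I.expRegret κ 𝒢 := by
  rw [expRegret_eq hI]
  have hcard : (0 : ℝ) < Fintype.card ι := by exact_mod_cast Fintype.card_pos
  have key : ∀ b ω, min (I.T : ℝ) l / 2 ≤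
      ∑ t ∈ Finset.range I.T, (1 - I.scale (𝒢 b) * ∑ i, c t i * I.run κ 𝒢 b ω t i) := by
    intro b ω
    -- The indices `t = 0, …, ⌊l⌋` are `⌊l⌋ + 1 > l` rounds, so no rounding loss occurs; the
    -- remaining rounds have nonnegative regret.
    have h1 : ∑ t ∈ Finset.range (min I.T (⌊l⌋₊ + 1)), (1 / 2 : ℝ) ≤
        ∑ t ∈ Finset.range (min I.T (⌊l⌋₊ + 1)),
          (1 - I.scale (𝒢 b) * ∑ i, c t i * I.run κ 𝒢 b ω t i) := by
      refine Finset.sum_le_sum fun t ht => ?_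
      have ht' : t ≤ ⌊l⌋₊ := by
        have := (lt_min_iff.1 (Finset.mem_range.1 ht)).2
        omega
      have := h b ω t ((Nat.le_floor_iff hl).1 ht')
      linarith
    have h2 : ∑ t ∈ Finset.range (min I.T (⌊l⌋₊ + 1)),
          (1 - I.scale (𝒢 b) * ∑ i, c t i * I.run κ 𝒢 b ω t i) ≤
        ∑ t ∈ Finset.range I.T, (1 - I.scale (𝒢 b) * ∑ i, c t i * I.run κ 𝒢 b ω t i) := by
      refine Finset.sum_le_sum_of_subset_of_nonneg
        (Finset.range_subset_range.2 (min_le_left _ _)) fun t _ _ => ?_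
      have := scale_mul_sum_le_one hI (I.run_mem κ 𝒢 b ω (hc b) t) t
      linarith
    refine le_trans ?_ (h1.trans h2)
    simp only [Finset.sum_const, Finset.card_range, nsmul_eq_mul, mul_one_div]
    have : min (I.T : ℝ) l ≤ (min I.T (⌊l⌋₊ + 1) : ℕ) := by
      push_cast
      exact min_le_min le_rfl (Nat.lt_floor_add_one l).le
    linarith
  rw [le_inv_mul_iff₀ hcard]
  calc (Fintype.card ι : ℝ) * (min (I.T : ℝ) l / 2) = ∑ _b : ι, min (I.T : ℝ) l / 2 := by simp
    _ ≤ _ := by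
      refine Finset.sum_le_sum fun b _ => ?_
      calc min (I.T : ℝ) l / 2 = ∑ ω, I.prob ω * (min (I.T : ℝ) l / 2) := by
            rw [← Finset.sum_mul, I.prob_sum, one_mul]
        _ ≤ _ := Finset.sum_le_sum fun ω _ =>
            mul_le_mul_of_nonneg_left (key b ω) (I.prob_nonneg ω)

/-- The first round alone has positive regret, since the rescaling cancels at the starting point,
and later rounds cannot have negative regret. -/
theorem expRegret_pos (hI : IsLinearWith I c e) (κ : ℝ) {ι : Type} [Fintype ι] [Nonempty ι]
    (𝒢 : ι → Geometry d) (hc : ∀ b, ContinuousOn (𝒢 b).mirror (I.scaledK (𝒢 b)))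
    (hT : 0 < I.T) (h : ∑ i, c 0 i * I.start i < 1) : 0 < I.expRegret κ 𝒢 := by
  rw [expRegret_eq hI]
  have hcard : (0 : ℝ) < Fintype.card ι := by exact_mod_cast Fintype.card_pos
  set δ := 1 - ∑ i, c 0 i * I.start i
  have hδ : 0 < δ := sub_pos.2 h
  have key : ∀ b ω, δ ≤
      ∑ t ∈ Finset.range I.T, (1 - I.scale (𝒢 b) * ∑ i, c t i * I.run κ 𝒢 b ω t i) := by
    intro b ω
    have h0 : (1 - I.scale (𝒢 b) * ∑ i, c 0 i * I.run κ 𝒢 b ω 0 i) = δ := by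
      have hrun0 : ∀ i, I.run κ 𝒢 b ω 0 i = (I.scale (𝒢 b))⁻¹ * I.start i := fun i => rfl
      have h1 : I.scale (𝒢 b) * ∑ i, c 0 i * I.run κ 𝒢 b ω 0 i = ∑ i, c 0 i * I.start i := by
        rw [Finset.mul_sum]
        refine Finset.sum_congr rfl fun i _ => ?_
        have := (I.scale_pos (𝒢 b)).ne'
        rw [hrun0 i]
        field_simp
      rw [h1]
    rw [← h0]
    refine Finset.single_le_sum (f := fun t =>
      1 - I.scale (𝒢 b) * ∑ i, c t i * I.run κ 𝒢 b ω t i) (fun t _ => ?_)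
      (Finset.mem_range.2 hT)
    have := scale_mul_sum_le_one hI (I.run_mem κ 𝒢 b ω (hc b) t) t
    linarith
  refine mul_pos (inv_pos.2 hcard) (lt_of_lt_of_le (mul_pos hcard hδ) ?_)
  calc (Fintype.card ι : ℝ) * δ = ∑ _b : ι, δ := by simp
    _ ≤ _ := by
      refine Finset.sum_le_sum fun b _ => ?_
      calc δ = ∑ ω, I.prob ω * δ := by rw [← Finset.sum_mul, I.prob_sum, one_mul]
        _ ≤ _ := Finset.sum_le_sum fun ω _ =>
            mul_le_mul_of_nonneg_left (key b ω) (I.prob_nonneg ω)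

theorem stepSize_nonneg (κ : ℝ) (hκ : 0 ≤ κ) {ι : Type} [Fintype ι] (𝒢 : ι → Geometry d) (b : ι) :
    0 ≤ I.stepSize κ 𝒢 b := by
  unfold stepSize diameter gradBound
  positivity

theorem stepSize_le {κ : ℝ} (hκ : 0 ≤ κ) {ι : Type} [Fintype ι] (𝒢 : ι → Geometry d) (b : ι)
    {D G : ℝ} (hG : 0 < G) (hGb : G ≤ I.gradBound 𝒢) (hD : 0 ≤ D)
    (hDb : ∀ z ∈ I.scaledK (𝒢 b), bregman (𝒢 b).mirror z (I.scaledStart (𝒢 b)) ≤ D) :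
    I.stepSize κ 𝒢 b ≤ κ * Real.sqrt D / (G * Real.sqrt I.T) := by
  have h1 : diameter (I.scaledK (𝒢 b)) (𝒢 b).mirror (I.scaledStart (𝒢 b)) ≤ Real.sqrt D := by
    refine Real.sqrt_le_sqrt (Real.sSup_le ?_ hD)
    rintro _ ⟨z, hz, rfl⟩
    exact hDb z hz
  unfold stepSize
  rcases (Nat.cast_nonneg (α := ℝ) I.T).eq_or_lt with h | h
  · rw [← h]; simp
  gcongr

/-- The expected regret of mirror descent in a random block geometry. -/
theorem blockRegret_le (hI : IsLinearWith I c e) {κ : ℝ} (hκ : 0 < κ) {n : ℕ} (hn : 2 < n)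
    (hnd : n ∣ d) (hT : 0 < I.T) (hstart : ∑ i, c 0 i * I.start i < 1)
    (hc01 : ∀ t i, c t i = 0 ∨ c t i = 1) (hcs : ∀ t, ∑ i, c t i ≤ 2 * n)
    (hK0 : ∀ x ∈ I.K, ∀ i, 0 ≤ x i)
    (hK1 : ∀ (β : EqualPartition d n), ∀ x ∈ I.K, (blockGeometry β).norm x ≤ 1) :
    I.blockRegret κ n ≤ 5 * (1 / κ + κ) * Real.log n * Real.sqrt I.T := by
  have hl := one_lt_log hn
  have hcard := card_equalPartition_pos hnd
  set 𝒢 : EqualPartition d n → Geometry d := fun β => blockGeometry β with h𝒢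
  have hscale : ∀ β, I.scale (𝒢 β) = 1 := fun β => I.scale_eq_one (hK1 β)
  have hsK : ∀ β, I.scaledK (𝒢 β) = I.K := fun β => by simp [scaledK, hscale]
  have hsS : ∀ β, I.scaledStart (𝒢 β) = I.start := fun β => by simp [scaledStart, hscale]
  have hneg : ∀ β t, (𝒢 β).dualNorm (fun i => -I.scale (𝒢 β) * c t i) = (𝒢 β).dualNorm (c t) := by
    intro β t
    simp only [hscale]
    exact (dualNorm_mul β (-1) (c t)).trans (by simp [h𝒢])
  have hdual1 : ∀ β t, 1 ≤ (𝒢 β).dualNorm (c t) := by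
    intro β t
    have h1 := sum_mul_le_dualNorm_mul_norm β (c t) e
    rw [hI.opt] at h1
    have h2 : 0 ≤ (𝒢 β).dualNorm (c t) := Real.iSup_nonneg fun j => blockL2_nonneg _ _ _
    exact h1.trans (mul_le_of_le_one_right h2 (hK1 β e hI.mem))
  have hTr : (0 : ℝ) < I.T := by exact_mod_cast hT
  set s := Real.sqrt I.T with hs
  have hs0 : 0 < s := Real.sqrt_pos.2 hTr
  have hss : s ^ 2 = I.T := Real.sq_sqrt hTr.le
  set Γ := I.gradBound 𝒢 with hΓ
  have hΓ1 : 1 ≤ Γ := by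
    refine le_trans ?_ (le_gradBound hI 𝒢 hT)
    rw [Real.one_le_sqrt, le_inv_mul_iff₀ hcard, mul_one]
    calc (Fintype.card (EqualPartition d n) : ℝ) = ∑ _β : EqualPartition d n, (1 : ℝ) := by simp
      _ ≤ _ := Finset.sum_le_sum fun β _ => by
        rw [hneg]
        exact one_le_pow₀ (hdual1 β 0)
  have hΓle : Γ ≤ Real.sqrt (2 * (Real.log n + 2)) := by
    refine gradBound_le hI 𝒢 (by positivity) fun t _ => ?_
    simp only [hneg]
    exact avg_dualNorm_sq_le (by omega) (c t) (hc01 t) (hcs t)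
  -- The gradient bound holds only on average over the partitions, so the individual regret bounds
  -- must be summed over `β` before it is used.
  have hΓsq : ∀ t < I.T, ∑ β, (𝒢 β).dualNorm (c t) ^ 2 ≤
      Fintype.card (EqualPartition d n) * Γ ^ 2 := by
    intro t ht
    have h1 := le_gradBound hI 𝒢 ht
    simp only [hneg] at h1
    have h2 := (Real.sqrt_le_left (by linarith)).1 h1
    rwa [inv_mul_le_iff₀ hcard] at h2
  set Dm := Real.sqrt (1 / gam n) with hDm
  have hgam := gam_pos n (by omega)
  have hbreg : ∀ β, ∀ z ∈ I.K, bregman (𝒢 β).mirror z I.start ≤ 1 / gam n := fun β z hz =>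
    bregman_blockMirror_le (by omega) β (hK0 z hz) (hK0 _ I.start_mem) (hK1 β z hz)
      (hK1 β _ I.start_mem)
  have hbdd : ∀ β, BddAbove ((fun z => bregman (𝒢 β).mirror z I.start) '' I.K) := by
    intro β
    refine ⟨1 / gam n, ?_⟩
    rintro _ ⟨z, hz, rfl⟩
    exact hbreg β z hz
  set D : EqualPartition d n → ℝ := fun β => diameter I.K (𝒢 β).mirror I.start with hD
  have hDle : ∀ β, D β ≤ Dm := by
    intro β
    refine Real.sqrt_le_sqrt (Real.sSup_le ?_ (by positivity))
    rintro _ ⟨z, hz, rfl⟩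
    exact hbreg β z hz
  have hsc : ∀ β, ∀ x ∈ I.K, ∀ y ∈ I.K, (𝒢 β).norm (y - x) ^ 2 / 4 ≤ bregman (𝒢 β).mirror x y :=
    fun β x hx y hy => blockMirror_strongly_convex hn β (hK1 β x hx) (hK1 β y hy)
  -- The start differs from `e` because it gains less than `1` in the first round. Hence the
  -- diameter and the step size are strictly positive.
  have hBpos : ∀ β, 0 < bregman (𝒢 β).mirror e I.start := by
    intro β
    refine lt_of_lt_of_le ?_ (hsc β e hI.mem _ I.start_mem)
    have h1 := sum_mul_le_dualNorm_mul_norm β (-c 0) (I.start - e)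
    have h2 : ∑ i, (-c 0) i * (I.start - e) i = 1 - ∑ i, c 0 i * I.start i := by
      simp only [Pi.neg_apply, Pi.sub_apply, mul_sub, Finset.sum_sub_distrib, neg_mul,
        Finset.sum_neg_distrib, hI.opt]
      ring
    rw [h2] at h1
    have h3 : (blockGeometry β).norm (I.start - e) ≠ 0 := by
      intro h
      rw [h, mul_zero] at h1
      linarith
    positivity
  have hBD : ∀ β, bregman (𝒢 β).mirror e I.start ≤ D β ^ 2 := by
    intro β
    have h1 := le_csSup (hbdd β) ⟨e, hI.mem, rfl⟩
    rw [hD]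
    simp only [diameter]
    rw [Real.sq_sqrt ((hBpos β).le.trans h1)]
    exact h1
  have hDpos : ∀ β, 0 < D β := by
    intro β
    have h1 : 0 ≤ D β := Real.sqrt_nonneg _
    refine lt_of_le_of_ne h1 fun h => ?_
    have h2 := (hBpos β).trans_le (hBD β)
    rw [← h] at h2
    norm_num at h2
  have hη : ∀ β, I.stepSize κ 𝒢 β = κ * D β / (Γ * s) := fun β => by
    rw [stepSize, hsK, hsS]
  have hreg : ∀ β ω, ∑ t ∈ Finset.range I.T, (1 - I.scale (𝒢 β) * ∑ i, c t i * I.run κ 𝒢 β ω t i) ≤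
      Dm * Γ * s / κ + κ * Dm / (Γ * s) * ∑ t ∈ Finset.range I.T, (𝒢 β).dualNorm (c t) ^ 2 := by
    intro β ω
    have hηpos : 0 < κ * D β / (Γ * s) := by
      have := hDpos β
      positivity
    have h1 := omd_linearized_regret_le I.K_compact I.K_convex (differentiable_blockMirror β) hηpos
      (I.scaledLoss (𝒢 β) ω) I.start_mem (fun t i => -I.scale (𝒢 β) * c t i)
      (fun t x => grad_scaledLoss hI _ _ _ _) (𝒢 β).norm (𝒢 β).dualNorm (hsc β)
      (sum_mul_le_dualNorm_mul_norm β) hI.mem I.T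
    simp only [hneg] at h1
    have hrun : I.run κ 𝒢 β ω = omdIter I.K (blockGeometry β).mirror (κ * D β / (Γ * s))
        (I.scaledLoss (𝒢 β) ω) I.start := by
      rw [run, hη, hsK, hsS]
    rw [← hrun] at h1
    have h2 : ∀ t, ∑ i, (-I.scale (𝒢 β) * c t i) * (I.run κ 𝒢 β ω t i - e i) =
        1 - I.scale (𝒢 β) * ∑ i, c t i * I.run κ 𝒢 β ω t i := by
      intro t
      simp only [hscale, mul_sub, neg_mul, one_mul, Finset.sum_sub_distrib,
        Finset.sum_neg_distrib, hI.opt t]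
      ring
    simp only [h2] at h1
    refine h1.trans (add_le_add ?_ ?_)
    · calc bregman (blockGeometry β).mirror e I.start / (κ * D β / (Γ * s))
          ≤ D β ^ 2 / (κ * D β / (Γ * s)) := by
            gcongr
            exact hBD β
        _ = D β * Γ * s / κ := by
            have := (hDpos β).ne'
            have : Γ ≠ 0 := by positivity
            field_simp
        _ ≤ _ := by
            gcongr
            exact hDle β
    · have h3 : 0 ≤ ∑ t ∈ Finset.range I.T, (𝒢 β).dualNorm (c t) ^ 2 :=
        Finset.sum_nonneg fun t _ => sq_nonneg _
      refine mul_le_mul_of_nonneg_right ?_ h3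
      gcongr
      exact hDle β
  have hΓ0 : Γ ≠ 0 := by positivity
  have hfin : I.blockRegret κ n ≤ (1 / κ + κ) * (Dm * Γ) * s := by
    rw [blockRegret, expRegret_eq hI, inv_mul_le_iff₀ hcard]
    calc _ ≤ ∑ β : EqualPartition d n, (Dm * Γ * s / κ +
          κ * Dm / (Γ * s) * ∑ t ∈ Finset.range I.T, (𝒢 β).dualNorm (c t) ^ 2) := by
          refine Finset.sum_le_sum fun β _ => ?_
          calc _ ≤ ∑ ω, I.prob ω * (Dm * Γ * s / κ +
                κ * Dm / (Γ * s) * ∑ t ∈ Finset.range I.T, (𝒢 β).dualNorm (c t) ^ 2) :=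
                Finset.sum_le_sum fun ω _ =>
                  mul_le_mul_of_nonneg_left (hreg β ω) (I.prob_nonneg ω)
            _ = _ := by rw [← Finset.sum_mul, I.prob_sum, one_mul]
      _ = Fintype.card (EqualPartition d n) * (Dm * Γ * s / κ) + κ * Dm / (Γ * s) *
          ∑ t ∈ Finset.range I.T, ∑ β, (𝒢 β).dualNorm (c t) ^ 2 := by
          rw [Finset.sum_add_distrib, ← Finset.mul_sum, Finset.sum_comm]
          simp
      _ ≤ Fintype.card (EqualPartition d n) * (Dm * Γ * s / κ) + κ * Dm / (Γ * s) *
          ∑ t ∈ Finset.range I.T, Fintype.card (EqualPartition d n) * Γ ^ 2 := by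
          gcongr with t ht
          exact hΓsq t (Finset.mem_range.1 ht)
      _ = _ := by
          rw [Finset.sum_const, Finset.card_range, nsmul_eq_mul, ← hss]
          field_simp
  -- As `ln n > 1`, `D² G² ≤ e ln n · 2 (ln n + 2) ≤ 6 e (ln n)² ≤ 25 (ln n)²`.
  have hDG : Dm * Γ ≤ 5 * Real.log n := by
    have hgn : 1 / gam n = Real.exp 1 * Real.log n := by
      rw [gam, if_neg (by omega), if_neg (by omega), one_div_one_div]
    calc Dm * Γ ≤ Real.sqrt (1 / gam n) * Real.sqrt (2 * (Real.log n + 2)) := by gcongr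
      _ = Real.sqrt (Real.exp 1 * Real.log n * (2 * (Real.log n + 2))) := by
          rw [hgn, Real.sqrt_mul (by positivity) (2 * _)]
      _ ≤ 5 * Real.log n := by
          rw [Real.sqrt_le_left (by positivity)]
          have h3 := Real.exp_one_lt_d9
          have h4 : Real.log n * (2 * (Real.log n + 2)) ≤ 6 * Real.log n ^ 2 := by nlinarith
          have h5 : Real.exp 1 * (Real.log n * (2 * (Real.log n + 2))) ≤
              4 * (6 * Real.log n ^ 2) := by
            gcongr
            linarith
          nlinarith
  calc _ ≤ (1 / κ + κ) * (Dm * Γ) * s := hfin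
    _ ≤ (1 / κ + κ) * (5 * Real.log n) * s := by gcongr
    _ = _ := by ring

end OCOInstance

/-! ### Block norms and separable mirror maps -/

theorem blockNorm_le_sum_abs {d n : ℕ} (β : EqualPartition d n) (x : Fin d → ℝ) :
    (blockGeometry β).norm x ≤ ∑ i, |x i| := by
  rw [← Finset.sum_fiberwise (s := Finset.univ) (g := β.1)]
  change ∑ j, blockL2 β x j ≤ _
  refine Finset.sum_le_sum fun j _ => ?_
  have h0 : 0 ≤ ∑ i with β.1 i = j, |x i| := Finset.sum_nonneg fun i _ => abs_nonneg _
  refine (Real.sqrt_le_left h0).2 ?_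
  calc ∑ i with β.1 i = j, x i ^ 2 = ∑ i with β.1 i = j, |x i| ^ 2 := by simp only [sq_abs]
    _ ≤ _ := Finset.sum_sq_le_sq_sum_of_nonneg fun i _ => abs_nonneg _

theorem blockNorm_comb_le {d n : ℕ} (β : EqualPartition d n) (x y : Fin d → ℝ) {a b : ℝ}
    (ha : 0 ≤ a) (hb : 0 ≤ b) : (blockGeometry β).norm (a • x + b • y) ≤
      a * (blockGeometry β).norm x + b * (blockGeometry β).norm y := by
  simp only [blockGeometry, ← norm_blockMask, Finset.mul_sum]
  rw [← Finset.sum_add_distrib]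
  refine Finset.sum_le_sum fun j _ => ?_
  rw [map_add, map_smul, map_smul]
  refine (norm_add_le _ _).trans (le_of_eq ?_)
  rw [norm_smul, norm_smul, Real.norm_of_nonneg ha, Real.norm_of_nonneg hb]

theorem blockNorm_smul {d n : ℕ} (β : EqualPartition d n) (x : Fin d → ℝ) {a : ℝ}
    (ha : 0 ≤ a) : (blockGeometry β).norm (a • x) = a * (blockGeometry β).norm x := by
  simp only [blockGeometry, Finset.mul_sum]
  refine Finset.sum_congr rfl fun j _ => ?_
  rw [← abs_of_nonneg ha, ← blockL2_mul, abs_of_nonneg ha]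
  rfl

theorem blockNorm_const {d n : ℕ} (hn : 0 < n) (β : EqualPartition d n) {a : ℝ} (ha : 0 ≤ a) :
    (blockGeometry β).norm (fun _ => a) = n * Real.sqrt (d / n) * a := by
  have hn' : (0 : ℝ) < n := by exact_mod_cast hn
  have h : ∀ j, blockL2 β (fun _ => a) j = Real.sqrt (d / n) * a := by
    intro j
    have hj : ((Finset.univ.filter fun i => β.1 i = j).card : ℝ) = d / n := by
      rw [eq_div_iff hn'.ne', mul_comm]
      exact_mod_cast β.2 j
    rw [blockL2, Finset.sum_const, nsmul_eq_mul, hj, Real.sqrt_mul' _ (sq_nonneg a),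
      Real.sqrt_sq ha]
  simp only [blockGeometry, h]
  simp
  ring

/-- Duality tested against the basis vector at `i₀`, whose block norm is at most `1`. -/
theorem one_le_dualNorm {d n : ℕ} (β : EqualPartition d n) {c : Fin d → ℝ} {i₀ : Fin d}
    (h : c i₀ = 1) : 1 ≤ (blockGeometry β).dualNorm c := by
  have h1 := sum_mul_le_dualNorm_mul_norm β c (Pi.single i₀ 1)
  have h2 : ∑ i, c i * (Pi.single i₀ 1 : Fin d → ℝ) i = 1 := by simp [Pi.single_apply, h]
  have h3 : (blockGeometry β).norm (Pi.single i₀ 1) ≤ 1 := by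
    refine (blockNorm_le_sum_abs β _).trans (le_of_eq ?_)
    rw [Finset.sum_eq_single i₀]
    · simp
    · intro k _ hk; simp [hk]
    · simp
  rw [h2] at h1
  have h4 : 0 ≤ (blockGeometry β).dualNorm c := Real.iSup_nonneg fun j => blockL2_nonneg _ _ _
  exact h1.trans (mul_le_of_le_one_right h4 h3)

/-- The derivative of the one-dimensional mirror map `x ↦ x ^ p_n / (γ_n p_n)`. -/
noncomputable def mirrorDeriv (n : ℕ) (x : ℝ) : ℝ := 1 / gam n * x ^ (pexp n - 1)

theorem mirrorDeriv_one (x : ℝ) : mirrorDeriv 1 x = x := by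
  have h : (2 : ℝ) - 1 = 1 := by norm_num
  simp [mirrorDeriv, gam, pexp, h]

theorem mirrorDeriv_strictMonoOn {n : ℕ} (hn : 0 < n) :
    StrictMonoOn (mirrorDeriv n) (Set.Ici 0) := fun x hx y _ hxy =>
  mul_lt_mul_of_pos_left (Real.rpow_lt_rpow hx hxy (by linarith [one_lt_pexp n]))
    (one_div_pos.2 (gam_pos n hn))

theorem mirrorDeriv_of_lt {n : ℕ} (hn : 2 < n) (x : ℝ) :
    mirrorDeriv n x = Real.exp 1 * Real.log n * x ^ (1 / Real.log n) := by
  rw [mirrorDeriv, gam, pexp, if_neg (by omega), if_neg (by omega), if_neg (by omega),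
    one_div_one_div, add_sub_cancel_left]

theorem inv_rpow_inv_log {n : ℕ} (hn : 2 < n) :
    (1 / n : ℝ) ^ (1 / Real.log n) = Real.exp (-1) := by
  have := one_lt_log hn
  have hn' : (0 : ℝ) < n := by positivity
  rw [Real.rpow_def_of_pos (by positivity), one_div, Real.log_inv]
  congr 1
  field_simp

/-- Gives the dual coordinates of the uniform starting point, the reference level from which the
growth under `h_d` is measured. -/
theorem mirrorDeriv_inv {n : ℕ} (hn : 2 < n) : mirrorDeriv n (1 / n) = Real.log n := by
  rw [mirrorDeriv_of_lt hn, inv_rpow_inv_log hn, mul_right_comm, ← Real.exp_add]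
  simp

/-- The extreme cases `n = 1` and `n = d` have separable mirror maps (the latter on nonnegative
vectors), so their steps can be followed coordinate by coordinate. -/
theorem grad_blockMirror_one {d : ℕ} (β : EqualPartition d 1) (x : Fin d → ℝ) (i : Fin d) :
    grad (blockGeometry β).mirror x i = mirrorDeriv 1 (x i) := by
  rw [grad_blockMirror, mirrorDeriv_one]
  simp [gam, pexp]

theorem blockL2_self {d : ℕ} (β : EqualPartition d d) (x : Fin d → ℝ) (i : Fin d) :
    blockL2 β x (β.1 i) = |x i| := by
  have h1 : (Finset.univ.filter fun k => β.1 k = β.1 i).card = 1 := by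
    have := β.2 (β.1 i)
    have hd : 0 < d := i.pos
    exact Nat.eq_of_mul_eq_mul_left hd (by rw [this, mul_one])
  obtain ⟨k, hk⟩ := Finset.card_eq_one.1 h1
  have hi : i ∈ Finset.univ.filter fun k => β.1 k = β.1 i := by simp
  rw [hk, Finset.mem_singleton] at hi
  subst hi
  rw [blockL2, hk, Finset.sum_singleton, Real.sqrt_sq_eq_abs]

theorem grad_blockMirror_self {d : ℕ} (β : EqualPartition d d) (x : Fin d → ℝ) (i : Fin d)
    (hx : 0 ≤ x i) : grad (blockGeometry β).mirror x i = mirrorDeriv d (x i) := by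
  rw [grad_blockMirror, blockL2_self, abs_of_nonneg hx, mirrorDeriv, mul_assoc]
  congr 1
  have hp := one_lt_pexp d
  rcases hx.eq_or_lt with h | h
  · rw [← h, Real.zero_rpow (by linarith : pexp d - 1 ≠ 0), mul_zero]
  · rw [← Real.rpow_add_one h.ne']
    congr 1
    ring

/-! ### Minimizers of linear functionals -/

/-- In a convex combination that attains a lower bound of its terms, every term with positive
weight attains it. -/
theorem eq_of_sum_mul_le {d : ℕ} {w v : Fin d → ℝ} {μ : ℝ} (hw : ∀ i, 0 ≤ w i)
    (hv : ∀ i, μ ≤ v i) (h : ∑ i, v i * w i ≤ μ * ∑ i, w i) {i : Fin d} (hi : 0 < w i) :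
    v i = μ := by
  have h0 : ∀ j ∈ Finset.univ, 0 ≤ (v j - μ) * w j := fun j _ =>
    mul_nonneg (sub_nonneg.2 (hv j)) (hw j)
  have h1 : ∑ j, (v j - μ) * w j = 0 := by
    refine le_antisymm ?_ (Finset.sum_nonneg h0)
    simp only [sub_mul, Finset.sum_sub_distrib, ← Finset.mul_sum]
    linarith
  have h2 := (Finset.sum_eq_zero_iff_of_nonneg h0).1 h1 i (Finset.mem_univ i)
  rcases mul_eq_zero.1 h2 with h3 | h3
  · linarith
  · exact absurd h3 hi.ne'

theorem exists_le_of_sum_le {d : ℕ} (hd : 0 < d) {x y : Fin d → ℝ} (h : ∑ i, y i ≤ ∑ i, x i) :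
    ∃ j, y j ≤ x j := by
  by_contra! hc
  have : Nonempty (Fin d) := ⟨⟨0, hd⟩⟩
  exact absurd h (not_le.2 (Finset.sum_lt_sum_of_nonempty Finset.univ_nonempty fun i _ => hc i))

/-- One mirror descent step on the simplex raises the `i`-th dual coordinate by at most the
negative loss gradient. -/
theorem simplex_step_le {d : ℕ} {φ : ℝ → ℝ} (hφ : MonotoneOn φ (Set.Ici 0)) {x y a : Fin d → ℝ}
    (ha : ∀ i, 0 ≤ a i) (hx : x ∈ stdSimplex ℝ (Fin d)) (hy : y ∈ stdSimplex ℝ (Fin d))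
    (hmin : ∀ z ∈ stdSimplex ℝ (Fin d), 0 ≤ ∑ i, (-a i + φ (y i) - φ (x i)) * (z i - y i))
    (i : Fin d) : φ (y i) ≤ φ (x i) + a i := by
  set v : Fin d → ℝ := fun i => -a i + φ (y i) - φ (x i) with hv
  rcases (hy.1 i).eq_or_lt with h | h
  · have := hφ (Set.mem_Ici.2 (hy.1 i)) (Set.mem_Ici.2 (hx.1 i)) (by rw [← h]; exact hx.1 i)
    linarith [ha i]
  have h1 : ∀ j, ∑ i, v i * y i ≤ v j := by
    intro j
    have := hmin _ (single_mem_stdSimplex ℝ j)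
    simp only [mul_sub, Finset.sum_sub_distrib] at this
    simpa [Pi.single_apply, hv] using this
  have h2 : v i = ∑ i, v i * y i := eq_of_sum_mul_le hy.1 h1 (by rw [hy.2, mul_one]) h
  -- Both points have coordinate sum `1`, so some coordinate does not increase. There `v` is
  -- nonpositive, hence so is its minimum, which is attained at every coordinate with positive
  -- weight.
  obtain ⟨j, hj⟩ := exists_le_of_sum_le i.pos (x := x) (y := y) (by rw [hx.2, hy.2])
  have h3 := h1 j
  have h4 := hφ (Set.mem_Ici.2 (hy.1 j)) (Set.mem_Ici.2 (hx.1 j)) hj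
  have h5 : v j ≤ 0 := by
    simp only [hv]
    linarith [ha j]
  have h6 : v i ≤ 0 := by linarith
  simp only [hv] at h6
  linarith

/-! ### The polytope `conv(Δ_d ∪ {d^{-2/3} 1})` -/

theorem rpow_neg_two_thirds {m d : ℕ} (hd : d = m ^ 3) :
    (d : ℝ) ^ (-(2 / 3) : ℝ) = 1 / (m : ℝ) ^ 2 := by
  subst hd
  push_cast
  rw [← Real.rpow_natCast, ← Real.rpow_mul (Nat.cast_nonneg m), one_div, ← Real.rpow_natCast,
    ← Real.rpow_neg (Nat.cast_nonneg m)]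
  congr 1
  norm_num

theorem mem_polytope_iff {m d : ℕ} (hm : 1 ≤ m) (hd : d = m ^ 3) {x : Fin d → ℝ} :
    x ∈ polytope d ↔ ∃ α : ℝ, 0 ≤ α ∧ α ≤ 1 ∧ ∃ q ∈ stdSimplex ℝ (Fin d),
      ∀ i, x i = α / (m : ℝ) ^ 2 + (1 - α) * q i := by
  have hd0 : 0 < d := by rw [hd]; positivity
  have hne : (stdSimplex ℝ (Fin d)).Nonempty := ⟨_, single_mem_stdSimplex ℝ ⟨0, hd0⟩⟩
  rw [polytope, Set.union_singleton, convexHull_insert hne, (convex_stdSimplex ℝ _).convexHull_eq,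
    rpow_neg_two_thirds hd]
  simp only [mem_convexJoin, Set.mem_singleton_iff, exists_eq_left, segment, Set.mem_ofPred_eq]
  constructor
  · rintro ⟨q, hq, a, b, ha, hb, hab, rfl⟩
    refine ⟨a, ha, by linarith, q, hq, fun i => ?_⟩
    have : 1 - a = b := by linarith
    rw [this]
    simp [div_eq_mul_inv]
  · rintro ⟨a, ha, ha1, q, hq, h⟩
    refine ⟨q, hq, a, 1 - a, ha, by linarith, by ring, ?_⟩
    ext i
    rw [h]
    simp [div_eq_mul_inv]

theorem simplex_subset_polytope {d : ℕ} : stdSimplex ℝ (Fin d) ⊆ polytope d :=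
  Set.subset_union_left.trans (subset_convexHull ℝ _)

theorem const_mem_polytope {m d : ℕ} (hd : d = m ^ 3) :
    (fun _ => 1 / (m : ℝ) ^ 2) ∈ polytope d := by
  refine subset_convexHull ℝ _ (Or.inr ?_)
  rw [rpow_neg_two_thirds hd]
  rfl

theorem isCompact_polytope {m d : ℕ} (hm : 1 ≤ m) (hd : d = m ^ 3) : IsCompact (polytope d) := by
  have h : polytope d = (fun w : ℝ × (Fin d → ℝ) => fun i =>
      w.1 / (m : ℝ) ^ 2 + (1 - w.1) * w.2 i) '' (Set.Icc 0 1 ×ˢ stdSimplex ℝ (Fin d)) := by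
    ext x
    rw [mem_polytope_iff hm hd]
    constructor
    · rintro ⟨α, h0, h1, q, hq, h⟩
      exact ⟨(α, q), ⟨⟨h0, h1⟩, hq⟩, funext fun i => (h i).symm⟩
    · rintro ⟨⟨α, q⟩, ⟨⟨h0, h1⟩, hq⟩, rfl⟩
      exact ⟨α, h0, h1, q, hq, fun i => rfl⟩
  rw [h]
  refine (isCompact_Icc.prod (isCompact_stdSimplex ℝ (Fin d))).image ?_
  fun_prop

theorem polytope_nonneg {m d : ℕ} (hm : 1 ≤ m) (hd : d = m ^ 3) {x : Fin d → ℝ}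
    (hx : x ∈ polytope d) (i : Fin d) : 0 ≤ x i := by
  obtain ⟨α, h0, h1, q, hq, h⟩ := (mem_polytope_iff hm hd).1 hx
  rw [h]
  exact add_nonneg (by positivity) (mul_nonneg (by linarith) (hq.1 i))

theorem sum_polytope_eq {m d : ℕ} (hm : 1 ≤ m) (hd : d = m ^ 3) {x q : Fin d → ℝ} {α : ℝ}
    (hq : q ∈ stdSimplex ℝ (Fin d)) (h : ∀ i, x i = α / (m : ℝ) ^ 2 + (1 - α) * q i) :
    ∑ i, x i = α * m + (1 - α) := by
  have hm' : (0 : ℝ) < m := by exact_mod_cast hm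
  rw [Finset.sum_congr rfl fun i _ => h i, Finset.sum_add_distrib, ← Finset.mul_sum, hq.2]
  simp only [Finset.sum_const, Finset.card_univ, Fintype.card_fin, nsmul_eq_mul, hd]
  push_cast
  field_simp

/-- Complementary slackness: every vertex carrying weight in the minimizer `y` attains the minimum
`μ` of the functional `v`. At the constant vertex the functional equals `(∑ i, v i) / m²`. -/
theorem polytope_minimizer {m d : ℕ} (hd : d = m ^ 3) {v y q : Fin d → ℝ} {α : ℝ}
    (h0 : 0 ≤ α) (h1 : α ≤ 1) (hq : q ∈ stdSimplex ℝ (Fin d))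
    (hy : ∀ i, y i = α / (m : ℝ) ^ 2 + (1 - α) * q i)
    (hmin : ∀ z ∈ polytope d, ∑ i, v i * y i ≤ ∑ i, v i * z i) :
    ∃ μ, (∀ j, μ ≤ v j) ∧ (∀ i, 0 < (1 - α) * q i → v i = μ) ∧ μ ≤ (∑ i, v i) / (m : ℝ) ^ 2 ∧
      (0 < α → (∑ i, v i) / (m : ℝ) ^ 2 = μ) := by
  set μ := ∑ i, v i * y i with hμ
  have hv : ∀ j, μ ≤ v j := by
    intro j
    have := hmin _ (simplex_subset_polytope (single_mem_stdSimplex ℝ j))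
    simpa [Pi.single_apply] using this
  have hp : μ ≤ (∑ i, v i) / (m : ℝ) ^ 2 := by
    have := hmin _ (const_mem_polytope hd)
    rwa [← Finset.sum_mul, mul_one_div] at this
  have hμ2 : μ = α * ((∑ i, v i) / (m : ℝ) ^ 2) + (1 - α) * ∑ i, v i * q i := by
    rw [hμ, Finset.sum_congr rfl fun i _ => by rw [hy i], Finset.mul_sum]
    simp only [mul_add, Finset.sum_add_distrib]
    rw [← Finset.sum_mul]
    congr 1
    · ring
    · exact Finset.sum_congr rfl fun i _ => by ring
  have hvq : μ ≤ ∑ i, v i * q i := by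
    calc μ = ∑ i, μ * q i := by rw [← Finset.mul_sum, hq.2, mul_one]
      _ ≤ _ := Finset.sum_le_sum fun i _ => mul_le_mul_of_nonneg_right (hv i) (hq.1 i)
  refine ⟨μ, hv, fun i hi => ?_, hp, fun hα => ?_⟩
  · refine eq_of_sum_mul_le (w := fun i => (1 - α) * q i)
      (fun i => mul_nonneg (by linarith) (hq.1 i)) hv ?_ hi
    have e1 : ∑ i, v i * ((1 - α) * q i) = (1 - α) * ∑ i, v i * q i := by
      rw [Finset.mul_sum]
      exact Finset.sum_congr rfl fun i _ => by ring
    rw [e1, ← Finset.mul_sum, hq.2, mul_one]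
    have := mul_le_mul_of_nonneg_left hp h0
    linarith
  · have := mul_le_mul_of_nonneg_left hvq (by linarith : 0 ≤ 1 - α)
    have h2 : α * ((∑ i, v i) / (m : ℝ) ^ 2) ≤ α * μ := by linarith
    exact le_antisymm (le_of_mul_le_mul_left h2 hα) hp

/-- One projected gradient step on the polytope. -/
theorem polytope_euclidean_step_le {m d : ℕ} (hm : 2 ≤ m) (hd : d = m ^ 3) {x y a : Fin d → ℝ}
    (ha : ∀ i, 0 ≤ a i) (hx : x ∈ polytope d) (hy : y ∈ polytope d)
    (hmin : ∀ z ∈ polytope d, 0 ≤ ∑ i, (-a i + y i - x i) * (z i - y i)) (i : Fin d) :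
    y i ≤ max (1 / (m : ℝ) ^ 2) (x i + a i) := by
  have hm' : (2 : ℝ) ≤ m := by exact_mod_cast hm
  have hd0 : 0 < d := i.pos
  obtain ⟨α, h0, h1, q, hq, hyq⟩ := (mem_polytope_iff (by omega) hd).1 hy
  obtain ⟨α', h0', h1', q', hq', hxq⟩ := (mem_polytope_iff (by omega) hd).1 hx
  set v : Fin d → ℝ := fun i => -a i + y i - x i with hv
  obtain ⟨μ, hμ, hμi, -, hμα⟩ := polytope_minimizer (v := v) hd h0 h1 hq hyq
    fun z hz => by
      have := hmin z hz
      simp only [mul_sub, Finset.sum_sub_distrib] at this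
      linarith
  -- If `α = 0`, then `y` has the smallest coordinate sum in the polytope, so some coordinate does
  -- not increase. If `α > 0`, the constant vertex is optimal and `m² μ = ∑ v ≥ m³ μ`, impossible
  -- for `μ > 0`.
  have hμ0 : μ ≤ 0 := by
    rcases h0.eq_or_lt with hα | hα
    · have hsy := sum_polytope_eq (by omega) hd hq hyq
      have hsx := sum_polytope_eq (by omega) hd hq' hxq
      rw [← hα] at hsy
      obtain ⟨j, hj⟩ := exists_le_of_sum_le hd0 (x := x) (y := y) (by rw [hsx, hsy]; nlinarith)
      have := hμ j
      simp only [hv] at this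
      linarith [ha j]
    · have h2 := hμα hα
      have h3 : (d : ℝ) * μ ≤ ∑ i, v i := by
        calc (d : ℝ) * μ = ∑ _i : Fin d, μ := by simp
          _ ≤ _ := Finset.sum_le_sum fun i _ => hμ i
      rw [div_eq_iff (by positivity)] at h2
      rw [h2, hd] at h3
      push_cast at h3
      by_contra! hc
      have h4 : μ * (m : ℝ) ^ 2 * 1 < μ * (m : ℝ) ^ 2 * m := by
        gcongr
        linarith
      nlinarith
  by_cases hi : 0 < (1 - α) * q i
  · have h2 := hμi i hi
    refine le_max_of_le_right ?_
    simp only [hv] at h2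
    linarith
  -- Without weight on vertex `i`, only the constant vertex contributes to this coordinate.
  · refine le_max_of_le_left ?_
    have h3 : α / (m : ℝ) ^ 2 ≤ 1 / (m : ℝ) ^ 2 := by gcongr
    rw [hyq]
    linarith

/-- One mirror descent step on a multiple of the polytope, for a separable mirror map, keeps the
dual coordinate `i₀` maximal, and it decreases the potential `∑ φ(x_j) - m² φ(x_{i₀})` by at most
`m² a_{i₀}` unless it returns to the constant vertex. -/
theorem polytope_potential_step {m d : ℕ} (hm : 1 ≤ m) (hd : d = m ^ 3) {φ : ℝ → ℝ}
    (hφ : StrictMonoOn φ (Set.Ici 0)) {ρ : ℝ} (hρ : 0 < ρ) {x y y' a : Fin d → ℝ}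
    (ha : ∀ i, 0 ≤ a i) {i₀ : Fin d} (ha₀ : ∀ i, a i ≤ a i₀) (hy' : y' ∈ polytope d)
    (hy : ∀ i, y i = ρ * y' i)
    (hmin : ∀ z ∈ polytope d, 0 ≤ ∑ i, (-a i + φ (y i) - φ (x i)) * (ρ * z i - y i))
    (hx₀ : ∀ i, φ (x i) ≤ φ (x i₀)) :
    (∀ i, φ (y i) ≤ φ (y i₀)) ∧ ((∀ i, y i = ρ * (1 / (m : ℝ) ^ 2)) ∨
      ∑ i, φ (x i) - (m : ℝ) ^ 2 * φ (x i₀) - (m : ℝ) ^ 2 * a i₀ ≤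
        ∑ i, φ (y i) - (m : ℝ) ^ 2 * φ (y i₀)) := by
  have hm' : (0 : ℝ) < m := by exact_mod_cast hm
  obtain ⟨α, h0, h1, q, hq, hyq⟩ := (mem_polytope_iff hm hd).1 hy'
  set v : Fin d → ℝ := fun i => -a i + φ (y i) - φ (x i) with hv
  obtain ⟨μ, hμ, hμi, hμs, -⟩ := polytope_minimizer (v := v) hd h0 h1 hq hyq fun z hz => by
    have h2 := hmin z hz
    have h3 : ∑ i, v i * (ρ * z i - y i) = ρ * (∑ i, v i * z i - ∑ i, v i * y' i) := by
      rw [← Finset.sum_sub_distrib, Finset.mul_sum]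
      exact Finset.sum_congr rfl fun i _ => by rw [hy i]; ring
    rw [h3] at h2
    have := nonneg_of_mul_nonneg_right h2 hρ
    linarith
  have hyn : ∀ i, 0 ≤ y i := fun i => by
    rw [hy]
    exact mul_nonneg hρ.le (polytope_nonneg hm hd hy' i)
  -- A coordinate with simplex weight minimizes `v`, so its dual value is controlled by that of
  -- `i₀`, which starts highest and is pushed most. A coordinate without such weight has the least
  -- possible value `ρ α / m²`.
  have hmax : ∀ i, φ (y i) ≤ φ (y i₀) := by
    intro i
    by_cases hi : 0 < (1 - α) * q i
    · have h2 := hμi i hi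
      have h3 := hμ i₀
      simp only [hv] at h2 h3
      linarith [hx₀ i, ha₀ i]
    · refine hφ.monotoneOn (hyn i) (hyn i₀) ?_
      rw [hy, hy, hyq, hyq]
      have := mul_nonneg (by linarith : 0 ≤ 1 - α) (hq.1 i₀)
      refine mul_le_mul_of_nonneg_left ?_ hρ.le
      linarith
  refine ⟨hmax, ?_⟩
  -- If `i₀` carries weight, comparing it with the constant vertex gives `m² v i₀ ≤ ∑ v`, which is
  -- the bound on the potential. Otherwise maximality of `i₀` leaves no simplex weight at all.
  by_cases hi₀ : 0 < (1 - α) * q i₀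
  · right
    have h2 := hμi i₀ hi₀
    rw [← h2, le_div_iff₀ (by positivity)] at hμs
    have h3 : ∑ i, v i = -∑ i, a i + ∑ i, φ (y i) - ∑ i, φ (x i) := by
      simp only [hv, Finset.sum_sub_distrib, Finset.sum_add_distrib, Finset.sum_neg_distrib]
    rw [h3] at hμs
    simp only [hv] at hμs
    have : 0 ≤ ∑ i, a i := Finset.sum_nonneg fun i _ => ha i
    nlinarith
  · left
    have hz : ∀ i, (1 - α) * q i = 0 := by
      intro i
      have h2 := mul_nonneg (by linarith : 0 ≤ 1 - α) (hq.1 i)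
      rcases h2.eq_or_lt with h | h
      · exact h.symm
      · exfalso
        have h3 : y i₀ < y i := by
          rw [hy, hy, hyq, hyq]
          refine mul_lt_mul_of_pos_left ?_ hρ
          linarith
        exact absurd (hmax i) (not_le.2 (hφ (hyn i₀) (hyn i) h3))
    have hα : 1 - α = 0 := by
      have : ∑ i, (1 - α) * q i = 0 := Finset.sum_eq_zero fun i _ => hz i
      rwa [← Finset.mul_sum, hq.2, mul_one] at this
    intro i
    rw [hy, hyq, hz, add_zero]
    congr 2
    linarith

/-! ### Sparse cyclic vectors -/

/-- The `0`-`1` vector of round `t`: coordinate `0` together with the `t`-th of `d / S` disjoint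
groups of `S - 1` further coordinates, which are used cyclically. -/
noncomputable def sparseVec (d S t : ℕ) : Fin d → ℝ := fun i =>
  -- The guard makes the vector zero for `S = 0`, so sparsity holds even when `⌊ln d⌋ = 0`.
  if 1 ≤ S ∧ ((i : ℕ) = 0 ∨ (t % (d / S) * (S - 1) < i ∧ (i : ℕ) ≤ t % (d / S) * (S - 1) + (S - 1)))
  then 1 else 0

theorem sparseVec_zero_or_one (d S t : ℕ) (i : Fin d) :
    sparseVec d S t i = 0 ∨ sparseVec d S t i = 1 := by
  unfold sparseVec
  split_ifs <;> simp

theorem sparseVec_nonneg (d S t : ℕ) (i : Fin d) : 0 ≤ sparseVec d S t i := by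
  rcases sparseVec_zero_or_one d S t i with h | h <;> rw [h]
  exact zero_le_one

theorem sparseVec_le_one (d S t : ℕ) (i : Fin d) : sparseVec d S t i ≤ 1 := by
  rcases sparseVec_zero_or_one d S t i with h | h <;> rw [h]
  exact zero_le_one

theorem sparseVec_zero {d S : ℕ} (hS : 1 ≤ S) (t : ℕ) (hd : 0 < d) :
    sparseVec d S t ⟨0, hd⟩ = 1 := by
  simp [sparseVec, hS]

theorem sum_sparseVec {d S : ℕ} (hS : 1 ≤ S) (hSd : S ≤ d) (t : ℕ) :
    ∑ i, sparseVec d S t i = S := by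
  set a := t % (d / S) * (S - 1) with ha
  have hN : 0 < d / S := Nat.div_pos hSd hS
  have hle : a + (S - 1) + 1 ≤ d := by
    have h1 : t % (d / S) + 1 ≤ d / S := Nat.mod_lt _ hN
    have h2 : (t % (d / S) + 1) * (S - 1) ≤ d / S * (S - 1) := Nat.mul_le_mul_right _ h1
    have h3 : d / S * S ≤ d := Nat.div_mul_le_self d S
    have h4 : d / S * (S - 1) + d / S = d / S * S := by
      rw [← Nat.mul_succ]; congr 1; omega
    rw [add_mul, one_mul] at h2
    omega
  have h1 : ∑ i, sparseVec d S t i =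
      ∑ k ∈ Finset.range d, if k = 0 ∨ (a < k ∧ k ≤ a + (S - 1)) then (1 : ℝ) else 0 := by
    rw [← Fin.sum_univ_eq_sum_range (fun k => if k = 0 ∨ (a < k ∧ k ≤ a + (S - 1)) then (1 : ℝ)
      else 0)]
    refine Finset.sum_congr rfl fun i _ => ?_
    simp [sparseVec, hS, ha]
  rw [h1, ← Finset.sum_filter, Finset.sum_const, nsmul_eq_mul, mul_one]
  have h2 : (Finset.range d).filter (fun k => k = 0 ∨ (a < k ∧ k ≤ a + (S - 1))) =
      insert 0 (Finset.Ioc a (a + (S - 1))) := by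
    ext k
    simp only [Finset.mem_filter, Finset.mem_range, Finset.mem_insert, Finset.mem_Ioc]
    omega
  rw [h2, Finset.card_insert_of_notMem (by simp), Nat.card_Ioc]
  congr 1
  omega

/-- A coordinate of the current group has been used in at most one round of each earlier cycle. -/
theorem sum_range_sparseVec_le {d S t : ℕ} {i : Fin d} (hi : (i : ℕ) ≠ 0)
    (hc : sparseVec d S t i = 1) :
    ∑ s ∈ Finset.range t, sparseVec d S s i ≤ (t : ℝ) / (d / S : ℕ) := by
  have hmem : ∀ s, sparseVec d S s i = 1 → s % (d / S) * (S - 1) < i ∧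
      (i : ℕ) ≤ s % (d / S) * (S - 1) + (S - 1) := by
    intro s hs
    by_contra h
    have : sparseVec d S s i = 0 := if_neg fun h' => h'.2.elim hi h
    rw [this] at hs
    norm_num at hs
  have huniq : ∀ a b L k : ℕ, a * L < k → k ≤ b * L + L → a ≤ b := by
    intro a b L k h1 h2
    by_contra! h
    have : (b + 1) * L ≤ a * L := Nat.mul_le_mul_right _ h
    rw [add_mul, one_mul] at this
    omega
  have hmod : ∀ s, sparseVec d S s i = 1 → s % (d / S) = t % (d / S) := fun s hs =>
    le_antisymm (huniq _ _ _ _ (hmem s hs).1 (hmem t hc).2)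
      (huniq _ _ _ _ (hmem t hc).1 (hmem s hs).2)
  set N := d / S with hN
  have hsum : ∑ s ∈ Finset.range t, sparseVec d S s i =
      ((Finset.range t).filter fun s => sparseVec d S s i = 1).card := by
    rw [Finset.card_filter]
    push_cast
    refine Finset.sum_congr rfl fun s _ => ?_
    rcases sparseVec_zero_or_one d S s i with h | h <;> simp [h]
  -- All rounds using coordinate `i` have the residue of `t` modulo `N`, so such a round `s < t` is
  -- determined by its quotient, which is below `t / N`.
  have hinj : ((Finset.range t).filter fun s => sparseVec d S s i = 1).card ≤
      (Finset.range (t / N)).card := by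
    refine Finset.card_le_card_of_injOn (fun s => s / N) ?_ ?_
    · intro s hs
      simp only [Finset.coe_filter, Finset.mem_range, Set.mem_ofPred_eq] at hs
      simp only [Finset.coe_range, Set.mem_Iio]
      by_contra! h
      have h1 := Nat.div_add_mod s N
      have h2 := Nat.div_add_mod t N
      have h3 : N * (t / N) ≤ N * (s / N) := Nat.mul_le_mul_left _ h
      have h4 := hmod s hs.2
      omega
    · intro s hs s' hs' h
      simp only [Finset.coe_filter, Finset.mem_range, Set.mem_ofPred_eq] at hs hs'
      simp only at h
      have h1 := Nat.div_add_mod s N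
      have h2 := Nat.div_add_mod s' N
      have h3 := hmod s hs.2
      have h4 := hmod s' hs'.2
      rw [← h1, ← h2, h, h3, h4]
  rw [hsum]
  rw [Finset.card_range] at hinj
  exact le_trans (by exact_mod_cast hinj) Nat.cast_div_le

/-- The gain of a slowly moving player in round `t`. -/
theorem sum_sparseVec_mul_le {d S t : ℕ} (hS : 1 ≤ S) (hSd : S ≤ d) (hN : 4 * S ≤ d / S)
    {b η : ℝ} (hb : 0 ≤ b) (hη : 0 ≤ η) (hbS : b * (1 + S) ≤ 1 / 8) (hηt : η * t ≤ 1 / 4)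
    {x : Fin d → ℝ} (hx : ∀ i, x i ≤ b + η * ∑ s ∈ Finset.range t, sparseVec d S s i) :
    ∑ i, sparseVec d S t i * x i ≤ 1 / 2 := by
  have hd : 0 < d := lt_of_lt_of_le hS hSd
  set N := d / S with hNdef
  have hS' : (1 : ℝ) ≤ S := by exact_mod_cast hS
  have hN' : 4 * (S : ℝ) ≤ N := by exact_mod_cast hN
  have hN0 : (0 : ℝ) < N := by linarith
  have h1 : ∀ i, sparseVec d S t i * x i ≤
      (if i = ⟨0, hd⟩ then b + η * t else 0) + sparseVec d S t i * (b + η * t / N) := by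
    intro i
    have hpos : 0 ≤ b + η * t / N := by positivity
    split_ifs with h
    · subst h
      rw [sparseVec_zero hS, one_mul, one_mul]
      refine (hx _).trans ?_
      have h2 : ∑ s ∈ Finset.range t, sparseVec d S s ⟨0, hd⟩ = t := by
        simp [sparseVec_zero hS]
      rw [h2]
      linarith
    · rw [zero_add]
      rcases sparseVec_zero_or_one d S t i with h2 | h2
      · rw [h2, zero_mul, zero_mul]
      · rw [h2, one_mul, one_mul]
        refine (hx i).trans ?_
        rw [mul_div_assoc]
        gcongr
        exact sum_range_sparseVec_le (fun h3 => h (Fin.ext h3)) h2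
  calc _ ≤ ∑ i, ((if i = ⟨0, hd⟩ then b + η * t else 0) +
        sparseVec d S t i * (b + η * t / N)) := Finset.sum_le_sum fun i _ => h1 i
    _ = b * (1 + S) + η * t + S * (η * t / N) := by
        rw [Finset.sum_add_distrib, ← Finset.sum_mul, sum_sparseVec hS hSd]
        simp
        ring
    _ ≤ 1 / 8 + 1 / 4 + 1 / 16 := by
        have h2 : S * (η * t / N) ≤ 1 / 16 := by
          rw [mul_div_assoc', div_le_iff₀ hN0]
          have : 0 ≤ η * t := by positivity
          nlinarith
        linarith
    _ ≤ 1 / 2 := by norm_num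

/-! ### The entropic mirror map -/

theorem grad_entMirror {d : ℕ} {x : Fin d → ℝ} (hx : ∀ i, 0 < x i) (i : Fin d) :
    grad (entGeometry d).mirror x i = Real.log (x i) + 1 := by
  have h : HasFDerivAt (entGeometry d).mirror (∑ j, (Real.log (x j) + 1) •
      ContinuousLinearMap.proj (R := ℝ) (φ := fun _ : Fin d => ℝ) j) x := by
    change HasFDerivAt (fun x : Fin d → ℝ => ∑ i, x i * Real.log (x i)) _ x
    refine HasFDerivAt.fun_sum fun j _ => ?_
    exact (Real.hasDerivAt_mul_log (hx j).ne').comp_hasFDerivAt x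
      (ContinuousLinearMap.proj (R := ℝ) (φ := fun _ : Fin d => ℝ) j).hasFDerivAt
  simp [grad, h.fderiv, Pi.single_apply]

theorem continuous_entMirror (d : ℕ) : Continuous (entGeometry d).mirror :=
  show Continuous fun x : Fin d → ℝ => ∑ i, x i * Real.log (x i) from
  continuous_finsetSum _ fun i _ => Real.continuous_mul_log.comp (continuous_apply i)

theorem bregman_entMirror {d : ℕ} {x z : Fin d → ℝ} (hx : ∀ i, 0 < x i)
    (hs : ∑ i, z i = ∑ i, x i) :
    bregman (entGeometry d).mirror z x = ∑ i, z i * (Real.log (z i) - Real.log (x i)) := by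
  simp only [bregman, grad_entMirror hx]
  have h : ∑ i, (Real.log (x i) + 1) * (z i - x i) =
      ∑ i, z i * Real.log (x i) - ∑ i, x i * Real.log (x i) + (∑ i, z i - ∑ i, x i) := by
    simp only [← Finset.sum_sub_distrib, ← Finset.sum_add_distrib]
    exact Finset.sum_congr rfl fun i _ => by ring
  rw [h, hs]
  simp only [entGeometry, mul_sub, Finset.sum_sub_distrib]
  ring

theorem bregman_entMirror_uniform_le {d : ℕ} (hd : 0 < d) {z : Fin d → ℝ}
    (hz : z ∈ stdSimplex ℝ (Fin d)) :
    bregman (entGeometry d).mirror z (fun _ => 1 / d) ≤ Real.log d := by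
  have hd' : (0 : ℝ) < d := by exact_mod_cast hd
  rw [bregman_entMirror (fun _ => by positivity) (by rw [hz.2]; simp; field_simp)]
  calc _ ≤ ∑ i, z i * Real.log d := by
        refine Finset.sum_le_sum fun i _ => mul_le_mul_of_nonneg_left ?_ (hz.1 i)
        have h1 : z i ≤ 1 := by
          rw [← hz.2]
          exact Finset.single_le_sum (fun j _ => hz.1 j) (Finset.mem_univ i)
        have := Real.log_nonpos (hz.1 i) h1
        rw [one_div, Real.log_inv]
        linarith
    _ = Real.log d := by rw [← Finset.sum_mul, hz.2, one_mul]

/-- An exponentiated gradient step multiplies the `i`-th coordinate by at most `exp (a i)`. -/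
theorem entropic_step_le {d : ℕ} {η : ℝ} {g x y a : Fin d → ℝ} (hx : x ∈ stdSimplex ℝ (Fin d))
    (hx0 : ∀ i, 0 < x i) (hag : ∀ i, η * g i = -a i) (ha : ∀ i, 0 ≤ a i)
    (hy : y ∈ stdSimplex ℝ (Fin d))
    (hmin : IsMinOn (omdObjective (entGeometry d).mirror η g x) (stdSimplex ℝ (Fin d)) y)
    (i : Fin d) : 0 < y i ∧ y i ≤ x i * Real.exp (a i) := by
  set Z := ∑ i, x i * Real.exp (a i) with hZ
  have hZ1 : 1 ≤ Z := by
    rw [← hx.2]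
    exact Finset.sum_le_sum fun i _ => le_mul_of_one_le_right (hx.1 i) (Real.one_le_exp (ha i))
  have hZ0 : 0 < Z := by linarith
  -- On the simplex the objective is the relative entropy to `w` minus `ln Z`, so `w` is the unique
  -- minimizer. This avoids differentiating at `y`, which might lie on the boundary; `Z ≥ 1` then
  -- permits dropping the normalization.
  set w : Fin d → ℝ := fun i => x i * Real.exp (a i) / Z with hw
  have hw0 : ∀ i, 0 < w i := fun i => div_pos (mul_pos (hx0 i) (Real.exp_pos _)) hZ0
  have hws : ∑ i, w i = 1 := by
    rw [hw, ← Finset.sum_div, ← hZ, div_self hZ0.ne']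
  have hlogw : ∀ i, Real.log (w i) = Real.log (x i) + a i - Real.log Z := by
    intro i
    rw [hw]
    simp only
    rw [Real.log_div (mul_pos (hx0 i) (Real.exp_pos _)).ne' hZ0.ne',
      Real.log_mul (hx0 i).ne' (Real.exp_ne_zero _), Real.log_exp]
  have hobj : ∀ z ∈ stdSimplex ℝ (Fin d), omdObjective (entGeometry d).mirror η g x z =
      ∑ i, z i * (Real.log (z i) - Real.log (w i)) - Real.log Z := by
    intro z hz
    rw [omdObjective, bregman_entMirror hx0 (by rw [hz.2, hx.2]), Finset.mul_sum,
      ← Finset.sum_add_distrib]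
    have : Real.log Z = ∑ i, z i * Real.log Z := by rw [← Finset.sum_mul, hz.2, one_mul]
    rw [this, ← Finset.sum_sub_distrib]
    refine Finset.sum_congr rfl fun i _ => ?_
    rw [hlogw, ← mul_assoc, hag]
    ring
  have hwm : w ∈ stdSimplex ℝ (Fin d) := ⟨fun i => (hw0 i).le, hws⟩
  have h1 : omdObjective (entGeometry d).mirror η g x y ≤
      omdObjective (entGeometry d).mirror η g x w := hmin hwm
  rw [hobj y hy, hobj w hwm] at h1
  simp only [sub_self, mul_zero, Finset.sum_const_zero] at h1
  have hkl : ∀ i, w i * InformationTheory.klFun (y i / w i) =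
      y i * (Real.log (y i) - Real.log (w i)) + w i - y i := by
    intro i
    rw [InformationTheory.klFun_apply]
    rcases (hy.1 i).eq_or_lt with h | h
    · rw [← h]; simp
    · rw [Real.log_div h.ne' (hw0 i).ne']
      have := (hw0 i).ne'
      field_simp
  have h0 : ∀ i ∈ Finset.univ, 0 ≤ w i * InformationTheory.klFun (y i / w i) := fun i _ =>
    mul_nonneg (hw0 i).le (InformationTheory.klFun_nonneg (div_nonneg (hy.1 i) (hw0 i).le))
  have hsum : ∑ i, w i * InformationTheory.klFun (y i / w i) = 0 := by
    refine le_antisymm ?_ (Finset.sum_nonneg h0)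
    simp only [hkl, Finset.sum_sub_distrib, Finset.sum_add_distrib, hws, hy.2]
    linarith
  have h2 := (Finset.sum_eq_zero_iff_of_nonneg h0).1 hsum i (Finset.mem_univ i)
  have h3 : y i / w i = 1 := by
    rw [← InformationTheory.klFun_eq_zero_iff (div_nonneg (hy.1 i) (hw0 i).le)]
    exact (mul_eq_zero.1 h2).resolve_left (hw0 i).ne'
  have h4 : y i = w i := by rwa [div_eq_one_iff_eq (hw0 i).ne'] at h3
  rw [h4]
  exact ⟨hw0 i, div_le_self (mul_pos (hx0 i) (Real.exp_pos _)).le hZ1⟩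

/-- Raising a dual coordinate from `ln d` by a quarter of `ln d` does not lift `x` above `d ^
(-3/4)`: as `5 / 4 ≤ exp (1 / 4)`, one has `x ^ (1 / ln d) ≤ exp (-3 / 4)`. -/
theorem le_rpow_of_mirrorDeriv_le {d : ℕ} (hd : 2 < d) {x : ℝ} (hx : 0 ≤ x)
    (h : mirrorDeriv d x ≤ 5 / 4 * Real.log d) : x ≤ (d : ℝ) ^ (-(3 / 4) : ℝ) := by
  have hl := one_lt_log hd
  have hd' : (0 : ℝ) < d := by positivity
  rw [mirrorDeriv_of_lt hd] at h
  have h1 : x ^ (1 / Real.log d) ≤ Real.exp (-(3 / 4)) := by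
    have h2 : Real.exp 1 * x ^ (1 / Real.log d) ≤ 5 / 4 := by
      have : Real.log d * (Real.exp 1 * x ^ (1 / Real.log d)) ≤ Real.log d * (5 / 4) := by
        linarith
      exact le_of_mul_le_mul_left this (by linarith)
    have h3 : (5 / 4 : ℝ) ≤ Real.exp (1 / 4) := by
      have := Real.add_one_le_exp (1 / 4 : ℝ)
      linarith
    have h4 : Real.exp (1 / 4) = Real.exp 1 * Real.exp (-(3 / 4)) := by
      rw [← Real.exp_add]; norm_num
    exact le_of_mul_le_mul_left (by linarith) (Real.exp_pos 1)
  calc x = (x ^ (1 / Real.log d)) ^ Real.log d := by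
        rw [← Real.rpow_mul hx, one_div_mul_cancel (by linarith), Real.rpow_one]
    _ ≤ Real.exp (-(3 / 4)) ^ Real.log d :=
        Real.rpow_le_rpow (Real.rpow_nonneg hx _) h1 (by linarith)
    _ = (d : ℝ) ^ (-(3 / 4) : ℝ) := by
        rw [Real.rpow_def_of_pos hd', ← Real.exp_mul, mul_comm]

/-- Tangent line at `1 / d` of a concave function, by Bernoulli. Summed over the coordinates, it
converts a bound on dual coordinates into one on `∑ x`. -/
theorem mirrorDeriv_le {d : ℕ} (hd : 2 < d) {x : ℝ} (hx : 0 ≤ x) :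
    mirrorDeriv d x ≤ Real.log d + (d * x - 1) := by
  have hl := one_lt_log hd
  have hd' : (0 : ℝ) < d := by positivity
  have hb := rpow_one_add_le_one_add_mul_self (s := d * x - 1) (by nlinarith) (p := 1 / Real.log d)
    (by positivity) (by rw [div_le_one (by linarith)]; exact hl.le)
  rw [add_sub_cancel] at hb
  have e : mirrorDeriv d x = Real.log d * (d * x) ^ (1 / Real.log d) := by
    have h1 : x = 1 / d * (d * x) := by field_simp
    rw [mirrorDeriv_of_lt hd]
    conv_lhs => rw [h1]
    rw [Real.mul_rpow (by positivity) (by positivity), inv_rpow_inv_log hd]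
    have : Real.exp 1 * Real.exp (-1) = 1 := by rw [← Real.exp_add]; simp
    linear_combination (Real.log d * (d * x) ^ (1 / Real.log d)) * this
  rw [e]
  calc _ ≤ Real.log d * (1 + 1 / Real.log d * (d * x - 1)) := by gcongr
    _ = _ := by field_simp

/-! ### From step-size bounds to lower bounds on regret -/

namespace OCOInstance

variable {d : ℕ} {I : OCOInstance d} {c : ℕ → Fin d → ℝ} {e : Fin d → ℝ}

theorem run_first_order (hI : IsLinearWith I c e) (κ : ℝ) {ι : Type} [Fintype ι]
    (𝒢 : ι → Geometry d) (b : ι) (ω : I.Ω) (hd : Differentiable ℝ (𝒢 b).mirror) (t : ℕ)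
    {z : Fin d → ℝ} (hz : z ∈ I.K) :
    0 ≤ ∑ i, (-(I.stepSize κ 𝒢 b * I.scale (𝒢 b) * c t i) +
      grad (𝒢 b).mirror (I.run κ 𝒢 b ω (t + 1)) i - grad (𝒢 b).mirror (I.run κ 𝒢 b ω t) i) *
        ((I.scale (𝒢 b))⁻¹ * z i - I.run κ 𝒢 b ω (t + 1) i) := by
  have h := omdIter_first_order (I.isCompact_scaledK (𝒢 b)) (I.convex_scaledK (𝒢 b)) hd
    (I.stepSize κ 𝒢 b) (I.scaledLoss (𝒢 b) ω) (I.scaledStart_mem _) t (I.mem_scaledK hz)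
  rw [grad_scaledLoss hI] at h
  refine h.trans_eq (Finset.sum_congr rfl fun i _ => ?_)
  simp only [run, Pi.smul_apply, smul_eq_mul]
  ring

theorem le_gradBound_of_le_dualNorm (hI : IsLinearWith I c e) {ι : Type} [Fintype ι] [Nonempty ι]
    (𝒢 : ι → Geometry d) (hT : 0 < I.T) {g : ℝ} (hg : 0 ≤ g)
    (h : ∀ b, g ≤ (𝒢 b).dualNorm (fun i => -I.scale (𝒢 b) * c 0 i)) : g ≤ I.gradBound 𝒢 := by
  have hcard : (0 : ℝ) < Fintype.card ι := by exact_mod_cast Fintype.card_pos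
  refine le_trans (Real.le_sqrt_of_sq_le ?_) (le_gradBound hI 𝒢 hT)
  rw [le_inv_mul_iff₀ hcard]
  calc (Fintype.card ι : ℝ) * g ^ 2 = ∑ _b : ι, g ^ 2 := by simp
    _ ≤ _ := Finset.sum_le_sum fun b _ => pow_le_pow_left₀ hg (h b) 2

/-- A lower bound on the expected regret from an upper bound `H` on the step sizes. -/
theorem le_expRegret_of_stepSize_le (hI : IsLinearWith I c e) (κ : ℝ) {ι : Type} [Fintype ι]
    [Nonempty ι] (𝒢 : ι → Geometry d)
    (hc : ∀ b, ContinuousOn (𝒢 b).mirror (I.scaledK (𝒢 b))) {H θ : ℝ} (hH : 0 < H) (hθ : 0 ≤ θ)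
    (hstep : ∀ b, I.stepSize κ 𝒢 b ≤ H)
    (h : ∀ b ω, ∀ t : ℕ, I.stepSize κ 𝒢 b * t ≤ θ →
      I.scale (𝒢 b) * ∑ i, c t i * I.run κ 𝒢 b ω t i ≤ 1 / 2) :
    min (I.T : ℝ) (θ / H) / 2 ≤ I.expRegret κ 𝒢 := by
  refine le_expRegret hI κ 𝒢 hc (by positivity) fun b ω t ht => h b ω t ?_
  calc I.stepSize κ 𝒢 b * t ≤ H * (θ / H) :=
        mul_le_mul (hstep b) ht (Nat.cast_nonneg t) hH.le
    _ = θ := mul_div_cancel₀ _ hH.ne'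

/-- The arithmetic that turns `min T (a √P √T) / 2` into a multiple of `√P √T`. -/
theorem min_mul_sqrt_le {T P a l : ℝ} (hT : 0 ≤ T) (hPT : P ≤ T)
    (hl : a * (Real.sqrt P * Real.sqrt T) ≤ l) :
    min 1 a / 2 * (Real.sqrt P * Real.sqrt T) ≤ min T l / 2 := by
  have h0 : 0 ≤ Real.sqrt P * Real.sqrt T := by positivity
  have h1 : Real.sqrt P * Real.sqrt T ≤ T := by
    calc Real.sqrt P * Real.sqrt T ≤ Real.sqrt T * Real.sqrt T := by gcongr
      _ = T := Real.mul_self_sqrt hT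
  have h2 : min 1 a * (Real.sqrt P * Real.sqrt T) ≤ T :=
    (mul_le_mul_of_nonneg_right (min_le_left _ _) h0).trans (by linarith)
  have h3 : min 1 a * (Real.sqrt P * Real.sqrt T) ≤ l :=
    (mul_le_mul_of_nonneg_right (min_le_right _ _) h0).trans hl
  have := le_min h2 h3
  linarith

/-- The first loss vector has Euclidean norm `√S` and the diameter is at most `1`, so `η ≤ κ / √(S
T)`, and `η t` stays below `1 / 4` for `√(S T) / (4 κ)` rounds. `hrun` isolates what depends on the
body. -/
theorem le_eucRegret (hI : IsLinearWith I c e) {κ : ℝ} (hκ : 0 < κ) {S : ℕ} (hS : 1 ≤ S)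
    (hST : S ≤ I.T) (hc01 : ∀ i, c 0 i = 0 ∨ c 0 i = 1) (hcs : ∑ i, c 0 i = S)
    (hK0 : ∀ x ∈ I.K, ∀ i, 0 ≤ x i)
    (hK1 : ∀ (β : EqualPartition d 1), ∀ x ∈ I.K, (blockGeometry β).norm x ≤ 1)
    (hrun : ∀ (β : EqualPartition d 1) (ω : I.Ω) (t : ℕ),
      I.stepSize κ (fun β : EqualPartition d 1 => blockGeometry β) β * t ≤ 1 / 4 →
      ∑ i, c t i * I.run κ (fun β : EqualPartition d 1 => blockGeometry β) β ω t i ≤ 1 / 2) :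
    min 1 (1 / (4 * κ)) / 2 * (Real.sqrt S * Real.sqrt I.T) ≤ I.eucRegret κ := by
  have : Nonempty (EqualPartition d 1) := nonempty_equalPartition (one_dvd d)
  set 𝒢 : EqualPartition d 1 → Geometry d := fun β => blockGeometry β with h𝒢
  have hscale : ∀ β, I.scale (𝒢 β) = 1 := fun β => I.scale_eq_one (hK1 β)
  have hsK : ∀ β, I.scaledK (𝒢 β) = I.K := fun β => by simp [scaledK, hscale]
  have hsS : ∀ β, I.scaledStart (𝒢 β) = I.start := fun β => by simp [scaledStart, hscale]
  have hT : 0 < I.T := lt_of_lt_of_le hS hST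
  have hS' : (0 : ℝ) < S := by exact_mod_cast hS
  have hT' : (0 : ℝ) < I.T := by exact_mod_cast hT
  have hdual : ∀ β, Real.sqrt S ≤ (𝒢 β).dualNorm (fun i => -I.scale (𝒢 β) * c 0 i) := by
    intro β
    refine le_trans (le_of_eq ?_) (le_ciSup (f := fun j =>
      blockL2 β (fun i => -I.scale (𝒢 β) * c 0 i) j) (Set.finite_range _).bddAbove 0)
    simp only [blockL2, hscale, Subsingleton.elim _ (0 : Fin 1), Finset.filter_true]
    congr 1
    rw [← hcs]
    exact Finset.sum_congr rfl fun i _ => by rcases hc01 i with h | h <;> simp [h]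
  have hG := le_gradBound_of_le_dualNorm hI 𝒢 hT (Real.sqrt_nonneg S) hdual
  have hstep : ∀ β, I.stepSize κ 𝒢 β ≤ κ / (Real.sqrt S * Real.sqrt I.T) := by
    intro β
    have := stepSize_le (I := I) hκ.le 𝒢 β (Real.sqrt_pos.2 hS') hG zero_le_one fun z hz => by
      rw [hsK] at hz
      rw [hsS]
      refine (bregman_blockMirror_le one_pos β (hK0 z hz) (hK0 _ I.start_mem) (hK1 β z hz)
        (hK1 β _ I.start_mem)).trans (le_of_eq ?_)
      simp [gam]
    rwa [Real.sqrt_one, mul_one] at this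
  refine le_trans (min_mul_sqrt_le (l := 1 / 4 / (κ / (Real.sqrt S * Real.sqrt I.T)))
    hT'.le (by exact_mod_cast hST) (le_of_eq ?_))
    (le_expRegret_of_stepSize_le hI κ 𝒢
      (fun β => (differentiable_blockMirror β).continuous.continuousOn) (H := κ / (Real.sqrt S * Real.sqrt I.T)) (by positivity)
      (by norm_num) hstep fun β ω t ht => ?_)
  · field_simp
  · rw [hscale, one_mul]
    exact hrun β ω t ht

end OCOInstance

theorem blockNorm_le_one_of_mem_simplex {d n : ℕ} (β : EqualPartition d n) {x : Fin d → ℝ}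
    (hx : x ∈ stdSimplex ℝ (Fin d)) : (blockGeometry β).norm x ≤ 1 := by
  refine (blockNorm_le_sum_abs β x).trans (le_of_eq ?_)
  rw [← hx.2]
  exact Finset.sum_congr rfl fun i _ => abs_of_nonneg (hx.1 i)

theorem entNorm_le_one_of_mem_simplex {d : ℕ} {x : Fin d → ℝ}
    (hx : x ∈ stdSimplex ℝ (Fin d)) : (entGeometry d).norm x ≤ 1 :=
  le_of_eq ((Finset.sum_congr rfl fun i _ => abs_of_nonneg (hx.1 i)).trans hx.2)

theorem uniform_mem_simplex {d : ℕ} (hd : 0 < d) :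
    (fun _ => 1 / d : Fin d → ℝ) ∈ stdSimplex ℝ (Fin d) := by
  have : (0 : ℝ) < d := by exact_mod_cast hd
  exact ⟨fun _ => by positivity, by simp; field_simp⟩

/-! ### Lower bounds on the simplex -/

namespace OCOInstance

variable {d : ℕ} {I : OCOInstance d} {c : ℕ → Fin d → ℝ} {e : Fin d → ℝ}

theorem simplex_block_run_le (hI : IsLinearWith I c e) (hc0 : ∀ t i, 0 ≤ c t i)
    (hK : I.K = stdSimplex ℝ (Fin d)) {κ : ℝ} (hκ : 0 ≤ κ) {n : ℕ} (hn : 0 < n)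
    (β : EqualPartition d n) (hgrad : ∀ x i, 0 ≤ x i →
      grad (blockGeometry β).mirror x i = mirrorDeriv n (x i)) (ω : I.Ω) (t : ℕ) (i : Fin d) :
    mirrorDeriv n (I.run κ (fun β : EqualPartition d n => blockGeometry β) β ω t i) ≤
      mirrorDeriv n (I.start i) + I.stepSize κ (fun β : EqualPartition d n => blockGeometry β) β *
        ∑ s ∈ Finset.range t, c s i := by
  set 𝒢 : EqualPartition d n → Geometry d := fun β => blockGeometry β with h𝒢
  have hscale : I.scale (𝒢 β) = 1 := I.scale_eq_one fun x hx =>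
    blockNorm_le_one_of_mem_simplex β (by rwa [hK] at hx)
  have hsK : I.scaledK (𝒢 β) = stdSimplex ℝ (Fin d) := by simp [scaledK, hscale, hK]
  have hη := stepSize_nonneg (I := I) κ hκ 𝒢 β
  have hmem : ∀ t, I.run κ 𝒢 β ω t ∈ stdSimplex ℝ (Fin d) := fun t => by
    rw [← hsK]
    exact I.run_mem κ 𝒢 β ω (differentiable_blockMirror β).continuous.continuousOn t
  induction t with
  | zero =>
    have : I.run κ 𝒢 β ω 0 i = I.start i := by
      change I.scaledStart (𝒢 β) i = _
      simp [scaledStart, hscale]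
    rw [this]
    simp
  | succ t ih =>
    have h := simplex_step_le (mirrorDeriv_strictMonoOn hn).monotoneOn
      (a := fun i => I.stepSize κ 𝒢 β * c t i) (fun i => mul_nonneg hη (hc0 t i))
      (hmem t) (hmem (t + 1)) (fun z hz => by
        have h1 := run_first_order hI κ 𝒢 β ω (differentiable_blockMirror β) t
          (z := z) (by rwa [hK])
        refine h1.trans_eq (Finset.sum_congr rfl fun i _ => ?_)
        rw [hgrad _ _ ((hmem t).1 i), hgrad _ _ ((hmem (t + 1)).1 i), hscale]
        simp) i
    rw [Finset.sum_range_succ, mul_add]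
    linarith

/-- The induction also carries positivity of all coordinates, which the closed form of the entropic
step requires. -/
theorem simplex_ent_run_le (hI : IsLinearWith I c e) (hc0 : ∀ t i, 0 ≤ c t i)
    (hc1 : ∀ t i, c t i ≤ 1) (hd : 0 < d)
    (hK : I.K = stdSimplex ℝ (Fin d)) (hstart : I.start = fun _ => 1 / (d : ℝ)) {κ : ℝ}
    (hκ : 0 ≤ κ) (ω : I.Ω) (t : ℕ) (i : Fin d) :
    I.run κ (fun _ : Unit => entGeometry d) () ω t i ≤ 1 / d *
      Real.exp (I.stepSize κ (fun _ : Unit => entGeometry d) () * t) := by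
  set 𝒢 : Unit → Geometry d := fun _ => entGeometry d with h𝒢
  have hd' : (0 : ℝ) < d := by exact_mod_cast hd
  have hscale : I.scale (𝒢 ()) = 1 := I.scale_eq_one fun x hx => by
    rw [hK] at hx
    exact entNorm_le_one_of_mem_simplex hx
  have hsK : I.scaledK (𝒢 ()) = stdSimplex ℝ (Fin d) := by simp [scaledK, hscale, hK]
  have hη := stepSize_nonneg (I := I) κ hκ 𝒢 ()
  have hcont := (continuous_entMirror d).continuousOn (s := stdSimplex ℝ (Fin d))
  have hmem : ∀ t, I.run κ 𝒢 () ω t ∈ stdSimplex ℝ (Fin d) := fun t => by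
    rw [← hsK]
    exact I.run_mem κ 𝒢 () ω (by rw [hsK]; exact hcont) t
  have key : ∀ t, ∀ i, 0 < I.run κ 𝒢 () ω t i ∧
      I.run κ 𝒢 () ω t i ≤ 1 / d * Real.exp (I.stepSize κ 𝒢 () * t) := by
    intro t
    induction t with
    | zero =>
      intro i
      have : I.run κ 𝒢 () ω 0 i = 1 / d := by
        change I.scaledStart (𝒢 ()) i = _
        simp [scaledStart, hscale, hstart]
      rw [this]
      simp [hd]
    | succ t ih =>
      intro i
      have hs := omdStep_spec (I.isCompact_scaledK (𝒢 ())) ⟨_, I.scaledStart_mem (𝒢 ())⟩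
        (h := (𝒢 ()).mirror) (by rw [hsK]; exact hcont) (I.stepSize κ 𝒢 ())
        (grad (I.scaledLoss (𝒢 ()) ω t) (I.run κ 𝒢 () ω t)) (I.run κ 𝒢 () ω t)
      have h := entropic_step_le (η := I.stepSize κ 𝒢 ())
        (g := grad (I.scaledLoss (𝒢 ()) ω t) (I.run κ 𝒢 () ω t))
        (a := fun i => I.stepSize κ 𝒢 () * c t i) (hmem t)
        (fun i => (ih i).1) (fun i => by rw [grad_scaledLoss hI, hscale]; ring)
        (fun i => mul_nonneg hη (hc0 t i)) (hmem (t + 1))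
        (by rw [← hsK]; exact hs.2) i
      refine ⟨h.1, h.2.trans ?_⟩
      calc _ ≤ 1 / d * Real.exp (I.stepSize κ 𝒢 () * t) * Real.exp (I.stepSize κ 𝒢 () * 1) := by
            gcongr
            · exact (ih i).2
            · exact hc1 t i
        _ = _ := by
            rw [mul_assoc, ← Real.exp_add]
            push_cast
            ring_nf
  exact (key t i).2

/-- A gain of at most `1 / 2` when all coordinates are at most `d ^ (-3/4)`. -/
theorem sum_mul_le_half {c x : Fin d → ℝ} {S : ℕ} (hc0 : ∀ i, 0 ≤ c i) (hcs : ∑ i, c i = S)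
    (hx : ∀ i, x i ≤ (d : ℝ) ^ (-(3 / 4) : ℝ))
    (hS : (S : ℝ) * (d : ℝ) ^ (-(3 / 4) : ℝ) ≤ 1 / 2) : ∑ i, c i * x i ≤ 1 / 2 :=
  calc _ ≤ ∑ i, c i * (d : ℝ) ^ (-(3 / 4) : ℝ) :=
        Finset.sum_le_sum fun i _ => mul_le_mul_of_nonneg_left (hx i) (hc0 i)
    _ ≤ 1 / 2 := by rw [← Finset.sum_mul, hcs]; exact hS

theorem div_log_step_ge {κ L s : ℝ} (hκ : 0 < κ) (hL : 0 < L) (hs : 0 < s) :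
    1 / (8 * κ) * (Real.sqrt L * s) ≤ L / 4 / (κ * (2 * Real.sqrt L) / s) := by
  have h1 := Real.sq_sqrt hL.le
  have h2 := Real.sqrt_pos.2 hL
  refine le_of_eq ?_
  rw [← h1, Real.sqrt_sq h2.le]
  field_simp
  norm_num

theorem sqrt_exp_mul_le {L : ℝ} (hL : 0 ≤ L) :
    Real.sqrt (Real.exp 1 * L) ≤ 2 * Real.sqrt L := by
  rw [Real.sqrt_le_left (by positivity), mul_pow, Real.sq_sqrt hL]
  have := Real.exp_one_lt_d9
  nlinarith

theorem le_entRegret (hI : IsLinearWith I c e) (hc0 : ∀ t i, 0 ≤ c t i)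
    (hc1 : ∀ t i, c t i ≤ 1) (hd : 2 < d) (hK : I.K = stdSimplex ℝ (Fin d))
    (hstart : I.start = fun _ => 1 / (d : ℝ)) {κ : ℝ} (hκ : 0 < κ) {S : ℕ}
    (hcs : ∀ t, ∑ i, c t i = S) (hS : (S : ℝ) * (d : ℝ) ^ (-(3 / 4) : ℝ) ≤ 1 / 2)
    {i₀ : Fin d} (hi₀ : c 0 i₀ = 1) (hT : Real.log d ≤ I.T) :
    min 1 (1 / (8 * κ)) / 2 * (Real.sqrt (Real.log d) * Real.sqrt I.T) ≤ I.entRegret κ := by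
  set 𝒢 : Unit → Geometry d := fun _ => entGeometry d with h𝒢
  have hl := one_lt_log hd
  have hd' : (0 : ℝ) < d := by positivity
  have hscale : I.scale (𝒢 ()) = 1 := I.scale_eq_one fun x hx => by
    rw [hK] at hx
    exact entNorm_le_one_of_mem_simplex hx
  have hsK : I.scaledK (𝒢 ()) = stdSimplex ℝ (Fin d) := by simp [scaledK, hscale, hK]
  have hsS : I.scaledStart (𝒢 ()) = fun _ => 1 / (d : ℝ) := by
    simp [scaledStart, hscale, hstart]
  have hT' : (0 : ℝ) < I.T := by linarith
  have hG := le_gradBound_of_le_dualNorm hI 𝒢 (by exact_mod_cast hT') zero_le_one fun b => by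
    refine le_trans (le_of_eq ?_) (le_ciSup (f := fun i => |-I.scale (𝒢 b) * c 0 i|)
      (Set.finite_range _).bddAbove i₀)
    rw [hi₀, hscale]
    simp
  -- The slack factor `2` gives the same bound as for `h_d`, so `div_log_step_ge` serves both
  -- geometries.
  have hstep : ∀ b, I.stepSize κ 𝒢 b ≤
      κ * (2 * Real.sqrt (Real.log d)) / Real.sqrt I.T := by
    intro b
    have := stepSize_le (I := I) hκ.le 𝒢 b one_pos hG (D := Real.log d) (by linarith) fun z hz => by
      rw [hsS]
      exact bregman_entMirror_uniform_le (by omega) (by rwa [← hsK])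
    rw [one_mul] at this
    refine this.trans ?_
    have h0 := Real.sqrt_nonneg (Real.log d)
    gcongr
    linarith
  have hs0 := Real.sqrt_pos.2 hT'
  have hL0 := Real.sqrt_pos.2 (by linarith : 0 < Real.log d)
  refine le_trans (min_mul_sqrt_le hT'.le hT (div_log_step_ge hκ (by linarith) hs0))
    (le_expRegret_of_stepSize_le hI κ 𝒢
      (fun _ => (continuous_entMirror d).continuousOn) (by positivity)
      (by positivity) hstep fun b ω t ht => ?_)
  rw [hscale, one_mul]
  refine sum_mul_le_half (hc0 t) (hcs t) (fun i => ?_) hS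
  refine (simplex_ent_run_le hI hc0 hc1 (by omega) hK hstart hκ.le ω t i).trans ?_
  calc 1 / d * Real.exp (I.stepSize κ 𝒢 () * t) ≤ 1 / d * Real.exp (Real.log d / 4) := by
        gcongr
    _ = (d : ℝ) ^ (-(3 / 4) : ℝ) := by
        rw [one_div, ← Real.exp_log hd', ← Real.exp_neg, Real.log_exp, ← Real.exp_add,
          ← Real.exp_mul]
        congr 1
        ring

theorem le_simplex_blockRegret (hI : IsLinearWith I c e) (hc0 : ∀ t i, 0 ≤ c t i)
    (hc1 : ∀ t i, c t i ≤ 1) (hd : 2 < d) (hK : I.K = stdSimplex ℝ (Fin d))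
    (hstart : I.start = fun _ => 1 / (d : ℝ)) {κ : ℝ} (hκ : 0 < κ) {S : ℕ}
    (hcs : ∀ t, ∑ i, c t i = S) (hS : (S : ℝ) * (d : ℝ) ^ (-(3 / 4) : ℝ) ≤ 1 / 2)
    {i₀ : Fin d} (hi₀ : c 0 i₀ = 1) (hT : Real.log d ≤ I.T) :
    min 1 (1 / (8 * κ)) / 2 * (Real.sqrt (Real.log d) * Real.sqrt I.T) ≤ I.blockRegret κ d := by
  have : Nonempty (EqualPartition d d) := nonempty_equalPartition dvd_rfl
  set 𝒢 : EqualPartition d d → Geometry d := fun β => blockGeometry β with h𝒢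
  have hl := one_lt_log hd
  have hd' : (0 : ℝ) < d := by positivity
  have hK1 : ∀ β : EqualPartition d d, ∀ x ∈ I.K, (blockGeometry β).norm x ≤ 1 :=
    fun β x hx => blockNorm_le_one_of_mem_simplex β (by rwa [hK] at hx)
  have hK0 : ∀ x ∈ I.K, ∀ i, 0 ≤ x i := fun x hx i => by
    rw [hK] at hx
    exact hx.1 i
  have hscale : ∀ β, I.scale (𝒢 β) = 1 := fun β => I.scale_eq_one (hK1 β)
  have hsK : ∀ β, I.scaledK (𝒢 β) = I.K := fun β => by simp [scaledK, hscale]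
  have hsS : ∀ β, I.scaledStart (𝒢 β) = I.start := fun β => by simp [scaledStart, hscale]
  have hT' : (0 : ℝ) < I.T := by linarith
  have hG := le_gradBound_of_le_dualNorm hI 𝒢 (by exact_mod_cast hT') zero_le_one fun β => by
    rw [hscale]
    rw [dualNorm_mul β (-1) (c 0)]
    simpa using one_le_dualNorm β hi₀
  have hgam : 1 / gam d = Real.exp 1 * Real.log d := by
    rw [gam, if_neg (by omega), if_neg (by omega), one_div_one_div]
  have hstep : ∀ β, I.stepSize κ 𝒢 β ≤
      κ * (2 * Real.sqrt (Real.log d)) / Real.sqrt I.T := by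
    intro β
    have := stepSize_le (I := I) hκ.le 𝒢 β one_pos hG (D := Real.exp 1 * Real.log d)
      (by positivity) fun z hz => by
        rw [hsK] at hz
        rw [hsS, ← hgam]
        exact bregman_blockMirror_le (by omega) β (hK0 z hz) (hK0 _ I.start_mem) (hK1 β z hz)
          (hK1 β _ I.start_mem)
    rw [one_mul] at this
    refine this.trans ?_
    gcongr
    exact sqrt_exp_mul_le (by linarith)
  have hs0 := Real.sqrt_pos.2 hT'
  have hL0 := Real.sqrt_pos.2 (by linarith : 0 < Real.log d)
  refine le_trans (min_mul_sqrt_le hT'.le hT (div_log_step_ge hκ (by linarith) hs0))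
    (le_expRegret_of_stepSize_le hI κ 𝒢
      (fun β => (differentiable_blockMirror β).continuous.continuousOn) (by positivity)
      (by positivity) hstep fun β ω t ht => ?_)
  rw [hscale, one_mul]
  refine sum_mul_le_half (hc0 t) (hcs t) (fun i => ?_) hS
  have hmem : I.run κ 𝒢 β ω t ∈ I.K := by
    rw [← hsK β]
    exact I.run_mem κ 𝒢 β ω (differentiable_blockMirror β).continuous.continuousOn t
  refine le_rpow_of_mirrorDeriv_le hd (hK0 _ hmem i) ?_
  refine (simplex_block_run_le hI hc0 hK hκ.le (by omega) β
    (fun x i hx => grad_blockMirror_self β x i hx) ω t i).trans ?_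
  have h1 : ∑ s ∈ Finset.range t, c s i ≤ t := by
    calc _ ≤ ∑ s ∈ Finset.range t, (1 : ℝ) := Finset.sum_le_sum fun s _ => hc1 s i
      _ = t := by simp
  have h2 := mul_le_mul_of_nonneg_left h1 (stepSize_nonneg (I := I) κ hκ.le 𝒢 β)
  rw [hstart, mirrorDeriv_inv hd]
  linarith

end OCOInstance

/-! ### The family of instances on the simplex -/

theorem isLinearWith_sparseVec {d S : ℕ} {I : OCOInstance d} (hd : 0 < d) (hS : 1 ≤ S)
    (hloss : ∀ t ω x, I.loss t ω x = -∑ i, sparseVec d S t i * x i)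
    (hmem : Pi.single ⟨0, hd⟩ 1 ∈ I.K)
    (hle : ∀ t, ∀ x ∈ I.K, ∑ i, sparseVec d S t i * x i ≤ 1) :
    IsLinearWith I (sparseVec d S) (Pi.single ⟨0, hd⟩ 1) where
  loss_eq := hloss
  mem := hmem
  opt := fun t => by simp [Pi.single_apply, sparseVec_zero hS]
  le_one := hle

theorem sparseLinear_of_sparseVec {d S : ℕ} {I : OCOInstance d} (hSd : S ≤ d)
    (hloss : ∀ t ω x, I.loss t ω x = -∑ i, sparseVec d S t i * x i) : I.SparseLinear S := by
  intro t ω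
  refine ⟨sparseVec d S t, sparseVec_zero_or_one d S t, ?_, hloss t ω⟩
  rcases Nat.eq_zero_or_pos S with h | h
  · subst h
    simp [sparseVec]
  · exact (sum_sparseVec h hSd t).le

theorem sum_mul_le_one_of_mem_simplex {d : ℕ} {c x : Fin d → ℝ} (hc : ∀ i, c i ≤ 1)
    (hx : x ∈ stdSimplex ℝ (Fin d)) : ∑ i, c i * x i ≤ 1 := by
  rw [← hx.2]
  exact Finset.sum_le_sum fun i _ => mul_le_of_le_one_left (hx.1 i) (hc i)

/-- The instance on the simplex with the uniform starting point and `⌊ln d⌋`-sparse losses. -/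
noncomputable def simplexInstance (d T : ℕ) : OCOInstance d :=
  if h : 0 < d then
    linearInstance (stdSimplex ℝ (Fin d)) (convex_stdSimplex ℝ _) (isCompact_stdSimplex ℝ _)
      (fun _ => 1 / d) (uniform_mem_simplex h) T (sparseVec d ⌊Real.log d⌋₊)
  else linearInstance {0} (convex_singleton 0) isCompact_singleton 0 rfl T 0

theorem simplexInstance_spec {d : ℕ} (hd : 0 < d) (T : ℕ) :
    (simplexInstance d T).K = stdSimplex ℝ (Fin d) ∧ (simplexInstance d T).T = T ∧
      (simplexInstance d T).start = (fun _ => 1 / (d : ℝ)) ∧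
      ∀ t ω x, (simplexInstance d T).loss t ω x =
        -∑ i, sparseVec d ⌊Real.log d⌋₊ t i * x i := by
  rw [simplexInstance, dif_pos hd]
  exact ⟨rfl, rfl, rfl, fun _ _ _ => rfl⟩

theorem floor_log_le (d : ℕ) : ⌊Real.log d⌋₊ ≤ d := by
  rw [← Nat.floor_natCast (R := ℝ) d]
  refine Nat.floor_le_floor ?_
  simpa using Real.log_le_self (Nat.cast_nonneg d)

/-- `ln d ≥ 8` forces `n > 2` and makes `ln ln d > 1`; the bound by `d ^ (1/4)` makes `S d ^ (-3/4)`
small and `4 S² ≤ d`. -/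
theorem exists_simplex_threshold : ∃ d₀ : ℕ, ∀ d : ℕ, d₀ ≤ d →
    2 < d ∧ 8 ≤ Real.log d ∧ Real.log d ≤ 1 / 4 * (d : ℝ) ^ (1 / 4 : ℝ) := by
  have h1 := ((isLittleO_log_rpow_atTop (r := 1 / 4) (by norm_num)).bound
    (c := 1 / 4) (by norm_num))
  have h2 := tendsto_natCast_atTop_atTop (R := ℝ).eventually h1
  have h3 := (Real.tendsto_log_atTop.comp tendsto_natCast_atTop_atTop).eventually_ge_atTop 8
  obtain ⟨d₀, hd₀⟩ := Filter.eventually_atTop.1 (h2.and (h3.and (Filter.eventually_gt_atTop 2)))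
  refine ⟨d₀, fun d hd => ?_⟩
  obtain ⟨ha, hb, hc⟩ := hd₀ d hd
  refine ⟨hc, hb, ?_⟩
  rw [Real.norm_eq_abs, Real.norm_eq_abs, abs_of_nonneg (Real.rpow_nonneg (Nat.cast_nonneg d) _)]
    at ha
  exact (le_abs_self _).trans ha

theorem simplex_improvement : ∃ I : (d T : ℕ) → OCOInstance d,
    (∀ d T : ℕ, 1 ≤ d →
      (I d T).K = stdSimplex ℝ (Fin d) ∧ (I d T).T = T ∧ (I d T).SparseLinear ⌊Real.log d⌋₊) ∧
    ∀ κ₁ κ₂ κ₃ : ℝ, 0 < κ₁ → 0 < κ₂ → 0 < κ₃ →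
      ∃ c : ℝ, 0 < c ∧ ∃ d₀ : ℕ, ∀ d n T : ℕ, d₀ ≤ d → n ∣ d →
        Real.log d / 2 ≤ n → (n : ℝ) ≤ 2 * Real.log d → Real.log d ≤ T →
        0 < (I d T).blockRegret κ₃ n ∧
        c * (Real.sqrt (Real.log d) / Real.log (Real.log d)) * (I d T).blockRegret κ₃ n ≤
          min ((I d T).eucRegret κ₁)
            (min ((I d T).entRegret κ₂) ((I d T).blockRegret κ₂ d)) := by
  refine ⟨simplexInstance, fun d T hd => ?_, fun κ₁ κ₂ κ₃ h1 h2 h3 => ?_⟩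
  · obtain ⟨hK, hT, -, hl⟩ := simplexInstance_spec hd T
    exact ⟨hK, hT, sparseLinear_of_sparseVec (floor_log_le d) hl⟩
  obtain ⟨d₀, hd₀⟩ := exists_simplex_threshold
  set A := min 1 (1 / (4 * κ₁)) / 2 with hA
  set B := min 1 (1 / (8 * κ₂)) / 2 with hB
  have hA0 : 0 < A := by positivity
  have hB0 : 0 < B := by positivity
  -- The half pays for `√⌊ln d⌋ ≥ √(ln d) / 2`; the `10` in the witness below is `5 · 2`, from `ln n
  -- ≤ 2 ln ln d`.
  set c₀ := min (A / 2) B with hc₀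
  have hc₀0 : 0 < c₀ := by positivity
  refine ⟨c₀ / (10 * (1 / κ₃ + κ₃)), by positivity, d₀, fun d n T hd hnd hn1 hn2 hT => ?_⟩
  obtain ⟨hd2, hL8, hLd⟩ := hd₀ d hd
  have hd0 : 0 < d := by omega
  have hd' : (0 : ℝ) < d := by exact_mod_cast hd0
  obtain ⟨hK, hTI, hstart, hloss⟩ := simplexInstance_spec hd0 T
  set I := simplexInstance d T with hI'
  set S := ⌊Real.log d⌋₊ with hSdef
  set L := Real.log d with hL
  have hSL : (S : ℝ) ≤ L := Nat.floor_le (by linarith)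
  have hLS : L < S + 1 := Nat.lt_floor_add_one L
  have hS1 : 1 ≤ S := Nat.le_floor (by push_cast; linarith)
  have hSd : S ≤ d := floor_log_le d
  set y := (d : ℝ) ^ (1 / 4 : ℝ) with hy
  have hy0 : 0 < y := Real.rpow_pos_of_pos hd' _
  have hy4 : y ^ 4 = d := by
    rw [hy, ← Real.rpow_natCast, ← Real.rpow_mul hd'.le]
    norm_num
  have hy3 : (d : ℝ) ^ (-(3 / 4) : ℝ) = (y ^ 3)⁻¹ := by
    rw [hy, ← Real.rpow_natCast, ← Real.rpow_mul hd'.le, ← Real.rpow_neg hd'.le]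
    norm_num
  have hy32 : 32 ≤ y := by linarith
  have hI : IsLinearWith I (sparseVec d S) (Pi.single ⟨0, hd0⟩ 1) :=
    isLinearWith_sparseVec hd0 hS1 hloss (by rw [hK]; exact single_mem_stdSimplex ℝ _)
      fun t x hx => sum_mul_le_one_of_mem_simplex (sparseVec_le_one d S t) (by rwa [← hK])
  have hK0 : ∀ x ∈ I.K, ∀ i, 0 ≤ x i := fun x hx i => by
    rw [hK] at hx
    exact hx.1 i
  have hK1 : ∀ {k : ℕ} (β : EqualPartition d k), ∀ x ∈ I.K, (blockGeometry β).norm x ≤ 1 :=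
    fun β x hx => blockNorm_le_one_of_mem_simplex β (by rwa [hK] at hx)
  have hcs := sum_sparseVec hS1 hSd
  have hIT : (I.T : ℝ) = T := by rw [hTI]
  have hT0 : 0 < I.T := by
    have : (0 : ℝ) < T := by linarith
    rw [hTI]
    exact_mod_cast this
  have hSd34 : (S : ℝ) * (d : ℝ) ^ (-(3 / 4) : ℝ) ≤ 1 / 2 := by
    rw [hy3, ← div_eq_mul_inv, div_le_iff₀ (by positivity)]
    have : y ≤ y ^ 3 := le_self_pow₀ (by linarith) (by norm_num)
    linarith
  have hbS : 1 / (d : ℝ) * (1 + S) ≤ 1 / 8 := by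
    rw [one_div_mul_eq_div, div_le_iff₀ hd', ← hy4]
    have h2 : y ^ 2 ≤ y ^ 4 := pow_le_pow_right₀ (by linarith) (by norm_num)
    nlinarith
  have hN : 4 * S ≤ d / S := by
    rw [Nat.le_div_iff_mul_le hS1]
    have h : (4 * S * S : ℝ) ≤ d := by
      rw [← hy4]
      have h1 : (S : ℝ) ≤ 1 / 4 * y := hSL.trans hLd
      have h2 : (S : ℝ) * S ≤ (1 / 4 * y) * (1 / 4 * y) := by gcongr
      have h3 : y ^ 2 ≤ y ^ 4 := pow_le_pow_right₀ (by linarith) (by norm_num)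
      nlinarith
    exact_mod_cast h
  have hstart1 : ∑ i, sparseVec d S 0 i * I.start i < 1 := by
    rw [hstart, ← Finset.sum_mul, hcs]
    have : 0 < 1 / (d : ℝ) := by positivity
    linarith
  have hn3 : 2 < n := by
    have : (2 : ℝ) < n := by linarith
    exact_mod_cast this
  have hneN : Nonempty (EqualPartition d n) := nonempty_equalPartition hnd
  have hup := OCOInstance.blockRegret_le hI h3 hn3 hnd hT0 hstart1 (sparseVec_zero_or_one d S)
    (fun t => by rw [hcs]; linarith) hK0 (fun β => hK1 β)
  have hpos : 0 < I.blockRegret κ₃ n := OCOInstance.expRegret_pos hI κ₃ _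
    (fun β => (differentiable_blockMirror β).continuous.continuousOn) hT0 hstart1
  refine ⟨hpos, ?_⟩
  have heuc : A * (Real.sqrt S * Real.sqrt I.T) ≤ I.eucRegret κ₁ := by
    refine OCOInstance.le_eucRegret hI h1 hS1 ?_ (sparseVec_zero_or_one d S 0) (hcs 0) hK0
      (fun β => hK1 β) fun β ω t ht => ?_
    · have : (S : ℝ) ≤ I.T := by linarith
      exact_mod_cast this
    · refine sum_sparseVec_mul_le hS1 hSd hN (b := 1 / d) (by positivity)
        (OCOInstance.stepSize_nonneg κ₁ h1.le _ β) hbS ht fun i => ?_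
      have := OCOInstance.simplex_block_run_le hI (sparseVec_nonneg d S) hK h1.le one_pos β
        (fun x i _ => grad_blockMirror_one β x i) ω t i
      rwa [mirrorDeriv_one, mirrorDeriv_one, hstart] at this
  have hent := OCOInstance.le_entRegret hI (sparseVec_nonneg d S) (sparseVec_le_one d S) hd2 hK
    hstart h2 hcs hSd34 (sparseVec_zero hS1 0 hd0) (by rw [hIT]; exact hT)
  have hblk := OCOInstance.le_simplex_blockRegret hI (sparseVec_nonneg d S) (sparseVec_le_one d S)
    hd2 hK hstart h2 hcs hSd34 (sparseVec_zero hS1 0 hd0) (by rw [hIT]; exact hT)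
  rw [← hL] at hent hblk
  have hsqS : Real.sqrt L / 2 ≤ Real.sqrt S := by
    refine Real.le_sqrt_of_sq_le ?_
    rw [div_pow, Real.sq_sqrt (by linarith)]
    linarith
  set s := Real.sqrt I.T with hs
  have hs0 : 0 ≤ s := Real.sqrt_nonneg _
  have hL0 : 0 ≤ Real.sqrt L := Real.sqrt_nonneg _
  have hmain : c₀ * (Real.sqrt L * s) ≤
      min (I.eucRegret κ₁) (min (I.entRegret κ₂) (I.blockRegret κ₂ d)) := by
    have hLs : 0 ≤ Real.sqrt L * s := by positivity
    refine le_min ?_ (le_min ?_ ?_)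
    · refine le_trans ?_ heuc
      calc c₀ * (Real.sqrt L * s) ≤ A / 2 * (Real.sqrt L * s) :=
            mul_le_mul_of_nonneg_right (min_le_left _ _) hLs
        _ = A * (Real.sqrt L / 2 * s) := by ring
        _ ≤ _ := by gcongr
    · exact (mul_le_mul_of_nonneg_right (min_le_right _ _) hLs).trans hent
    · exact (mul_le_mul_of_nonneg_right (min_le_right _ _) hLs).trans hblk
  refine le_trans ?_ hmain
  have hll : 1 < Real.log L := by
    rw [Real.lt_log_iff_exp_lt (by linarith)]
    linarith [Real.exp_one_lt_d9]
  have hlogn : Real.log n ≤ 2 * Real.log L := by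
    have h : Real.log n ≤ Real.log (2 * L) := Real.log_le_log (by positivity) hn2
    rw [Real.log_mul (by norm_num) (by linarith)] at h
    have : Real.log 2 ≤ Real.log L := Real.log_le_log (by norm_num) (by linarith)
    linarith
  calc c₀ / (10 * (1 / κ₃ + κ₃)) * (Real.sqrt L / Real.log L) * I.blockRegret κ₃ n
      ≤ c₀ / (10 * (1 / κ₃ + κ₃)) * (Real.sqrt L / Real.log L) *
          (5 * (1 / κ₃ + κ₃) * (2 * Real.log L) * s) := by
        refine mul_le_mul_of_nonneg_left (hup.trans ?_) (by positivity)
        gcongr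
    _ = c₀ * (Real.sqrt L * s) := by
        field_simp
        norm_num

/-! ### Lower bounds on the polytope -/

theorem blockNorm_polytope_le {m d n : ℕ} (hm : 1 ≤ m) (hd : d = m ^ 3) (hn : 0 < n)
    (β : EqualPartition d n) {x : Fin d → ℝ} (hx : x ∈ polytope d) {R : ℝ} (hR : 1 ≤ R)
    (hp : n * Real.sqrt (d / n) * (1 / (m : ℝ) ^ 2) ≤ R) : (blockGeometry β).norm x ≤ R := by
  obtain ⟨α, h0, h1, q, hq, h⟩ := (mem_polytope_iff hm hd).1 hx
  have hx' : x = α • (fun _ => 1 / (m : ℝ) ^ 2) + (1 - α) • q := by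
    ext i
    simp [h, div_eq_mul_inv]
  rw [hx']
  have h2 := blockNorm_comb_le β (fun _ => 1 / (m : ℝ) ^ 2) q h0 (by linarith : 0 ≤ 1 - α)
  rw [blockNorm_const hn β (by positivity)] at h2
  have h3 := mul_le_mul_of_nonneg_left hp h0
  have h4 := mul_le_mul_of_nonneg_left
    ((blockNorm_le_one_of_mem_simplex β hq).trans hR) (by linarith : 0 ≤ 1 - α)
  linarith

/-- The constant vertex has norm `m ^ (-1/2)` for one block, exactly `1` for `m` blocks and `m` for
`d` blocks, so among these three only `h_d` requires genuine rescaling. -/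
theorem one_block_const {m d : ℕ} (hm : 1 ≤ m) (hd : d = m ^ 3) :
    ((1 : ℕ) : ℝ) * Real.sqrt (d / (1 : ℕ)) * (1 / (m : ℝ) ^ 2) ≤ 1 := by
  have hm' : (1 : ℝ) ≤ m := by exact_mod_cast hm
  rw [mul_one_div, div_le_one (by positivity), Nat.cast_one, one_mul, div_one,
    Real.sqrt_le_left (by positivity), hd]
  push_cast
  rw [← pow_mul]
  exact pow_le_pow_right₀ hm' (by norm_num)

theorem cube_root_blocks_const {m d : ℕ} (hm : 1 ≤ m) (hd : d = m ^ 3) :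
    (m : ℝ) * Real.sqrt (d / m) * (1 / (m : ℝ) ^ 2) ≤ 1 := by
  have hm' : (0 : ℝ) < m := by exact_mod_cast hm
  have h : (d : ℝ) / m = (m : ℝ) ^ 2 := by
    rw [hd]; push_cast; field_simp
  rw [h, Real.sqrt_sq hm'.le]
  refine le_of_eq ?_
  field_simp

theorem all_blocks_const {m d : ℕ} (hm : 1 ≤ m) (hd : d = m ^ 3) :
    (d : ℝ) * Real.sqrt (d / d) * (1 / (m : ℝ) ^ 2) = m := by
  have hm' : (0 : ℝ) < m := by exact_mod_cast hm
  have hd' : (d : ℝ) = (m : ℝ) ^ 3 := by rw [hd]; push_cast; ring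
  rw [div_self (by rw [hd']; positivity), Real.sqrt_one, hd']
  field_simp

theorem sum_mul_polytope_le {m d : ℕ} {c x q : Fin d → ℝ} {α : ℝ}
    (hm : 1 ≤ m) (hc1 : ∀ i, c i ≤ 1) (hcs : ∑ i, c i = m) (h1 : α ≤ 1)
    (hq : q ∈ stdSimplex ℝ (Fin d)) (h : ∀ i, x i = α / (m : ℝ) ^ 2 + (1 - α) * q i) :
    ∑ i, c i * x i ≤ α / m + (1 - α) := by
  have hm' : (0 : ℝ) < m := by exact_mod_cast hm
  have e : ∑ i, c i * x i = α / (m : ℝ) ^ 2 * ∑ i, c i + (1 - α) * ∑ i, c i * q i := by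
    rw [Finset.mul_sum, Finset.mul_sum, ← Finset.sum_add_distrib]
    exact Finset.sum_congr rfl fun i _ => by rw [h]; ring
  have h2 := mul_le_mul_of_nonneg_left (sum_mul_le_one_of_mem_simplex hc1 hq)
    (by linarith : 0 ≤ 1 - α)
  have h3 : α / (m : ℝ) ^ 2 * m = α / m := by field_simp
  rw [e, hcs, h3]
  linarith

namespace OCOInstance

variable {d : ℕ} {I : OCOInstance d} {c : ℕ → Fin d → ℝ} {e : Fin d → ℝ}

/-- A return to the level `1 / m²`, the other alternative in the one-step bound, is absorbed because
the claimed bound never falls below that level. -/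
theorem polytope_euclidean_run_le (hI : IsLinearWith I c e) (hc0 : ∀ t i, 0 ≤ c t i) {m : ℕ}
    (hm : 2 ≤ m) (hd : d = m ^ 3) (hK : I.K = polytope d)
    (hstart : I.start = fun _ => 1 / (m : ℝ) ^ 2) {κ : ℝ} (hκ : 0 ≤ κ) (β : EqualPartition d 1)
    (ω : I.Ω) (t : ℕ) (i : Fin d) :
    I.run κ (fun β : EqualPartition d 1 => blockGeometry β) β ω t i ≤ 1 / (m : ℝ) ^ 2 +
      I.stepSize κ (fun β : EqualPartition d 1 => blockGeometry β) β *
        ∑ s ∈ Finset.range t, c s i := by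
  set 𝒢 : EqualPartition d 1 → Geometry d := fun β => blockGeometry β with h𝒢
  have hscale : I.scale (𝒢 β) = 1 := I.scale_eq_one fun x hx =>
    blockNorm_polytope_le (by omega) hd one_pos β (by rwa [hK] at hx) le_rfl
      (one_block_const (by omega) hd)
  have hsK : I.scaledK (𝒢 β) = polytope d := by simp [scaledK, hscale, hK]
  have hη := stepSize_nonneg (I := I) κ hκ 𝒢 β
  have hmem : ∀ t, I.run κ 𝒢 β ω t ∈ polytope d := fun t => by
    rw [← hsK]
    exact I.run_mem κ 𝒢 β ω (differentiable_blockMirror β).continuous.continuousOn t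
  induction t with
  | zero =>
    have : I.run κ 𝒢 β ω 0 i = 1 / (m : ℝ) ^ 2 := by
      change I.scaledStart (𝒢 β) i = _
      simp [scaledStart, hscale, hstart]
    rw [this]
    simp
  | succ t ih =>
    have h := polytope_euclidean_step_le hm hd
      (a := fun i => I.stepSize κ 𝒢 β * c t i) (fun i => mul_nonneg hη (hc0 t i))
      (hmem t) (hmem (t + 1)) (fun z hz => by
        have h1 := run_first_order hI κ 𝒢 β ω (differentiable_blockMirror β) t
          (z := z) (by rwa [hK])
        refine h1.trans_eq (Finset.sum_congr rfl fun i _ => ?_)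
        rw [grad_blockMirror_one, grad_blockMirror_one, mirrorDeriv_one, mirrorDeriv_one, hscale]
        simp) i
    have h2 : 0 ≤ I.stepSize κ 𝒢 β * ∑ s ∈ Finset.range (t + 1), c s i :=
      mul_nonneg hη (Finset.sum_nonneg fun s _ => hc0 s i)
    refine h.trans (max_le (by linarith) ?_)
    rw [Finset.sum_range_succ, mul_add]
    linarith

theorem polytope_scale_eq {m : ℕ} (hm : 1 ≤ m) (hd : d = m ^ 3) (hK : I.K = polytope d)
    (β : EqualPartition d d) : I.scale (blockGeometry β) = m := by
  have hm' : (1 : ℝ) ≤ m := by exact_mod_cast hm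
  have hd0 : 0 < d := by rw [hd]; positivity
  have h : IsGreatest ((blockGeometry β).norm '' I.K) m := by
    rw [hK]
    refine ⟨⟨_, const_mem_polytope hd, ?_⟩, ?_⟩
    · rw [blockNorm_const hd0 β (by positivity), all_blocks_const hm hd]
    · rintro _ ⟨x, hx, rfl⟩
      exact blockNorm_polytope_le hm hd hd0 β hx hm' (all_blocks_const hm hd).le
  rw [scale, h.csSup_eq, max_eq_right hm']

/-- Mirror descent with `h_d` on the rescaled polytope stays close to the constant vertex: the
potential `∑ φ(x_j) - m² φ(x_{i₀})` decreases by at most `η m³` per round. -/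
theorem polytope_potential_run (hI : IsLinearWith I c e) (hc0 : ∀ t i, 0 ≤ c t i)
    (hc1 : ∀ t i, c t i ≤ 1) {m : ℕ} (hm : 2 ≤ m) (hd : d = m ^ 3) (hK : I.K = polytope d)
    (hstart : I.start = fun _ => 1 / (m : ℝ) ^ 2) {κ : ℝ} (hκ : 0 ≤ κ) (β : EqualPartition d d)
    {i₀ : Fin d} (hi₀ : ∀ t, c t i₀ = 1) (ω : I.Ω) (t : ℕ) :
    (d - (m : ℝ) ^ 2) * Real.log d -
        d * (I.stepSize κ (fun β : EqualPartition d d => blockGeometry β) β * t) ≤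
      ∑ i, mirrorDeriv d (I.run κ (fun β : EqualPartition d d => blockGeometry β) β ω t i) -
        (m : ℝ) ^ 2 * mirrorDeriv d
          (I.run κ (fun β : EqualPartition d d => blockGeometry β) β ω t i₀) := by
  set 𝒢 : EqualPartition d d → Geometry d := fun β => blockGeometry β with h𝒢
  have hm' : (2 : ℝ) ≤ m := by exact_mod_cast hm
  have hd2 : 2 < d := by
    have : 2 ^ 3 ≤ m ^ 3 := Nat.pow_le_pow_left hm 3
    omega
  have hdm : (d : ℝ) = (m : ℝ) ^ 3 := by rw [hd]; push_cast; ring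
  have hscale : I.scale (𝒢 β) = m := polytope_scale_eq (by omega) hd hK β
  have hη := stepSize_nonneg (I := I) κ hκ 𝒢 β
  set η := I.stepSize κ 𝒢 β
  set X := I.run κ 𝒢 β ω with hX
  have hmem : ∀ t, (m : ℝ) • X t ∈ polytope d := fun t => by
    rw [← hK, ← hscale]
    exact I.smul_mem_of_mem_scaledK
      (I.run_mem κ 𝒢 β ω (differentiable_blockMirror β).continuous.continuousOn t)
  have hXm : ∀ t i, X t i = (m : ℝ)⁻¹ * ((m : ℝ) • X t) i := fun t i => by
    rw [Pi.smul_apply, smul_eq_mul, inv_mul_cancel_left₀ (by linarith)]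
  have hnn : ∀ t i, 0 ≤ X t i := fun t i => by
    rw [hXm]
    exact mul_nonneg (by positivity) (polytope_nonneg (by omega) hd (hmem t) i)
  have hconst : (m : ℝ)⁻¹ * (1 / (m : ℝ) ^ 2) = 1 / d := by
    rw [hdm]; field_simp
  have hval : ∀ x : Fin d → ℝ, (∀ i, x i = 1 / d) → ∑ i, mirrorDeriv d (x i) -
      (m : ℝ) ^ 2 * mirrorDeriv d (x i₀) = (d - (m : ℝ) ^ 2) * Real.log d := by
    intro x hx
    simp only [hx, mirrorDeriv_inv hd2, Finset.sum_const, Finset.card_univ, Fintype.card_fin,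
      nsmul_eq_mul]
    ring
  have key : ∀ t : ℕ, (∀ i, mirrorDeriv d (X t i) ≤ mirrorDeriv d (X t i₀)) ∧
      (d - (m : ℝ) ^ 2) * Real.log d - d * (η * t) ≤
        ∑ i, mirrorDeriv d (X t i) - (m : ℝ) ^ 2 * mirrorDeriv d (X t i₀) := by
    intro t
    induction t with
    | zero =>
      have h0 : ∀ i, X 0 i = 1 / d := by
        intro i
        change I.scaledStart (𝒢 β) i = _
        rw [scaledStart, hscale, hstart, ← hconst]
        rfl
      refine ⟨fun i => by rw [h0, h0], ?_⟩
      rw [hval _ h0]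
      simp
    | succ t ih =>
      have h := polytope_potential_step (by omega) hd (mirrorDeriv_strictMonoOn (n := d) (by omega))
        (ρ := (m : ℝ)⁻¹) (by positivity) (x := X t) (y := X (t + 1)) (y' := (m : ℝ) • X (t + 1))
        (a := fun i => η * m * c t i) (i₀ := i₀)
        (fun i => mul_nonneg (by positivity) (hc0 t i))
        (fun i => mul_le_mul_of_nonneg_left (by rw [hi₀]; exact hc1 t i) (by positivity))
        (hmem (t + 1)) (hXm (t + 1)) (fun z hz => by
          have h1 := run_first_order hI κ 𝒢 β ω (differentiable_blockMirror β) t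
            (z := z) (by rwa [hK])
          refine h1.trans_eq (Finset.sum_congr rfl fun i _ => ?_)
          rw [grad_blockMirror_self β _ _ (hnn t i), grad_blockMirror_self β _ _ (hnn (t + 1) i),
            hscale]) ih.1
      refine ⟨h.1, ?_⟩
      push_cast
      rcases h.2 with h2 | h2
      · rw [hconst] at h2
        rw [hval _ h2]
        have : 0 ≤ (d : ℝ) * (η * (t + 1)) := by positivity
        linarith
      · refine le_trans ?_ h2
        -- The extra factor `m` comes from the rescaled loss.
        have e2 : (m : ℝ) ^ 2 * (η * m * c t i₀) = d * η := by rw [hi₀, hdm]; ring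
        linarith [ih.2]
  exact (key t).2

/-- A potential close to its initial value forces `∑ X ≥ 7/8` by concavity of the dual map. After
undoing the rescaling, the coordinate sum is `α m + (1 - α)`, so a sum near `m` means that the
weight `1 - α` off the constant vertex is at most `1/4`; the constant vertex gains only `1/m`. -/
theorem polytope_gain_le (hI : IsLinearWith I c e) (hc0 : ∀ t i, 0 ≤ c t i)
    (hc1 : ∀ t i, c t i ≤ 1) {m : ℕ} (hm : 8 ≤ m) (hd : d = m ^ 3) (hK : I.K = polytope d)
    (hcs : ∀ t, ∑ i, c t i = m)
    (hstart : I.start = fun _ => 1 / (m : ℝ) ^ 2) {κ : ℝ} (hκ : 0 ≤ κ) (β : EqualPartition d d)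
    {i₀ : Fin d} (hi₀ : ∀ t, c t i₀ = 1) (hlog : 16 * Real.log d ≤ m) (ω : I.Ω) (t : ℕ)
    (ht : I.stepSize κ (fun β : EqualPartition d d => blockGeometry β) β * t ≤ 1 / 16) :
    I.scale (blockGeometry β) *
      ∑ i, c t i * I.run κ (fun β : EqualPartition d d => blockGeometry β) β ω t i ≤ 1 / 2 := by
  have hpot := polytope_potential_run hI hc0 hc1 (by omega) hd hK hstart hκ β hi₀ ω t
  set 𝒢 : EqualPartition d d → Geometry d := fun β => blockGeometry β with h𝒢
  have hm' : (8 : ℝ) ≤ m := by exact_mod_cast hm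
  have hd2 : 2 < d := by
    have : 8 ^ 3 ≤ m ^ 3 := Nat.pow_le_pow_left hm 3
    omega
  have hdm : (d : ℝ) = (m : ℝ) ^ 3 := by rw [hd]; push_cast; ring
  have hscale : I.scale (blockGeometry β) = m := polytope_scale_eq (by omega) hd hK β
  set η := I.stepSize κ 𝒢 β
  set X := I.run κ 𝒢 β ω with hX
  have hmem : (m : ℝ) • X t ∈ polytope d := by
    rw [← hK, ← hscale]
    exact I.smul_mem_of_mem_scaledK
      (I.run_mem κ 𝒢 β ω (differentiable_blockMirror β).continuous.continuousOn t)
  have hnn : ∀ i, 0 ≤ X t i := fun i => by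
    have := polytope_nonneg (by omega) hd hmem i
    exact nonneg_of_mul_nonneg_right (by simpa using this) (by linarith)
  have hφ0 : 0 ≤ mirrorDeriv d (X t i₀) :=
    mul_nonneg (one_div_pos.2 (gam_pos d (by omega))).le (Real.rpow_nonneg (hnn i₀) _)
  have hup : ∑ i, mirrorDeriv d (X t i) ≤ d * Real.log d + (d * ∑ i, X t i - d) := by
    calc _ ≤ ∑ i, (Real.log d + (d * X t i - 1)) :=
          Finset.sum_le_sum fun i _ => mirrorDeriv_le hd2 (hnn i)
      _ = _ := by
          rw [Finset.sum_add_distrib, Finset.sum_sub_distrib, ← Finset.mul_sum]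
          simp
  have hs : 7 / 8 ≤ ∑ i, X t i := by
    have h1 : (m : ℝ) ^ 2 * Real.log d ≤ d * (1 / 16) := by
      calc (m : ℝ) ^ 2 * Real.log d ≤ (m : ℝ) ^ 2 * (m / 16) := by gcongr; linarith
        _ = (d : ℝ) * (1 / 16) := by rw [hdm]; ring
    have h2 : (d : ℝ) * (η * t) ≤ d * (1 / 16) := by gcongr
    have h3 : 0 ≤ (m : ℝ) ^ 2 * mirrorDeriv d (X t i₀) := by positivity
    have h4 : (d : ℝ) * (7 / 8) ≤ d * ∑ i, X t i := by linarith
    exact le_of_mul_le_mul_left h4 (by positivity)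
  obtain ⟨α, h0, h1, q, hq, h⟩ := (mem_polytope_iff (by omega) hd).1 hmem
  have hsum := sum_polytope_eq (by omega) hd hq h
  have e1 : ∑ i, ((m : ℝ) • X t) i = m * ∑ i, X t i := by
    rw [Finset.mul_sum]; rfl
  have e2 : I.scale (blockGeometry β) * ∑ i, c t i * X t i = ∑ i, c t i * ((m : ℝ) • X t) i := by
    rw [hscale, Finset.mul_sum]
    exact Finset.sum_congr rfl fun i _ => by simp; ring
  rw [e1] at hsum
  rw [e2]
  refine (sum_mul_polytope_le (by omega) (hc1 t) (hcs t) h1 hq h).trans ?_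
  have h2 : α / m ≤ 1 / 8 := by
    rw [div_le_div_iff₀ (by linarith) (by norm_num)]
    linarith
  have h3 : (1 - α) * (m - 1) ≤ m / 8 := by nlinarith
  have h4 : (1 - α) ≤ 1 / 4 := by
    by_contra! hc
    nlinarith
  linarith

/-- Rescaling by `m` makes `G ≥ m`, so `η t ≤ 1 / 16` holds for order `m √T / √(ln d)` rounds. This
is weakened to `√(m T)` through `ln d ≤ m`, enough for the claimed ratio. -/
theorem le_polytope_blockRegret (hI : IsLinearWith I c e) (hc0 : ∀ t i, 0 ≤ c t i)
    (hc1 : ∀ t i, c t i ≤ 1) {m : ℕ} (hm : 8 ≤ m) (hd : d = m ^ 3) (hK : I.K = polytope d)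
    (hcs : ∀ t, ∑ i, c t i = m)
    (hstart : I.start = fun _ => 1 / (m : ℝ) ^ 2) {κ : ℝ} (hκ : 0 < κ)
    {i₀ : Fin d} (hi₀ : ∀ t, c t i₀ = 1) (hlog : 16 * Real.log d ≤ m) (hT : m ≤ I.T) :
    min 1 (1 / (32 * κ)) / 2 * (Real.sqrt m * Real.sqrt I.T) ≤ I.blockRegret κ d := by
  have : Nonempty (EqualPartition d d) := nonempty_equalPartition dvd_rfl
  set 𝒢 : EqualPartition d d → Geometry d := fun β => blockGeometry β with h𝒢
  have hm' : (8 : ℝ) ≤ m := by exact_mod_cast hm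
  have hd2 : 2 < d := by
    have : 8 ^ 3 ≤ m ^ 3 := Nat.pow_le_pow_left hm 3
    omega
  have hl := one_lt_log hd2
  have hscale : ∀ β, I.scale (𝒢 β) = m := fun β => polytope_scale_eq (by omega) hd hK β
  have hmT : (m : ℝ) ≤ I.T := by exact_mod_cast hT
  have hT' : (0 : ℝ) < I.T := by linarith
  have hG := le_gradBound_of_le_dualNorm hI 𝒢 (by exact_mod_cast hT') (Nat.cast_nonneg m)
    fun β => by
      rw [hscale]
      rw [dualNorm_mul β (-(m : ℝ)) (c 0), abs_neg, Nat.abs_cast]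
      exact le_mul_of_one_le_right (Nat.cast_nonneg m) (one_le_dualNorm β (hi₀ 0))
  have hgam : 1 / gam d = Real.exp 1 * Real.log d := by
    rw [gam, if_neg (by omega), if_neg (by omega), one_div_one_div]
  have hsc : ∀ β, ∀ z ∈ I.scaledK (𝒢 β), (∀ i, 0 ≤ z i) ∧ (blockGeometry β).norm z ≤ 1 := by
    rintro β _ ⟨x, hx, rfl⟩
    rw [hK] at hx
    have hinv : 0 ≤ (I.scale (𝒢 β))⁻¹ := by rw [hscale]; positivity
    refine ⟨fun i => mul_nonneg hinv (polytope_nonneg (by omega) hd hx i), ?_⟩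
    simp only
    rw [blockNorm_smul β x hinv, hscale, inv_mul_le_iff₀ (by linarith), mul_one]
    exact blockNorm_polytope_le (by omega) hd (by omega) β hx (by linarith)
      (all_blocks_const (by omega) hd).le
  have hstep : ∀ β, I.stepSize κ 𝒢 β ≤
      κ * (2 * Real.sqrt (Real.log d)) / (m * Real.sqrt I.T) := by
    intro β
    have := stepSize_le (I := I) hκ.le 𝒢 β (by linarith) hG (D := Real.exp 1 * Real.log d)
      (by positivity) fun z hz => by
        have h1 := hsc β z hz
        have h2 := hsc β _ (I.scaledStart_mem (𝒢 β))
        rw [← hgam]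
        exact bregman_blockMirror_le (by omega) β h1.1 h2.1 h1.2 h2.2
    refine this.trans ?_
    gcongr
    exact sqrt_exp_mul_le (by linarith)
  have hs0 := Real.sqrt_pos.2 hT'
  have hL0 := Real.sqrt_pos.2 (by linarith : 0 < Real.log d)
  refine le_trans (min_mul_sqrt_le
    (l := 1 / 16 / (κ * (2 * Real.sqrt (Real.log d)) / (m * Real.sqrt I.T))) hT'.le hmT ?_)
    (le_expRegret_of_stepSize_le hI κ 𝒢
      (fun β => (differentiable_blockMirror β).continuous.continuousOn) (by positivity)
      (by norm_num) hstep fun β ω t ht =>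
        polytope_gain_le hI hc0 hc1 hm hd hK hcs hstart hκ.le β hi₀ hlog ω t ht)
  have h1 : Real.sqrt (Real.log d) ≤ Real.sqrt m := Real.sqrt_le_sqrt (by linarith)
  have h2 : Real.sqrt m * Real.sqrt m = m := Real.mul_self_sqrt (by linarith)
  rw [div_div_eq_mul_div, le_div_iff₀ (by positivity)]
  calc 1 / (32 * κ) * (Real.sqrt m * Real.sqrt I.T) * (κ * (2 * Real.sqrt (Real.log d)))
      = 1 / 16 * (Real.sqrt m * Real.sqrt (Real.log d) * Real.sqrt I.T) := by
        field_simp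
        norm_num
    _ ≤ 1 / 16 * (Real.sqrt m * Real.sqrt m * Real.sqrt I.T) := by gcongr
    _ = _ := by rw [h2]

end OCOInstance

/-! ### The family of instances on the polytope -/

/-- The instance on the polytope `conv(Δ_d ∪ {d^{-2/3} 1})` for `d = m ^ 3`, started at the
constant vertex, with `m`-sparse losses. -/
noncomputable def polytopeInstance (d T : ℕ) : OCOInstance d :=
  open Classical in
  if h : ∃ m : ℕ, 1 ≤ m ∧ d = m ^ 3 then
    linearInstance (polytope d) (convex_convexHull ℝ _)
      (isCompact_polytope h.choose_spec.1 h.choose_spec.2)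
      (fun _ => 1 / (h.choose : ℝ) ^ 2) (const_mem_polytope h.choose_spec.2) T
      (sparseVec d h.choose)
  else linearInstance {0} (convex_singleton 0) isCompact_singleton 0 rfl T 0

theorem polytopeInstance_spec {m d : ℕ} (hm : 1 ≤ m) (hd : d = m ^ 3) (T : ℕ) :
    (polytopeInstance d T).K = polytope d ∧ (polytopeInstance d T).T = T ∧
      (polytopeInstance d T).start = (fun _ => 1 / (m : ℝ) ^ 2) ∧
      ∀ t ω x, (polytopeInstance d T).loss t ω x = -∑ i, sparseVec d m t i * x i := by
  have h : ∃ m : ℕ, 1 ≤ m ∧ d = m ^ 3 := ⟨m, hm, hd⟩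
  have hc : h.choose = m :=
    Nat.pow_left_injective (n := 3) (by norm_num) (h.choose_spec.2.symm.trans hd)
  rw [polytopeInstance, dif_pos h]
  refine ⟨rfl, rfl, ?_, fun t _ x => ?_⟩
  · simp only [linearInstance, hc]
  · simp only [linearInstance, hc]

theorem exists_cube_threshold : ∃ m₀ : ℕ, 10 ≤ m₀ ∧ ∀ m : ℕ, m₀ ≤ m →
    16 * Real.log ((m ^ 3 : ℕ) : ℝ) ≤ m := by
  have h1 := Real.isLittleO_log_id_atTop.bound (c := 1 / 48) (by norm_num)
  have h2 := tendsto_natCast_atTop_atTop (R := ℝ).eventually h1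
  obtain ⟨m₀, h⟩ := Filter.eventually_atTop.1 h2
  refine ⟨max m₀ 10, le_max_right _ _, fun m hm => ?_⟩
  have h3 := h m ((le_max_left _ _).trans hm)
  rw [Real.norm_eq_abs, id, Real.norm_natCast] at h3
  have h4 := (le_abs_self _).trans h3
  push_cast
  rw [Real.log_pow]
  push_cast
  linarith

theorem polytope_improvement : ∃ I : (d T : ℕ) → OCOInstance d,
    (∀ m d T : ℕ, 1 ≤ m → d = m ^ 3 →
      (I d T).K = polytope d ∧ (I d T).T = T ∧ (I d T).SparseLinear m) ∧
    ∀ κ₁ κ₂ κ₃ : ℝ, 0 < κ₁ → 0 < κ₂ → 0 < κ₃ →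
      ∃ c : ℝ, 0 < c ∧ ∃ k m₀ : ℕ, ∀ m d T : ℕ, m₀ ≤ m → d = m ^ 3 → m ≤ T →
        0 < (I d T).blockRegret κ₃ m ∧
        c * ((d : ℝ) ^ (1 / 6 : ℝ) / Real.log d ^ k) * (I d T).blockRegret κ₃ m ≤
          min ((I d T).eucRegret κ₁) ((I d T).blockRegret κ₂ d) := by
  refine ⟨polytopeInstance, fun m d T hm hd => ?_, fun κ₁ κ₂ κ₃ h1 h2 h3 => ?_⟩
  · obtain ⟨hK, hT, -, hl⟩ := polytopeInstance_spec hm hd T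
    exact ⟨hK, hT, sparseLinear_of_sparseVec (by rw [hd]; exact Nat.le_self_pow (by norm_num) m) hl⟩
  obtain ⟨m₀, hm₀, hlog⟩ := exists_cube_threshold
  set A := min 1 (1 / (4 * κ₁)) / 2 with hA
  set B := min 1 (1 / (32 * κ₂)) / 2 with hB
  have hA0 : 0 < A := by positivity
  have hB0 : 0 < B := by positivity
  set c₀ := min A B with hc₀
  have hc₀0 : 0 < c₀ := by positivity
  -- One power of `ln d` suffices: the upper bound for `m` blocks is `5 (1 / κ₃ + κ₃) ln m √T`, and
  -- `ln m ≤ ln d`.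
  refine ⟨c₀ / (5 * (1 / κ₃ + κ₃)), by positivity, 1, m₀, fun m d T hm hd hT => ?_⟩
  have hm10 : 10 ≤ m := hm₀.trans hm
  have hm' : (10 : ℝ) ≤ m := by exact_mod_cast hm10
  have hlogd : 16 * Real.log d ≤ m := by rw [hd]; exact hlog m hm
  have hd0 : 0 < d := by rw [hd]; positivity
  have hdm : (d : ℝ) = (m : ℝ) ^ 3 := by rw [hd]; push_cast; ring
  have hmd : m ≤ d := by rw [hd]; exact Nat.le_self_pow (by norm_num) m
  have hm1 : 1 ≤ m := by omega
  obtain ⟨hK, hTI, hstart, hloss⟩ := polytopeInstance_spec hm1 hd T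
  set I := polytopeInstance d T with hI'
  have hcs := sum_sparseVec hm1 hmd
  have hle : ∀ t, ∀ x ∈ I.K, ∑ i, sparseVec d m t i * x i ≤ 1 := by
    intro t x hx
    rw [hK] at hx
    obtain ⟨α, h0, h1', q, hq, h⟩ := (mem_polytope_iff hm1 hd).1 hx
    refine (sum_mul_polytope_le hm1 (sparseVec_le_one d m t) (hcs t) h1' hq h).trans ?_
    have : α / m ≤ α := div_le_self h0 (by linarith)
    linarith
  have hI : IsLinearWith I (sparseVec d m) (Pi.single ⟨0, hd0⟩ 1) :=
    isLinearWith_sparseVec hd0 hm1 hloss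
      (by rw [hK]; exact simplex_subset_polytope (single_mem_stdSimplex ℝ _)) hle
  have hK0 : ∀ x ∈ I.K, ∀ i, 0 ≤ x i := fun x hx i => by
    rw [hK] at hx
    exact polytope_nonneg hm1 hd hx i
  have hTm : m ≤ I.T := by rw [hTI]; exact hT
  have hT0 : 0 < I.T := by omega
  have hstart1 : ∑ i, sparseVec d m 0 i * I.start i < 1 := by
    rw [hstart, ← Finset.sum_mul, hcs, mul_one_div, div_lt_one (by positivity)]
    nlinarith
  have hneM : Nonempty (EqualPartition d m) :=
    nonempty_equalPartition (by rw [hd]; exact dvd_pow_self m (by norm_num))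
  have hup := OCOInstance.blockRegret_le hI h3 (n := m) (by omega)
    (by rw [hd]; exact dvd_pow_self m (by norm_num)) hT0 hstart1 (sparseVec_zero_or_one d m)
    (fun t => by rw [hcs]; linarith) hK0 (fun β x hx => by
      rw [hK] at hx
      exact blockNorm_polytope_le hm1 hd hm1 β hx le_rfl (cube_root_blocks_const hm1 hd))
  have hpos : 0 < I.blockRegret κ₃ m := OCOInstance.expRegret_pos hI κ₃ _
    (fun β => (differentiable_blockMirror β).continuous.continuousOn) hT0 hstart1
  refine ⟨hpos, ?_⟩
  have hN : 4 * m ≤ d / m := by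
    rw [Nat.le_div_iff_mul_le hm1, hd]
    calc 4 * m * m ≤ m * m * m := by gcongr; omega
      _ = m ^ 3 := by ring
  have hbS : 1 / (m : ℝ) ^ 2 * (1 + m) ≤ 1 / 8 := by
    rw [one_div_mul_eq_div, div_le_iff₀ (by positivity)]
    nlinarith
  have heuc : A * (Real.sqrt m * Real.sqrt I.T) ≤ I.eucRegret κ₁ :=
    OCOInstance.le_eucRegret hI h1 hm1 hTm (sparseVec_zero_or_one d m 0) (hcs 0) hK0
      (fun β x hx => by
        rw [hK] at hx
        exact blockNorm_polytope_le hm1 hd one_pos β hx le_rfl (one_block_const hm1 hd))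
      fun β ω t ht => sum_sparseVec_mul_le hm1 hmd hN (b := 1 / (m : ℝ) ^ 2) (by positivity)
        (OCOInstance.stepSize_nonneg κ₁ h1.le _ β) hbS ht fun i =>
          OCOInstance.polytope_euclidean_run_le hI (sparseVec_nonneg d m) (by omega) hd hK hstart
            h1.le β ω t i
  have hblk : B * (Real.sqrt m * Real.sqrt I.T) ≤ I.blockRegret κ₂ d :=
    OCOInstance.le_polytope_blockRegret hI (sparseVec_nonneg d m) (sparseVec_le_one d m)
      (by omega) hd hK hcs hstart h2 (fun t => sparseVec_zero hm1 t hd0) hlogd hTm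
  set s := Real.sqrt I.T with hs
  have hs0 : 0 ≤ s := Real.sqrt_nonneg _
  have hLs : 0 ≤ Real.sqrt m * s := by positivity
  have hmain : c₀ * (Real.sqrt m * s) ≤ min (I.eucRegret κ₁) (I.blockRegret κ₂ d) :=
    le_min ((mul_le_mul_of_nonneg_right (min_le_left _ _) hLs).trans heuc)
      ((mul_le_mul_of_nonneg_right (min_le_right _ _) hLs).trans hblk)
  refine le_trans ?_ hmain
  have hroot : (d : ℝ) ^ (1 / 6 : ℝ) = Real.sqrt m := by
    rw [hdm, ← Real.rpow_natCast, ← Real.rpow_mul (Nat.cast_nonneg m), Real.sqrt_eq_rpow]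
    norm_num
  have hlogm : Real.log m ≤ Real.log d := Real.log_le_log (by positivity) (by exact_mod_cast hmd)
  have hlogm1 : 1 < Real.log m := one_lt_log (by omega)
  have hlogd0 : 0 < Real.log d := by linarith
  rw [hroot, pow_one]
  calc c₀ / (5 * (1 / κ₃ + κ₃)) * (Real.sqrt m / Real.log d) * I.blockRegret κ₃ m
      ≤ c₀ / (5 * (1 / κ₃ + κ₃)) * (Real.sqrt m / Real.log d) *
          (5 * (1 / κ₃ + κ₃) * Real.log d * s) := by
        refine mul_le_mul_of_nonneg_left (hup.trans ?_) (by positivity)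
        gcongr
    _ = c₀ * (Real.sqrt m * s) := by
        field_simp

end OCO

theorem theorem2 :
    -- Part 1: a polynomial improvement; `d = m ^ 3` and OEG is mirror descent with `h_d`.
    (∃ I : (d T : ℕ) → OCO.OCOInstance d,
      (∀ m d T : ℕ, 1 ≤ m → d = m ^ 3 →
        (I d T).K = OCO.polytope d ∧ (I d T).T = T ∧ (I d T).SparseLinear m) ∧
      ∀ κ₁ κ₂ κ₃ : ℝ, 0 < κ₁ → 0 < κ₂ → 0 < κ₃ →
        ∃ c : ℝ, 0 < c ∧ ∃ k m₀ : ℕ, ∀ m d T : ℕ, m₀ ≤ m → d = m ^ 3 → m ≤ T →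
          0 < (I d T).blockRegret κ₃ m ∧
          c * ((d : ℝ) ^ (1 / 6 : ℝ) / Real.log d ^ k) * (I d T).blockRegret κ₃ m ≤
            min ((I d T).eucRegret κ₁) ((I d T).blockRegret κ₂ d)) ∧
    -- Part 2: a logarithmic improvement on the simplex, for OEG with the entropic mirror map as
    -- well as for mirror descent with `h_d`.
    (∃ I : (d T : ℕ) → OCO.OCOInstance d,
      (∀ d T : ℕ, 1 ≤ d →
        (I d T).K = stdSimplex ℝ (Fin d) ∧ (I d T).T = T ∧
          (I d T).SparseLinear ⌊Real.log d⌋₊) ∧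
      ∀ κ₁ κ₂ κ₃ : ℝ, 0 < κ₁ → 0 < κ₂ → 0 < κ₃ →
        ∃ c : ℝ, 0 < c ∧ ∃ d₀ : ℕ, ∀ d n T : ℕ, d₀ ≤ d → n ∣ d →
          Real.log d / 2 ≤ n → (n : ℝ) ≤ 2 * Real.log d → Real.log d ≤ T →
          0 < (I d T).blockRegret κ₃ n ∧
          c * (Real.sqrt (Real.log d) / Real.log (Real.log d)) * (I d T).blockRegret κ₃ n ≤
            min ((I d T).eucRegret κ₁)
              (min ((I d T).entRegret κ₂) ((I d T).blockRegret κ₂ d))) :=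
  ⟨OCO.polytope_improvement, OCO.simplex_improvement⟩
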